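/- Conventions. Let $p$ be a prime. A \emph{$p$-elementary quadratic form} is a pair $(V,q)$, where $V$ is a finite $\mathbb{Z}/p\mathbb{Z}$-module and $q\colon V\to\mathbb{Q}/p\mathbb{Z}$ satisfies $q(rx)=r^2q(x)$ for $r\in\mathbb{Z}$, $x\in V$, such that $b_q(x,y)=q(x+y)-q(x)-q(y)$ is biadditive and non-degenerate (for every $x\neq 0$ there is $y$ with $b_q(x,y)\neq0$). A \emph{$p$-elementary symmetric bilinear form} is a non-degenerate symmetric biadditive map $b\colon V\times V\to\mathbb{Q}/p\mathbb{Z}$ on such a $V$. $O(q)$ and $O(b)$ denote the groups of linear automorphisms of $V$ preserving $q$, respectively $b$; $\cong$ denotes isometry, $\oplus$ orthogonal direct sum, and $\dim$ is the dimension over $\mathbb{Z}/p\mathbb{Z}$. Empty products equal $1$. Let $\mathbf h$ be the form $q(a,b)=ab$ on $(\mathbb{Z}/p\mathbb{Z})^2$; $q$ is \emph{hyperbolic} if $q\cong\mathbf h^{\oplus m}$ for some $m\ge 0$. For $p=2$ let $\mathbf u$ and $\mathbf v$ be the forms $q(a,b)=ab$ and $q(a,b)=a^2+ab+b^2$ on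 $(\mathbb{Z}/2\mathbb{Z})^2$, and let $\mathbf w^\varepsilon$ ($\varepsilon\in\{1,3\}$) be the form on $\mathbb{Z}/2\mathbb{Z}$ taking the value $\varepsilon/2$ on the generator. Let $\bar{\mathbf u}$ be the bilinear form of $\mathbf u$ and $\bar{\mathbf w}$ that of $\mathbf w^1$ (which is also that of $\mathbf w^3$). A $2$-elementary quadratic form $q$ is \emph{even} if $b_q(x,x)=0$ for all $x$. \textbf{Proposition.} (1) Let $q$ be a $2$-elementary quadratic form. If $q$ is even, then $q\cong\mathbf u^{\oplus m}$ for some $m\ge0$ or $q\cong\mathbf u^{\oplus m-1}\oplus\mathbf v$ for some $m\ge1$. If $q$ is not even, then there is an even $2$-elementary quadratic form $q'$ such that $q\cong q'\oplus\mathbf w^\varepsilon$ or $q\cong q'\oplus\mathbf w^\varepsilon\oplus\mathbf w^\varepsilon$ for some $\varepsilon\in\{1,3\}$, or $q\cong q'\oplus\mathbf w^1\oplus\mathbf w^3$. The orders of $O(q)$ and of $q^{-1}(\{0\})$ are as follows, where $q'$ is even and $\varepsilon\in\{1,3\}$: \begin{itemize} \item if $q\cong\mathbf u^{\oplus m}$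 with $m\ge1$: $\#O(q)=2^{m(m-1)+1}(2^m-1)\prod_{k=1}^{m-1}(2^{2k}-1)$ and $\#q^{-1}(\{0\})=2^{m-1}(2^m+1)$; for $m=0$ (the zero form) both numbers are $1$; \item if $q\cong\mathbf u^{\oplus m-1}\oplus\mathbf v$ with $m\ge1$: $\#O(q)=2^{m(m-1)+1}(2^m+1)\prod_{k=1}^{m-1}(2^{2k}-1)$ and $\#q^{-1}(\{0\})=2^{m-1}(2^m-1)$; \item if $q\cong q'\oplus\mathbf w^\varepsilon$: $\#O(q)=\#O(q')$ and $\#q^{-1}(\{0\})=\#q'^{-1}(\{0\})$; \item if $q\cong q'\oplus\mathbf w^\varepsilon\oplus\mathbf w^\varepsilon$: $\#O(q)=2\,\#O(b_{q'})$ and $\#q^{-1}(\{0\})=2^{\dim q'}$; \item if $q\cong q'\oplus\mathbf w^1\oplus\mathbf w^3$: $\#O(q)=2^{\dim q'}\,\#O(q')$ and $\#q^{-1}(\{0\})=2\,\#q'^{-1}(\{0\})$. \end{itemize} (2) Let $b$ be a $2$-elementary symmetric bilinear form. Then $b\cong\bar{\mathbf u}^{\oplus m}\oplus b''$ for some $m\ge0$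 and some $b''\in\{0,\bar{\mathbf w},\bar{\mathbf w}^{\oplus2}\}$, and \begin{itemize} \item if $b\cong\bar{\mathbf u}^{\oplus m}$: $\#O(b)=2^{m^2}\prod_{k=1}^m(2^{2k}-1)$; \item if $b\cong\bar{\mathbf u}^{\oplus m}\oplus\bar{\mathbf w}$: $\#O(b)=\#O(\bar{\mathbf u}^{\oplus m})$; \item if $b\cong\bar{\mathbf u}^{\oplus m}\oplus\bar{\mathbf w}^{\oplus2}$: $\#O(b)=2^{2m+1}\,\#O(\bar{\mathbf u}^{\oplus m})$. \end{itemize} (3) Let $p$ be an odd prime and $q$ a $p$-elementary quadratic form. \begin{itemize} \item If $\dim q=2m$ with $m\ge1$ and $q$ is hyperbolic: $\#O(q)=2p^{m(m-1)}(p^m-1)\prod_{k=1}^{m-1}(p^{2k}-1)$. \item If $\dim q=2m$ with $m\ge1$ and $q$ is not hyperbolic: $\#O(q)=2p^{m(m-1)}(p^m+1)\prod_{k=1}^{m-1}(p^{2k}-1)$. \item If $\dim q=2m+1$ with $m\ge0$: $\#O(q)=2p^{m^2}\prod_{k=1}^m(p^{2k}-1)$. \item If $\dim q=0$: $\#O(q)=1$.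 \end{itemize} -/

import Mathlib

namespace ElementaryForms

section General

variable {R M M₁ M₂ N : Type*} [CommRing R] [AddCommGroup M] [Module R M]
  [AddCommGroup M₁] [Module R M₁] [AddCommGroup M₂] [Module R M₂]
  [AddCommGroup N] [Module R N]

/-- An `N`-valued bilinear form is symmetric. -/
def IsSymmetric (b : LinearMap.BilinMap R M N) : Prop :=
  ∀ x y, b x y = b y x

/-- An `N`-valued (symmetric) bilinear form is non-degenerate: every nonzero `x` pairs
nontrivially with some `y`. -/
def BilinNondegenerate (b : LinearMap.BilinMap R M N) : Prop :=
  ∀ x, x ≠ 0 → ∃ y, b x y ≠ 0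

/-- The orthogonal group `O(b)` of a bilinear form. -/
def bilinO (b : LinearMap.BilinMap R M N) : Subgroup (M ≃ₗ[R] M) where
  carrier := {f | ∀ x y, b (f x) (f y) = b x y}
  mul_mem' := by
    intro f g hf hg x y
    rw [LinearEquiv.mul_apply, LinearEquiv.mul_apply, hf, hg]
  one_mem' := fun _ _ => rfl
  inv_mem' := by
    intro f hf x y
    have h := hf (f⁻¹ x) (f⁻¹ y)
    rw [← LinearEquiv.mul_apply, ← LinearEquiv.mul_apply, mul_inv_cancel] at h
    exact h.symm

/-- Isomorphism (isometry) of bilinear forms. -/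
def BilinIso (b₁ : LinearMap.BilinMap R M₁ N) (b₂ : LinearMap.BilinMap R M₂ N) : Prop :=
  ∃ f : M₁ ≃ₗ[R] M₂, ∀ x y, b₂ (f x) (f y) = b₁ x y

/-- The orthogonal direct sum `b₁ ⊕ b₂`. -/
def bilinSum (b₁ : LinearMap.BilinMap R M₁ N) (b₂ : LinearMap.BilinMap R M₂ N) :
    LinearMap.BilinMap R (M₁ × M₂) N :=
  b₁.compl₁₂ (LinearMap.fst R M₁ M₂) (LinearMap.fst R M₁ M₂) +
    b₂.compl₁₂ (LinearMap.snd R M₁ M₂) (LinearMap.snd R M₁ M₂)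

/-- The orthogonal direct sum of `m` copies of `b`. -/
def bilinPow (b : LinearMap.BilinMap R M N) (m : ℕ) :
    LinearMap.BilinMap R (Fin m → M) N :=
  ∑ i : Fin m, b.compl₁₂ (LinearMap.proj i) (LinearMap.proj i)

/-- The bilinear form associated with `q`: `b(x, y) = q(x + y) - q(x) - q(y)`. -/
abbrev assocBilin (q : QuadraticMap R M N) : LinearMap.BilinMap R M N := q.polarBilin

/-- A quadratic form is non-degenerate if its associated bilinear form is. -/
def QuadNondegenerate (q : QuadraticMap R M N) : Prop :=
  BilinNondegenerate (assocBilin q)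

/-- The associated bilinear form is alternating. -/
def IsEven (q : QuadraticMap R M N) : Prop :=
  ∀ x, assocBilin q x x = 0

/-- The orthogonal group `O(q)` of a quadratic form. -/
def quadO (q : QuadraticMap R M N) : Subgroup (M ≃ₗ[R] M) where
  carrier := {f | ∀ x, q (f x) = q x}
  mul_mem' := by
    intro f g hf hg x
    rw [LinearEquiv.mul_apply, hf, hg]
  one_mem' := fun _ => rfl
  inv_mem' := by
    intro f hf x
    have h := hf (f⁻¹ x)
    rw [← LinearEquiv.mul_apply, mul_inv_cancel] at h
    exact h.symm

/-- The orthogonal direct sum of `m` copies of `q`. -/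
abbrev quadPow (q : QuadraticMap R M N) (m : ℕ) : QuadraticMap R (Fin m → M) N :=
  QuadraticMap.pi fun _ : Fin m => q

end General

/-- The value group `ℚ/pℤ`. -/
abbrev QMod (p : ℕ) : Type := ℚ ⧸ AddSubgroup.zmultiples (p : ℚ)

/-- The embedding `ℤ/pℤ → ℚ/pℤ`, `n ↦ n`. -/
def zmodToQMod (p : ℕ) : ZMod p →ₗ[ℤ] QMod p :=
  (ZMod.lift p ⟨(QuotientAddGroup.mk' (AddSubgroup.zmultiples (p : ℚ))).comp
    (Int.castAddHom ℚ), by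
      simp [QuotientAddGroup.eq_zero_iff]⟩).toIntLinearMap

theorem zmodToQMod_intCast (p : ℕ) (n : ℤ) :
    zmodToQMod p (n : ZMod p) = ((n : ℚ) : QMod p) := by
  simp only [zmodToQMod, AddMonoidHom.coe_toIntLinearMap, ZMod.lift_coe]
  rfl

/-- The form `h` on `(ℤ/pℤ)²` (denoted `u` for `p = 2`): `q(a, b) = ab`. -/
noncomputable def formH (p : ℕ) : QuadraticMap ℤ (ZMod p × ZMod p) (QMod p) :=
  (zmodToQMod p).compQuadraticMap
    (QuadraticMap.linMulLin (LinearMap.fst ℤ (ZMod p) (ZMod p)) (LinearMap.snd ℤ (ZMod p) (ZMod p)))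

theorem formH_apply (p : ℕ) (a b : ZMod p) : formH p (a, b) = zmodToQMod p (a * b) := rfl

/-- The form `u` on `(ℤ/2ℤ)²`: `q(a, b) = ab`. -/
noncomputable abbrev formU : QuadraticMap ℤ (ZMod 2 × ZMod 2) (QMod 2) := formH 2

/-- The form `v` on `(ℤ/2ℤ)²`: `q(a, b) = a² + ab + b²`. -/
noncomputable def formV : QuadraticMap ℤ (ZMod 2 × ZMod 2) (QMod 2) :=
  (zmodToQMod 2).compQuadraticMap
    (QuadraticMap.linMulLin (LinearMap.fst ℤ (ZMod 2) (ZMod 2)) (LinearMap.fst ℤ (ZMod 2) (ZMod 2)) +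
     QuadraticMap.linMulLin (LinearMap.fst ℤ (ZMod 2) (ZMod 2)) (LinearMap.snd ℤ (ZMod 2) (ZMod 2)) +
     QuadraticMap.linMulLin (LinearMap.snd ℤ (ZMod 2) (ZMod 2)) (LinearMap.snd ℤ (ZMod 2) (ZMod 2)))

theorem formV_apply (a b : ZMod 2) :
    formV (a, b) = zmodToQMod 2 (a * a + a * b + b * b) := rfl

/-- The form `w^ε` on `ℤ/2ℤ`: `q(x) = ε/2` on the generator, hence `q(a x) = a² ε/2`. -/
def formW (ε : ℤ) : QuadraticMap ℤ (ZMod 2) (QMod 2) where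
  toFun a := (((a.val : ℚ) ^ 2 * ((ε : ℚ) / 2) : ℚ) : QMod 2)
  toFun_smul := by
    intro r x
    have key : ∀ k : ℤ, ((((2 * k * ε : ℤ) : ℚ)) : QMod 2) = 0 := by
      intro k
      rw [QuotientAddGroup.eq_zero_iff, AddSubgroup.mem_zmultiples_iff]
      exact ⟨k * ε, by simp; ring⟩
    obtain rfl | rfl : x = 0 ∨ x = 1 := by revert x; decide
    · simp
    · rw [← QuotientAddGroup.mk_zsmul, ← sub_eq_zero, ← QuotientAddGroup.mk_sub]
      rw [zsmul_one]
      obtain ⟨k, rfl | rfl⟩ := Int.even_or_odd' r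
      · have h : ((2 * k : ℤ) : ZMod 2) = 0 := by
          rw [Int.cast_mul]; exact (by decide : ∀ t : ZMod 2, 2 * t = 0) _
        rw [h, ← key (-k ^ 2)]
        congr 1
        simp [ZMod.val_one]
        ring
      · have h : ((2 * k + 1 : ℤ) : ZMod 2) = 1 := by
          rw [Int.cast_add, Int.cast_mul]
          exact (by decide : ∀ t : ZMod 2, 2 * t + 1 = 1) _
        rw [h, ← key (-(k ^ 2 + k))]
        congr 1
        simp [ZMod.val_one]
        ring
  exists_companion' := by
    refine ⟨ε • (LinearMap.mul ℤ (ZMod 2)).compr₂ (zmodToQMod 2), ?_⟩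
    have h1 : zmodToQMod 2 1 = ((1 : ℚ) : QMod 2) := by
      simpa using zmodToQMod_intCast 2 1
    intro x y
    obtain rfl | rfl : x = 0 ∨ x = 1 := by revert x; decide
    · simp
    obtain rfl | rfl : y = 0 ∨ y = 1 := by revert y; decide
    · simp
    rw [show (1 : ZMod 2) + 1 = 0 from rfl]
    simp only [LinearMap.smul_apply, LinearMap.compr₂_apply, LinearMap.mul_apply', mul_one, h1]
    rw [← QuotientAddGroup.mk_zsmul, ← QuotientAddGroup.mk_add, ← QuotientAddGroup.mk_add,
      eq_comm, ← sub_eq_zero, ← QuotientAddGroup.mk_sub, QuotientAddGroup.eq_zero_iff,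
      AddSubgroup.mem_zmultiples_iff]
    exact ⟨ε, by simp [ZMod.val_one]; ring⟩

theorem formW_one (ε : ℤ) : formW ε 1 = (((ε : ℚ) / 2 : ℚ) : QMod 2) := by
  change ((((1 : ZMod 2).val : ℚ) ^ 2 * ((ε : ℚ) / 2) : ℚ) : QMod 2) = _
  rw [ZMod.val_one, Nat.cast_one, one_pow, one_mul]

/-- The bilinear form of `u`. -/
noncomputable abbrev formUbar : LinearMap.BilinMap ℤ (ZMod 2 × ZMod 2) (QMod 2) := assocBilin formU

/-- The bilinear form of `w^1`; `w^3` has the same one. -/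
noncomputable abbrev formWbar : LinearMap.BilinMap ℤ (ZMod 2) (QMod 2) := assocBilin (formW 1)

/-- A quadratic form over `ℤ/pℤ` with values in `ℚ/pℤ` is hyperbolic if it is isomorphic to a
direct sum of copies of `h`. -/
def IsHyperbolic (p : ℕ) {V : Type*} [AddCommGroup V] (q : QuadraticMap ℤ V (QMod p)) : Prop :=
  ∃ m : ℕ, q.Equivalent (quadPow (formH p) m)

end ElementaryForms

/-! The values of `q` are killed by `p` when `p` is odd, and also when `p = 2` and `q` is even. The
form then factors through `ℤ/pℤ ⊂ ℚ/pℤ`, and these cases become statements about quadratic forms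
over a finite field with `s` elements.

Over a field, a non-degenerate form is a sum of hyperbolic planes and an anisotropic kernel
(`exists_witt_decomposition`). The isometry group acts transitively on hyperbolic pairs, by
reflections and Siegel transformations. Orbit-stabiliser then expresses `#O(h ⊕ Q)` as the number of
nonzero isotropic vectors times `#V` times `#O(Q)` (`card_quadO_hypPlane_prod`). Isotropic vectors
are counted by a recursion on the number of planes (`card_zeros_sub_one`), so only the kernel
remains. In odd characteristic it has dimension `d ≤ 2`, with isometry group of order `1`, `2` or
`2(s + 1)`. Over `ℤ/2ℤ` it is zero or the plane `v`, whose group is `GL₂(𝔽₂)`.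

The order of the symplectic group comes from `card_bilinO_eq`: a symplectic `g` changes `Q` by a
linear form `B(·, w)` with `Q w = 0`, and the transvection along `w` makes the same change, so `#Sp
= #Q⁻¹(0) · #O(Q)`.

For `p = 2` and `b` not alternating, `x ↦ b(x, x)` is linear, hence equal to `b(·, c)` for a
characteristic vector `c ≠ 0`. If `b(c, c) ≠ 0`, the line of `c` splits off with alternating
complement; otherwise a plane containing `c` does, and it is a sum of two lines. Every isometry
fixes `c`, so it acts on the split-off part through the image of at most one further vector. The
orbit of that vector is explicit and gives the orders. -/

namespace ElementaryForms

/-! ### Isometries, orthogonal splittings and orbit-stabiliser -/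

section Isometries

variable {R M M₁ M₂ N : Type*} [CommRing R] [AddCommGroup M] [Module R M]
  [AddCommGroup M₁] [Module R M₁] [AddCommGroup M₂] [Module R M₂]
  [AddCommGroup N] [Module R N]

theorem mem_quadO {q : QuadraticMap R M N} {f : M ≃ₗ[R] M} : f ∈ quadO q ↔ ∀ x, q (f x) = q x :=
  Iff.rfl

theorem mem_bilinO {b : LinearMap.BilinMap R M N} {f : M ≃ₗ[R] M} :
    f ∈ bilinO b ↔ ∀ x y, b (f x) (f y) = b x y :=
  Iff.rfl

theorem polar_map_of_preserves {q : QuadraticMap R M N} {f : M →ₗ[R] M} (hf : ∀ x, q (f x) = q x)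
    (x y : M) : QuadraticMap.polar q (f x) (f y) = QuadraticMap.polar q x y := by
  simp only [QuadraticMap.polar, ← map_add, hf]

theorem quadO_le_bilinO (q : QuadraticMap R M N) : quadO q ≤ bilinO (assocBilin q) :=
  fun f hf => polar_map_of_preserves (f := (f : M →ₗ[R] M)) hf

/-- Conjugation of automorphisms by a linear equivalence. -/
def autEquivOfLinearEquiv (e : M₁ ≃ₗ[R] M₂) : (M₁ ≃ₗ[R] M₁) ≃ (M₂ ≃ₗ[R] M₂) where
  toFun g := e.symm.trans (g.trans e)
  invFun g := e.trans (g.trans e.symm)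
  left_inv g := by ext x; simp
  right_inv g := by ext x; simp

theorem card_quadO_congr {q₁ : QuadraticMap R M₁ N} {q₂ : QuadraticMap R M₂ N}
    (h : q₁.Equivalent q₂) : Nat.card (quadO q₁) = Nat.card (quadO q₂) := by
  obtain ⟨e⟩ := h
  refine Nat.card_congr (Equiv.subtypeEquiv (autEquivOfLinearEquiv e.toLinearEquiv) ?_)
  intro g
  rw [mem_quadO, mem_quadO]
  constructor
  · intro hg x
    change q₂ (e (g (e.symm x))) = _
    rw [e.map_app, hg, e.symm.map_app]
  · intro hg x
    have := hg (e x)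
    change q₂ (e (g (e.symm (e x)))) = _ at this
    rw [e.map_app, e.map_app] at this
    simpa using this

theorem card_bilinO_congr {b₁ : LinearMap.BilinMap R M₁ N} {b₂ : LinearMap.BilinMap R M₂ N}
    (h : BilinIso b₁ b₂) : Nat.card (bilinO b₁) = Nat.card (bilinO b₂) := by
  obtain ⟨e, he⟩ := h
  refine Nat.card_congr (Equiv.subtypeEquiv (autEquivOfLinearEquiv e) ?_)
  intro g
  rw [mem_bilinO, mem_bilinO]
  constructor
  · intro hg x y
    change b₂ (e (g (e.symm x))) (e (g (e.symm y))) = _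
    rw [he, hg, ← he, e.apply_symm_apply, e.apply_symm_apply]
  · intro hg x y
    have := hg (e x) (e y)
    change b₂ (e (g (e.symm (e x)))) (e (g (e.symm (e y)))) = _ at this
    rw [he, he] at this
    simpa using this

theorem card_preimage_congr {q₁ : QuadraticMap R M₁ N} {q₂ : QuadraticMap R M₂ N}
    (h : q₁.Equivalent q₂) (s : Set N) : Nat.card (q₁ ⁻¹' s) = Nat.card (q₂ ⁻¹' s) := by
  obtain ⟨e⟩ := h
  refine Nat.card_congr (Equiv.subtypeEquiv e.toLinearEquiv.toEquiv fun x => ?_)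
  change q₁ x ∈ s ↔ q₂ (e x) ∈ s
  rw [e.map_app]

theorem BilinIso.symm {b₁ : LinearMap.BilinMap R M₁ N} {b₂ : LinearMap.BilinMap R M₂ N}
    (h : BilinIso b₁ b₂) : BilinIso b₂ b₁ := by
  obtain ⟨e, he⟩ := h
  exact ⟨e.symm, fun x y => by rw [← he, e.apply_symm_apply, e.apply_symm_apply]⟩

theorem BilinIso.trans {b : LinearMap.BilinMap R M N} {b₁ : LinearMap.BilinMap R M₁ N}
    {b₂ : LinearMap.BilinMap R M₂ N} (h : BilinIso b b₁) (h' : BilinIso b₁ b₂) : BilinIso b b₂ := by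
  obtain ⟨e, he⟩ := h
  obtain ⟨e', he'⟩ := h'
  exact ⟨e.trans e', fun x y => by simp [he, he']⟩

theorem bilinIso_of_equivalent {q₁ : QuadraticMap R M₁ N} {q₂ : QuadraticMap R M₂ N}
    (h : q₁.Equivalent q₂) : BilinIso (assocBilin q₁) (assocBilin q₂) := by
  obtain ⟨e⟩ := h
  refine ⟨e.toLinearEquiv, fun x y => ?_⟩
  change q₂ (e x + e y) - q₂ (e x) - q₂ (e y) = _
  rw [← map_add, e.map_app, e.map_app, e.map_app]
  rfl

theorem BilinIso.sum_congr {M₃ M₄ : Type*} [AddCommGroup M₃] [Module R M₃]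
    [AddCommGroup M₄] [Module R M₄]
    {b₁ : LinearMap.BilinMap R M₁ N} {b₂ : LinearMap.BilinMap R M₂ N}
    {b₃ : LinearMap.BilinMap R M₃ N} {b₄ : LinearMap.BilinMap R M₄ N}
    (h : BilinIso b₁ b₂) (h' : BilinIso b₃ b₄) : BilinIso (bilinSum b₁ b₃) (bilinSum b₂ b₄) := by
  obtain ⟨e, he⟩ := h
  obtain ⟨e', he'⟩ := h'
  exact ⟨e.prodCongr e', fun x y => by simp [bilinSum, he, he']⟩

theorem bilinIso_sum_comm (b₁ : LinearMap.BilinMap R M₁ N) (b₂ : LinearMap.BilinMap R M₂ N) :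
    BilinIso (bilinSum b₁ b₂) (bilinSum b₂ b₁) :=
  ⟨LinearEquiv.prodComm R M₁ M₂, fun x y => by simp [bilinSum, add_comm]⟩

theorem bilinSum_apply (b₁ : LinearMap.BilinMap R M₁ N) (b₂ : LinearMap.BilinMap R M₂ N)
    (x y : M₁ × M₂) : bilinSum b₁ b₂ x y = b₁ x.1 y.1 + b₂ x.2 y.2 := rfl

theorem assocBilin_prod (q₁ : QuadraticMap R M₁ N) (q₂ : QuadraticMap R M₂ N) :
    assocBilin (q₁.prod q₂) = bilinSum (assocBilin q₁) (assocBilin q₂) :=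
  QuadraticMap.polarBilin_prod q₁ q₂

theorem assocBilin_quadPow (q : QuadraticMap R M N) (m : ℕ) :
    assocBilin (quadPow q m) = bilinPow (assocBilin q) m := by
  ext x y
  simp [bilinPow, QuadraticMap.polar]

theorem BilinNondegenerate.of_iso {b₁ : LinearMap.BilinMap R M₁ N}
    {b₂ : LinearMap.BilinMap R M₂ N} (h : BilinIso b₁ b₂) (hb : BilinNondegenerate b₁) :
    BilinNondegenerate b₂ := by
  obtain ⟨e, he⟩ := h.symm
  intro x hx
  obtain ⟨y, hy⟩ := hb (e x) (by simpa using hx)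
  exact ⟨e.symm y, by rwa [← he, e.apply_symm_apply]⟩

theorem BilinNondegenerate.of_sum_right {b₁ : LinearMap.BilinMap R M₁ N}
    {b₂ : LinearMap.BilinMap R M₂ N} (h : BilinNondegenerate (bilinSum b₁ b₂)) :
    BilinNondegenerate b₂ := by
  intro x hx
  obtain ⟨y, hy⟩ := h (0, x) (by simpa using hx)
  exact ⟨y.2, by simpa [bilinSum_apply] using hy⟩

theorem BilinNondegenerate.sum {b₁ : LinearMap.BilinMap R M₁ N}
    {b₂ : LinearMap.BilinMap R M₂ N} (h₁ : BilinNondegenerate b₁) (h₂ : BilinNondegenerate b₂) :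
    BilinNondegenerate (bilinSum b₁ b₂) := by
  rintro ⟨x, y⟩ hxy
  by_cases hx : x = 0
  · obtain ⟨z, hz⟩ := h₂ y (fun hy => hxy (by rw [hx, hy]; rfl))
    exact ⟨(0, z), by simpa [bilinSum_apply] using hz⟩
  · obtain ⟨z, hz⟩ := h₁ x hx
    exact ⟨(z, 0), by simpa [bilinSum_apply] using hz⟩

theorem QuadNondegenerate.of_equivalent {q₁ : QuadraticMap R M₁ N} {q₂ : QuadraticMap R M₂ N}
    (h : q₁.Equivalent q₂) (hq : QuadNondegenerate q₁) : QuadNondegenerate q₂ :=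
  BilinNondegenerate.of_iso (bilinIso_of_equivalent h) hq

theorem QuadNondegenerate.of_prod_right {q₁ : QuadraticMap R M₁ N} {q₂ : QuadraticMap R M₂ N}
    (h : QuadNondegenerate (q₁.prod q₂)) : QuadNondegenerate q₂ := by
  rw [QuadNondegenerate, assocBilin_prod] at h
  exact h.of_sum_right

theorem QuadNondegenerate.prod {q₁ : QuadraticMap R M₁ N} {q₂ : QuadraticMap R M₂ N}
    (h₁ : QuadNondegenerate q₁) (h₂ : QuadNondegenerate q₂) : QuadNondegenerate (q₁.prod q₂) := by
  rw [QuadNondegenerate, assocBilin_prod]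
  exact BilinNondegenerate.sum h₁ h₂

theorem equivalent_prod_assoc (q : QuadraticMap R M N) (q₁ : QuadraticMap R M₁ N)
    (q₂ : QuadraticMap R M₂ N) : ((q.prod q₁).prod q₂).Equivalent (q.prod (q₁.prod q₂)) :=
  ⟨{ LinearEquiv.prodAssoc R M M₁ M₂ with
     map_app' := fun x => by simp [add_assoc] }⟩

theorem equivalent_prod_comm (q₁ : QuadraticMap R M₁ N) (q₂ : QuadraticMap R M₂ N) :
    (q₁.prod q₂).Equivalent (q₂.prod q₁) :=
  ⟨QuadraticMap.IsometryEquiv.prodComm q₁ q₂⟩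

theorem equivalent_prod_of_subsingleton [Subsingleton M₂] (q₁ : QuadraticMap R M₁ N)
    (q₂ : QuadraticMap R M₂ N) : (q₁.prod q₂).Equivalent q₁ :=
  ⟨{ LinearEquiv.ofBijective (LinearMap.fst R M₁ M₂)
      ⟨fun x y h => Prod.ext h (Subsingleton.elim _ _), Prod.fst_surjective⟩ with
     map_app' := fun x => by
      have : x.2 = 0 := Subsingleton.elim _ _
      change q₁ x.1 = q₁ x.1 + q₂ x.2
      rw [this, map_zero, add_zero] }⟩

theorem quadPow_succ_equivalent (q : QuadraticMap R M N) (m : ℕ) :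
    (quadPow q (m + 1)).Equivalent (q.prod (quadPow q m)) :=
  ⟨{ (Fin.consLinearEquiv R (fun _ : Fin (m + 1) => M)).symm with
     map_app' := fun x => by
      simp [Fin.sum_univ_succ, Fin.tail] }⟩

/-- Non-degeneracy makes a form-preserving map injective, and finiteness makes it bijective.
Isometries can therefore be given by a linear formula without exhibiting an inverse. -/
theorem exists_mem_bilinO_of_preserves [Finite M] {b : LinearMap.BilinMap R M N}
    (hb : BilinNondegenerate b) (f : M →ₗ[R] M) (hf : ∀ x y, b (f x) (f y) = b x y) :
    ∃ g ∈ bilinO b, ∀ x, g x = f x := by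
  have hinj : Function.Injective f := by
    rw [injective_iff_map_eq_zero]
    intro x hx
    by_contra h
    obtain ⟨y, hy⟩ := hb x h
    rw [← hf, hx] at hy
    simp at hy
  exact ⟨LinearEquiv.ofBijective f (Finite.injective_iff_bijective.1 hinj), hf, fun _ => rfl⟩

theorem exists_mem_quadO_of_preserves [Finite M] {q : QuadraticMap R M N}
    (hq : QuadNondegenerate q) (f : M →ₗ[R] M) (hf : ∀ x, q (f x) = q x) :
    ∃ g ∈ quadO q, ∀ x, g x = f x := by
  obtain ⟨g, -, hg⟩ := exists_mem_bilinO_of_preserves hq f (polar_map_of_preserves hf)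
  exact ⟨g, fun x => by rw [hg, hf], hg⟩

/-- An isometry of `b₁ ⊕ b₂` which is the identity on the first summand comes from an automorphism
of the second summand. -/
theorem exists_eq_prodCongr {b₁ : LinearMap.BilinMap R M₁ N} {b₂ : LinearMap.BilinMap R M₂ N}
    (h₁ : BilinNondegenerate b₁) {g : (M₁ × M₂) ≃ₗ[R] (M₁ × M₂)}
    (hg : g ∈ bilinO (bilinSum b₁ b₂)) (hfix : ∀ x, g (x, 0) = (x, 0)) :
    ∃ h : M₂ ≃ₗ[R] M₂, g = (LinearEquiv.refl R M₁).prodCongr h := by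
  -- The image of the second summand stays orthogonal to the fixed first summand, so its first
  -- component lies in the radical of `b₁`.
  have key : ∀ g ∈ bilinO (bilinSum b₁ b₂), (∀ x, g (x, 0) = (x, 0)) →
      ∀ y, (g (0, y)).1 = 0 := by
    intro g hg hfix y
    by_contra hne
    obtain ⟨x, hx⟩ := h₁ _ hne
    have := hg (0, y) (x, 0)
    rw [hfix] at this
    simp [bilinSum_apply] at this
    exact hx this
  have hginv : ∀ x, g.symm (x, 0) = (x, 0) := fun x => by rw [LinearEquiv.symm_apply_eq, hfix]
  have hmem : g.symm ∈ bilinO (bilinSum b₁ b₂) := (bilinO (bilinSum b₁ b₂)).inv_mem hg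
  have e1 : ∀ y, g (0, y) = (0, (g (0, y)).2) := fun y => Prod.ext (key g hg hfix y) rfl
  have e2 : ∀ y, g.symm (0, y) = (0, (g.symm (0, y)).2) :=
    fun y => Prod.ext (key _ hmem hginv y) rfl
  refine ⟨LinearEquiv.ofLinearMap
    (LinearMap.snd R M₁ M₂ ∘ₗ (g : _ →ₗ[R] _) ∘ₗ LinearMap.inr R M₁ M₂)
    (LinearMap.snd R M₁ M₂ ∘ₗ (g.symm : _ →ₗ[R] _) ∘ₗ LinearMap.inr R M₁ M₂) ?_ ?_, ?_⟩
  · ext y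
    simp only [LinearMap.comp_apply, LinearMap.inr_apply, LinearMap.snd_apply,
      LinearEquiv.coe_coe, LinearMap.id_apply]
    rw [← e2, g.apply_symm_apply]
  · ext y
    simp only [LinearMap.comp_apply, LinearMap.inr_apply, LinearMap.snd_apply,
      LinearEquiv.coe_coe, LinearMap.id_apply]
    rw [← e1, g.symm_apply_apply]
  · ext1 ⟨x, y⟩
    have : ((x, y) : M₁ × M₂) = (x, 0) + (0, y) := by simp
    rw [this, map_add, hfix, e1]
    simp

/-- Orbit-stabiliser for the action of a group `G` of isometries of `b₁ ⊕ b₂` on the embeddings of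
the first summand: `F g` encodes the restriction of `g` to that summand, `S` is the orbit, and `H`
is the group of automorphisms of the second summand that belong to `G`. -/
theorem card_eq_card_orbit_mul {b₁ : LinearMap.BilinMap R M₁ N} {b₂ : LinearMap.BilinMap R M₂ N}
    (h₁ : BilinNondegenerate b₁) {G : Subgroup ((M₁ × M₂) ≃ₗ[R] (M₁ × M₂))}
    (hG : G ≤ bilinO (bilinSum b₁ b₂)) {H : Subgroup (M₂ ≃ₗ[R] M₂)}
    (hH : ∀ h, h ∈ H ↔ (LinearEquiv.refl R M₁).prodCongr h ∈ G) {T : Type*}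
    (F : ((M₁ × M₂) ≃ₗ[R] (M₁ × M₂)) → T)
    (hF : ∀ g ∈ G, ∀ g' ∈ G, F g = F g' ↔ ∀ x, g (x, 0) = g' (x, 0))
    (S : Set T) (hS : F '' G = S) : Nat.card G = Nat.card S * Nat.card H := by
  subst hS
  -- `r` picks one isometry for each point of the orbit; the bijection is `(s, h) ↦ r s * (1 ⊕ h)`.
  choose! r hrG hrF using fun s (hs : s ∈ F '' G) => hs
  rw [← Nat.card_prod]
  symm
  refine Nat.card_congr (Equiv.ofBijective (fun p : F '' G × H =>
    (⟨r p.1 * (LinearEquiv.refl R M₁).prodCongr p.2,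
      G.mul_mem (hrG _ p.1.2) ((hH _).1 p.2.2)⟩ : G)) ⟨?_, ?_⟩)
  · rintro ⟨⟨s, hs⟩, ⟨h, hh⟩⟩ ⟨⟨s', hs'⟩, ⟨h', hh'⟩⟩ heq
    have heq' := congrArg Subtype.val heq
    simp only at heq'
    have hss : s = s' := by
      rw [← hrF s hs, ← hrF s' hs', hF _ (hrG _ hs) _ (hrG _ hs')]
      intro x
      have := LinearEquiv.congr_fun heq' (x, 0)
      simpa [LinearEquiv.mul_apply] using this
    subst hss
    have hhh : h = h' := by
      ext y
      have := LinearEquiv.congr_fun (mul_left_cancel heq') (0, y)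
      simpa using this
    subst hhh
    rfl
  · rintro ⟨g, hg⟩
    have hs : F g ∈ F '' G := ⟨g, hg, rfl⟩
    have hfix : ∀ x, ((r (F g))⁻¹ * g) (x, 0) = (x, 0) := by
      intro x
      have := (hF _ hg _ (hrG _ hs)).1 (hrF _ hs).symm x
      rw [LinearEquiv.mul_apply, this, ← LinearEquiv.mul_apply, inv_mul_cancel]
      rfl
    have hmem : (r (F g))⁻¹ * g ∈ G := G.mul_mem (G.inv_mem (hrG _ hs)) hg
    obtain ⟨h, hh⟩ := exists_eq_prodCongr h₁ (hG hmem) hfix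
    refine ⟨(⟨F g, hs⟩, ⟨h, (hH h).2 (hh ▸ hmem)⟩), Subtype.ext ?_⟩
    simp only [← hh, mul_inv_cancel_left]

/-- The version of `card_eq_card_orbit_mul` for quadratic forms. -/
theorem card_quadO_prod {q₁ : QuadraticMap R M₁ N} {q₂ : QuadraticMap R M₂ N}
    (h₁ : QuadNondegenerate q₁) {T : Type*} (F : ((M₁ × M₂) ≃ₗ[R] (M₁ × M₂)) → T)
    (hF : ∀ g g' : (M₁ × M₂) ≃ₗ[R] (M₁ × M₂), g ∈ quadO (q₁.prod q₂) → g' ∈ quadO (q₁.prod q₂) →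
      F g = F g' → ∀ x, g (x, 0) = g' (x, 0))
    (hF' : ∀ g g' : (M₁ × M₂) ≃ₗ[R] (M₁ × M₂), (∀ x, g (x, 0) = g' (x, 0)) → F g = F g')
    (S : Set T) (hS₁ : ∀ g ∈ quadO (q₁.prod q₂), F g ∈ S)
    (hS₂ : ∀ s ∈ S, ∃ g ∈ quadO (q₁.prod q₂), F g = s) :
    Nat.card (quadO (q₁.prod q₂)) = Nat.card S * Nat.card (quadO q₂) := by
  refine card_eq_card_orbit_mul h₁ ((quadO_le_bilinO _).trans_eq
    (congrArg bilinO (assocBilin_prod q₁ q₂))) (fun h => ?_) F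
    (fun g hg g' hg' => ⟨hF g g' hg hg', hF' g g'⟩) S ?_
  · rw [mem_quadO, mem_quadO]
    simp
  · ext s
    exact ⟨fun ⟨g, hg, hs⟩ => hs ▸ hS₁ g hg, fun hs => hS₂ s hs⟩

/-- An embedded form `b₁` with an adjoint projection `π` splits off as an orthogonal summand. -/
theorem exists_splitting {b : LinearMap.BilinMap R M N} {b₁ : LinearMap.BilinMap R M₁ N}
    (h₁ : BilinNondegenerate b₁) (φ : M₁ →ₗ[R] M) (π : M →ₗ[R] M₁)
    (hπ : ∀ x y, b₁ (π x) y = b x (φ y)) (hφ : ∀ x y, b (φ x) (φ y) = b₁ x y) :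
    ∃ f : (M₁ × LinearMap.ker π) ≃ₗ[R] M, ∀ x (z : LinearMap.ker π), f (x, z) = φ x + z := by
  -- `π (φ x) - x` pairs to zero with everything under `b₁`. So `φ ∘ π` is a projection, and its
  -- complement `ker π` is orthogonal to the image of `φ`.
  have hπφ : ∀ x, π (φ x) = x := by
    intro x
    by_contra hne
    obtain ⟨y, hy⟩ := h₁ _ (sub_ne_zero.2 hne)
    rw [map_sub, LinearMap.sub_apply, hπ, hφ, sub_self] at hy
    exact hy rfl
  refine ⟨LinearEquiv.ofBijective (φ.coprod (LinearMap.ker π).subtype) ⟨?_, ?_⟩, ?_⟩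
  · rw [injective_iff_map_eq_zero]
    rintro ⟨x, z, hz⟩ h
    rw [LinearMap.mem_ker] at hz
    replace h : φ x + z = 0 := h
    have hx := congrArg π h
    rw [map_add, hz, hπφ, add_zero, map_zero] at hx
    subst hx
    rw [map_zero, zero_add] at h
    subst h
    rfl
  · intro y
    exact ⟨(π y, ⟨y - φ (π y), by rw [LinearMap.mem_ker, map_sub, hπφ, sub_self]⟩), by simp⟩
  · exact fun x z => rfl

theorem bilinIso_of_splitting {b : LinearMap.BilinMap R M N} {b₁ : LinearMap.BilinMap R M₁ N}
    (hs : IsSymmetric b) (h₁ : BilinNondegenerate b₁) (φ : M₁ →ₗ[R] M) (π : M →ₗ[R] M₁)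
    (hπ : ∀ x y, b₁ (π x) y = b x (φ y)) (hφ : ∀ x y, b (φ x) (φ y) = b₁ x y) :
    BilinIso b (bilinSum b₁ (b.compl₁₂ (LinearMap.ker π).subtype (LinearMap.ker π).subtype)) := by
  obtain ⟨f, hf⟩ := exists_splitting h₁ φ π hπ hφ
  refine BilinIso.symm ⟨f, ?_⟩
  rintro ⟨x, z, hz⟩ ⟨x', z', hz'⟩
  rw [LinearMap.mem_ker] at hz hz'
  have e1 : b z (φ x') = 0 := by rw [← hπ, hz]; simp
  have e2 : b (φ x) z' = 0 := by rw [hs, ← hπ, hz']; simp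
  simp [hf, bilinSum_apply, hφ, e1, e2]

theorem equivalent_of_splitting {q : QuadraticMap R M N} {q₁ : QuadraticMap R M₁ N}
    (h₁ : QuadNondegenerate q₁) (φ : M₁ →ₗ[R] M) (π : M →ₗ[R] M₁)
    (hπ : ∀ x y, assocBilin q₁ (π x) y = assocBilin q x (φ y)) (hφ : ∀ x, q (φ x) = q₁ x) :
    q.Equivalent (q₁.prod (q.comp (LinearMap.ker π).subtype)) := by
  have hφ' : ∀ x y, assocBilin q (φ x) (φ y) = assocBilin q₁ x y := by
    intro x y
    simp only [QuadraticMap.polarBilin_apply_apply, QuadraticMap.polar, ← map_add, hφ]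
  obtain ⟨f, hf⟩ := exists_splitting h₁ φ π hπ hφ'
  refine QuadraticMap.Equivalent.symm ⟨{ f with map_app' := ?_ }⟩
  rintro ⟨x, z, hz⟩
  rw [LinearMap.mem_ker] at hz
  have e1 : assocBilin q z (φ x) = 0 := by rw [← hπ, hz]; simp
  rw [QuadraticMap.polarBilin_apply_apply, QuadraticMap.polar_comm, QuadraticMap.polar,
    sub_sub, sub_eq_zero] at e1
  change q (f (x, ⟨z, _⟩)) = _
  simp [hf, e1, hφ]

end Isometries

/-! ### Reflections, Siegel transformations and hyperbolic planes over a field -/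

section Field

variable {K V : Type*} [Field K] [AddCommGroup V] [Module K V]

theorem map_add_smul (Q : QuadraticForm K V) (x y : V) (a : K) :
    Q (x + a • y) = Q x + a ^ 2 * Q y + a * QuadraticMap.polar Q x y := by
  rw [QuadraticMap.map_add (⇑Q), QuadraticMap.map_smul, QuadraticMap.polar_smul_right]
  simp [pow_two]

/-- The hyperbolic plane over a field. -/
def hypPlane (K : Type*) [Field K] : QuadraticForm K (K × K) :=
  QuadraticMap.linMulLin (LinearMap.fst K K K) (LinearMap.snd K K K)

theorem hypPlane_apply (x : K × K) : hypPlane K x = x.1 * x.2 := rfl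

theorem polar_hypPlane (x y : K × K) :
    QuadraticMap.polar (hypPlane K) x y = x.1 * y.2 + x.2 * y.1 := by
  simp only [QuadraticMap.polar, hypPlane_apply, Prod.fst_add, Prod.snd_add]
  ring

theorem quadNondegenerate_hypPlane : QuadNondegenerate (hypPlane K) := by
  rintro ⟨a, b⟩ h
  by_cases ha : a = 0
  · refine ⟨(1, 0), ?_⟩
    have hb : b ≠ 0 := fun hb => h (by rw [ha, hb]; rfl)
    simpa [polar_hypPlane] using hb
  · exact ⟨(0, 1), by simpa [polar_hypPlane] using ha⟩

/-- Dividing by `Q v` instead of `B(v, v)` keeps the formula valid in characteristic two. -/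
theorem exists_reflection [Finite V] {Q : QuadraticForm K V} (hQ : QuadNondegenerate Q) {v : V}
    (hv : Q v ≠ 0) :
    ∃ g ∈ quadO Q, ∀ x, g x = x + (-(QuadraticMap.polar Q x v / Q v)) • v := by
  refine exists_mem_quadO_of_preserves hQ
    { toFun := fun x => x + (-(QuadraticMap.polar Q x v / Q v)) • v
      map_add' := fun x y => ?_
      map_smul' := fun a x => ?_ } fun x => ?_
  · rw [QuadraticMap.polar_add_left]
    module
  · rw [QuadraticMap.polar_smul_left, smul_eq_mul, RingHom.id_apply]
    module
  · change Q (x + (-(QuadraticMap.polar Q x v / Q v)) • v) = Q x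
    rw [map_add_smul]
    field_simp
    ring

/-- When `Q x = Q y`, one has `B(x, x - y) = Q(x - y)`, so the reflection along `x - y` subtracts
exactly `x - y` from `x`. -/
theorem exists_isometry_of_sub_anisotropic [Finite V] {Q : QuadraticForm K V}
    (hQ : QuadNondegenerate Q)
    {x y : V} (hxy : Q x = Q y) (h : Q (x - y) ≠ 0) : ∃ g ∈ quadO Q, g x = y := by
  obtain ⟨g, hg, hgx⟩ := exists_reflection hQ h
  refine ⟨g, hg, ?_⟩
  have h1 : QuadraticMap.polar Q x (x - y) = Q (x - y) := by
    have h2 := map_add_smul Q x y (-1)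
    have h3 : x + (-1 : K) • y = x - y := by module
    rw [h3] at h2
    rw [h2, QuadraticMap.polar_sub_right, QuadraticMap.polar_self, hxy]
    simp only [nsmul_eq_mul]
    push_cast
    ring
  rw [hgx, h1, div_self h]
  module

/-- Two isotropic vectors with nonzero pairing differ by an anisotropic vector, so one reflection is
enough. If they are orthogonal, a third isotropic vector pairing nontrivially with both serves as an
intermediate stop. -/
theorem exists_isometry_of_isotropic [Finite V] {Q : QuadraticForm K V} (hQ : QuadNondegenerate Q)
    {e e' : V} (he : e ≠ 0) (he' : e' ≠ 0) (hQe : Q e = 0) (hQe' : Q e' = 0) :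
    ∃ g ∈ quadO Q, g e = e' := by
  have key : ∀ x y : V, Q x = 0 → Q y = 0 → QuadraticMap.polar Q x y ≠ 0 →
      ∃ g ∈ quadO Q, g x = y := by
    intro x y hx hy hxy
    refine exists_isometry_of_sub_anisotropic hQ (hx.trans hy.symm) ?_
    have h2 := map_add_smul Q x y (-1)
    have h3 : x + (-1 : K) • y = x - y := by module
    rw [h3, hx, hy] at h2
    rw [h2]
    simpa using hxy
  by_cases hp : QuadraticMap.polar Q e e' = 0
  swap
  · exact key e e' hQe hQe' hp
  obtain ⟨x, hx, hx'⟩ : ∃ x, QuadraticMap.polar Q x e ≠ 0 ∧ QuadraticMap.polar Q x e' ≠ 0 := by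
    obtain ⟨y, hy⟩ := hQ e he
    obtain ⟨z, hz⟩ := hQ e' he'
    rw [QuadraticMap.polarBilin_apply_apply, QuadraticMap.polar_comm] at hy hz
    by_cases hy' : QuadraticMap.polar Q y e' = 0
    · by_cases hz' : QuadraticMap.polar Q z e = 0
      · refine ⟨y + z, ?_, ?_⟩
        · rwa [QuadraticMap.polar_add_left, hz', add_zero]
        · rwa [QuadraticMap.polar_add_left, hy', zero_add]
      · exact ⟨z, hz', hz⟩
    · exact ⟨y, hy, hy'⟩
  -- This multiple of `e` makes `x` isotropic. Both pairings are unchanged because `e` is orthogonal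
  -- to `e` and to `e'`.
  obtain ⟨t, ht⟩ : ∃ t, t = -(Q x / QuadraticMap.polar Q x e) := ⟨_, rfl⟩
  have h0 : Q (x + t • e) = 0 := by
    rw [map_add_smul, hQe, ht]
    field_simp
    ring
  have h1 : QuadraticMap.polar Q (x + t • e) e ≠ 0 := by
    rw [QuadraticMap.polar_add_left, QuadraticMap.polar_smul_left, QuadraticMap.polar_self, hQe]
    simpa using hx
  have h2 : QuadraticMap.polar Q (x + t • e) e' ≠ 0 := by
    rw [QuadraticMap.polar_add_left, QuadraticMap.polar_smul_left, hp]
    simpa using hx'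
  obtain ⟨g, hg, hge⟩ := key e _ hQe h0 (by rwa [QuadraticMap.polar_comm])
  obtain ⟨g', hg', hge'⟩ := key _ e' h0 hQe' h2
  exact ⟨g' * g, (quadO Q).mul_mem hg' hg, by rw [LinearEquiv.mul_apply, hge, hge']⟩

/-- Siegel transformations move any hyperbolic partner of `e` to any other one. -/
theorem exists_isometry_fixing_isotropic [Finite V] {Q : QuadraticForm K V}
    (hQ : QuadNondegenerate Q)
    {e f f' : V} (hQe : Q e = 0) (hQf : Q f = 0) (hQf' : Q f' = 0)
    (hf : QuadraticMap.polar Q e f = 1) (hf' : QuadraticMap.polar Q e f' = 1) :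
    ∃ g ∈ quadO Q, g e = e ∧ g f = f' := by
  obtain ⟨w, hw⟩ : ∃ w, w = f' - f := ⟨_, rfl⟩
  have hew : QuadraticMap.polar Q e w = 0 := by
    rw [hw, QuadraticMap.polar_sub_right, hf, hf', sub_self]
  have hee : QuadraticMap.polar Q e e = 0 := by rw [QuadraticMap.polar_self, hQe, smul_zero]
  have hff : QuadraticMap.polar Q f f = 0 := by rw [QuadraticMap.polar_self, hQf, smul_zero]
  have hQw : Q w = -QuadraticMap.polar Q f f' := by
    have h2 := map_add_smul Q f' f (-1)
    have h3 : f' + (-1 : K) • f = w := by rw [hw]; module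
    rw [h3, hQf, hQf', QuadraticMap.polar_comm] at h2
    rw [h2]
    ring
  have hfw : QuadraticMap.polar Q f w = QuadraticMap.polar Q f f' := by
    rw [hw, QuadraticMap.polar_sub_right, hff, sub_zero]
  -- The Siegel transformation attached to `e` and `w = f' - f ∈ e^⊥`. It sends `f` to `f + w = f'`,
  -- because the coefficient of `e` is `-(B(f, w) + Q w) = 0`.
  obtain ⟨g, hg, hgx⟩ := exists_mem_quadO_of_preserves hQ
    { toFun := fun x => x + QuadraticMap.polar Q x e • w +
        (-(QuadraticMap.polar Q x w + Q w * QuadraticMap.polar Q x e)) • e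
      map_add' := fun x y => by
        rw [QuadraticMap.polar_add_left, QuadraticMap.polar_add_left]
        module
      map_smul' := fun a x => by
        rw [QuadraticMap.polar_smul_left, QuadraticMap.polar_smul_left, smul_eq_mul, smul_eq_mul,
          RingHom.id_apply]
        module } (fun x => by
      change Q (x + QuadraticMap.polar Q x e • w +
        (-(QuadraticMap.polar Q x w + Q w * QuadraticMap.polar Q x e)) • e) = Q x
      rw [map_add_smul, map_add_smul, hQe, QuadraticMap.polar_add_left,
        QuadraticMap.polar_smul_left, QuadraticMap.polar_comm Q w e, hew, smul_zero]
      ring)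
  refine ⟨g, hg, ?_, ?_⟩
  · rw [hgx]
    change e + QuadraticMap.polar Q e e • w +
      (-(QuadraticMap.polar Q e w + Q w * QuadraticMap.polar Q e e)) • e = e
    rw [hee, hew]
    module
  · rw [hgx]
    change f + QuadraticMap.polar Q f e • w +
      (-(QuadraticMap.polar Q f w + Q w * QuadraticMap.polar Q f e)) • e = f'
    rw [QuadraticMap.polar_comm Q f e, hf, hfw, hQw, hw]
    module

/-- Scale a vector not orthogonal to `e` so that it pairs to `1`, then subtract the multiple of `e`
that removes its `Q`-value. -/
theorem exists_hyperbolic_partner {Q : QuadraticForm K V} (hQ : QuadNondegenerate Q)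
    {e : V} (he : e ≠ 0) (hQe : Q e = 0) : ∃ f, Q f = 0 ∧ QuadraticMap.polar Q e f = 1 := by
  obtain ⟨y, hy⟩ := hQ e he
  rw [QuadraticMap.polarBilin_apply_apply] at hy
  obtain ⟨z, hz⟩ : ∃ z, z = (QuadraticMap.polar Q e y)⁻¹ • y := ⟨_, rfl⟩
  have hez : QuadraticMap.polar Q e z = 1 := by
    rw [hz, QuadraticMap.polar_smul_right, smul_eq_mul, inv_mul_cancel₀ hy]
  refine ⟨z + (-Q z) • e, ?_, ?_⟩
  · rw [map_add_smul, hQe, QuadraticMap.polar_comm, hez]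
    ring
  · rw [QuadraticMap.polar_add_right, QuadraticMap.polar_smul_right, hez, QuadraticMap.polar_self,
      hQe]
    simp

theorem exists_hypPlane_splitting {Q : QuadraticForm K V} (hQ : QuadNondegenerate Q)
    {e : V} (he : e ≠ 0) (hQe : Q e = 0) :
    ∃ (W : Submodule K V) (Q₀ : QuadraticForm K W),
      QuadNondegenerate Q₀ ∧ Q.Equivalent ((hypPlane K).prod Q₀) := by
  obtain ⟨f, hQf, hef⟩ := exists_hyperbolic_partner hQ he hQe
  have h := equivalent_of_splitting (q := Q) quadNondegenerate_hypPlane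
    ((LinearMap.toSpanSingleton K V e).coprod (LinearMap.toSpanSingleton K V f))
    -- The order is swapped: in a hyperbolic pair the `e`-coordinate is read off by pairing with
    -- `f`.
    ((Q.polarBilin.flip f).prod (Q.polarBilin.flip e))
    (fun x y => by
      simp [polar_hypPlane, QuadraticMap.polar_add_right, QuadraticMap.polar_smul_right]
      ring)
    (fun x => by
      simp [map_add_smul, hypPlane_apply, QuadraticMap.map_smul, hQe, hQf,
        QuadraticMap.polar_smul_left, hef]
      ring)
  exact ⟨_, _, (hQ.of_equivalent h).of_prod_right, h⟩

/-- Solve `ab + Q x = 0` for `b`: if `a = 0`, then `b` is free and `Q x = 0`; if `a ≠ 0`, then `x`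
is free and `b` is determined. The term `#V` on the left avoids the subtraction in `(#K - 1) #V`. -/
theorem card_zeros_hypPlane_prod [Finite V] [Finite K] (Q : QuadraticForm K V) :
    Nat.card (((hypPlane K).prod Q) ⁻¹' {0}) + Nat.card V =
      Nat.card K * Nat.card (Q ⁻¹' {0}) + Nat.card K * Nat.card V := by
  have h : Nat.card ((K × (Q ⁻¹' {0})) ⊕ (Kˣ × V)) = Nat.card (((hypPlane K).prod Q) ⁻¹' {0}) := by
    refine Nat.card_congr (Equiv.ofBijective (Sum.elim
      (fun p => ⟨((0, p.1), p.2.1), by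
        have := p.2.2
        simp only [Set.mem_preimage, Set.mem_singleton_iff] at this
        simp [hypPlane_apply, this]⟩)
      (fun p => ⟨(((p.1 : K), -((p.1 : K)⁻¹ * Q p.2)), p.2), by simp [hypPlane_apply]⟩)) ⟨?_, ?_⟩)
    · rintro (⟨a, x, hx⟩ | ⟨u, x⟩) (⟨a', x', hx'⟩ | ⟨u', x'⟩) h
      · simpa using h
      · simp at h
        exact absurd h.1.1.symm u'.ne_zero
      · simp at h
      · simp at h
        obtain ⟨⟨h1, -⟩, h2⟩ := h
        rw [Units.ext h1, h2]
    · rintro ⟨⟨⟨a, b⟩, x⟩, h⟩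
      simp [hypPlane_apply] at h
      by_cases ha : a = 0
      · subst ha
        exact ⟨Sum.inl (b, ⟨x, by simpa using h⟩), rfl⟩
      · refine ⟨Sum.inr (Units.mk0 a ha, x), ?_⟩
        simp only [Sum.elim_inr, Units.val_mk0, Subtype.mk.injEq, Prod.mk.injEq, true_and, and_true]
        rw [eq_neg_of_add_eq_zero_right h]
        field_simp
  rw [← h, Nat.card_sum, Nat.card_prod, Nat.card_prod, Nat.card_units, add_assoc, ← Nat.succ_mul]
  congr 2
  have : 0 < Nat.card K := Nat.card_pos
  omega

/-- The orbit of the standard hyperbolic pair consists of all hyperbolic pairs `(e, f)`. There is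
one choice of `e` for each nonzero isotropic vector, and each `e` has `#V` partners. -/
theorem card_quadO_hypPlane_prod [Finite V] [Finite K] {Q : QuadraticForm K V}
    (hQ : QuadNondegenerate Q) :
    Nat.card (quadO ((hypPlane K).prod Q)) =
      (Nat.card (((hypPlane K).prod Q) ⁻¹' {0}) - 1) * Nat.card V * Nat.card (quadO Q) := by
  have hP : QuadNondegenerate ((hypPlane K).prod Q) := quadNondegenerate_hypPlane.prod hQ
  obtain ⟨P, hPdef⟩ : ∃ P, P = (hypPlane K).prod Q := ⟨_, rfl⟩
  have hpol : ∀ x y, QuadraticMap.polar P x y =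
      x.1.1 * y.1.2 + x.1.2 * y.1.1 + QuadraticMap.polar Q x.2 y.2 := by
    intro x y
    rw [hPdef, QuadraticMap.polar_prod, polar_hypPlane]
  have hval : ∀ x, P x = x.1.1 * x.1.2 + Q x.2 := fun x => by rw [hPdef]; rfl
  rw [card_quadO_prod quadNondegenerate_hypPlane
    (fun g => (g ((1, 0), 0), g ((0, 1), 0))) ?_ ?_
    {p | P p.1 = 0 ∧ P p.2 = 0 ∧ QuadraticMap.polar P p.1 p.2 = 1} ?_ ?_]
  · congr 1
    rw [← hPdef] at hP ⊢
    have hb : (((1, 0), 0) : (K × K) × V) ≠ 0 := by simp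
    have hb0 : P ((1, 0), 0) = 0 := by simp [hval]
    choose! r hr hre using fun (e : (K × K) × V) (h : e ≠ 0 ∧ P e = 0) =>
      exists_isometry_of_isotropic hP hb h.1 hb0 h.2
    have h1 : Nat.card ((P ⁻¹' {0} \ {0} : Set ((K × K) × V)) × V) =
        (Nat.card (P ⁻¹' {0}) - 1) * Nat.card V := by
      rw [Nat.card_prod, Nat.card_coe_set_eq, Nat.card_coe_set_eq,
        Set.ncard_sdiff_singleton_of_mem (by simp)]
    rw [← h1]
    symm
    have hr1 : ∀ e, e ≠ 0 → P e = 0 → ∀ x, P (r e x) = P x := fun e he he' => hr e ⟨he, he'⟩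
    have hr2 : ∀ e, e ≠ 0 → P e = 0 → ∀ x y, QuadraticMap.polar P (r e x) (r e y) =
      QuadraticMap.polar P x y := fun e he he' => polar_map_of_preserves
        (f := (r e : (K × K) × V →ₗ[K] (K × K) × V)) (hr1 e he he')
    -- The partners of the standard vector are exactly `((-Q x, 1), x)`, one for each `x`; `r e`
    -- carries them to the partners of `e`.
    refine Nat.card_congr (Equiv.ofBijective (fun p => ⟨(p.1, r p.1 ((-Q p.2, 1), p.2)), ?_⟩)
      ⟨?_, ?_⟩)
    · obtain ⟨⟨e, he, he0⟩, x⟩ := p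
      refine ⟨he, ?_, ?_⟩
      · change P (r e _) = 0
        rw [hr1 e he0 he, hval]
        simp
      · change QuadraticMap.polar P e (r e _) = 1
        have h2 := hr2 e he0 he ((1, 0), 0) ((-Q x, 1), x)
        rw [hre e ⟨he0, he⟩, hpol ((1, 0), 0)] at h2
        simpa using h2
    · rintro ⟨⟨e, he, he0⟩, x⟩ ⟨⟨e', he', he0'⟩, x'⟩ h
      simp only [Subtype.mk.injEq, Prod.mk.injEq] at h
      obtain ⟨rfl, h⟩ := h
      have := (r e).injective h
      simp only [Prod.mk.injEq] at this
      rw [this.2]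
    · rintro ⟨⟨e, f⟩, he, hf, hef⟩
      simp only at he hf hef
      have he0 : e ≠ 0 := by
        rintro rfl
        simp at hef
      obtain ⟨y, hy⟩ := (r e).surjective f
      obtain ⟨⟨a, b⟩, x⟩ := y
      rw [← hy, hr1 e he0 he, hval] at hf
      nth_rw 1 [← hre e ⟨he0, he⟩] at hef
      rw [← hy, hr2 e he0 he, hpol] at hef
      simp at hef
      subst hef
      refine ⟨(⟨e, he, he0⟩, x), Subtype.ext (Prod.ext rfl ?_)⟩
      change r e _ = f
      rw [← hy]
      have : a = -Q x := by simpa using eq_neg_of_add_eq_zero_left hf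
      rw [this]
  · rintro g g' - - h x
    have hx : ((x, 0) : (K × K) × V) = x.1 • ((1, 0), 0) + x.2 • ((0, 1), 0) := by
      ext <;> simp
    simp only [Prod.mk.injEq] at h
    rw [hx, map_add, map_add, map_smul, map_smul, map_smul, map_smul, h.1, h.2]
  · intro g g' h
    simp only [h]
  · intro g hg
    rw [← hPdef] at hg
    refine ⟨?_, ?_, ?_⟩
    · change P (g _) = 0
      rw [hg, hval]
      simp
    · change P (g _) = 0
      rw [hg, hval]
      simp
    · refine (polar_map_of_preserves (f := (g : (K × K) × V →ₗ[K] (K × K) × V)) hg _ _).trans ?_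
      rw [hpol]
      simp
  · rintro ⟨e, f⟩ ⟨he, hf, hef⟩
    simp only at he hf hef
    rw [← hPdef] at hP ⊢
    have he0 : e ≠ 0 := by
      rintro rfl
      simp at hef
    obtain ⟨g, hg, hge⟩ := exists_isometry_of_isotropic hP
      (e := ((1, 0), 0)) (by simp) he0 (by simp [hval]) he
    obtain ⟨g', hg', hge', hgf'⟩ := exists_isometry_fixing_isotropic hP (e := e)
      (f := g ((0, 1), 0)) (f' := f) he (by rw [hg, hval]; simp) hf (by
        rw [← hge]
        refine (polar_map_of_preserves (f := (g : (K × K) × V →ₗ[K] (K × K) × V)) hg _ _).trans ?_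
        rw [hpol]
        simp) hef
    exact ⟨g' * g, (quadO P).mul_mem hg' hg, by simp [LinearEquiv.mul_apply, hge, hge', hgf']⟩

end Field

/-! ### Witt decomposition -/

section Witt

variable {K V : Type*} [Field K] [AddCommGroup V] [Module K V]

theorem quadNondegenerate_of_subsingleton [Subsingleton V] (Q : QuadraticForm K V) :
    QuadNondegenerate Q :=
  fun x hx => absurd (Subsingleton.elim x 0) hx

theorem quadNondegenerate_quadPow_hypPlane (K : Type*) [Field K] (m : ℕ) :
    QuadNondegenerate (quadPow (hypPlane K) m) := by
  induction m with
  | zero => exact quadNondegenerate_of_subsingleton _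
  | succ m ih =>
    exact (quadNondegenerate_hypPlane.prod ih).of_equivalent (quadPow_succ_equivalent _ _).symm

theorem quadPow_zero_prod_equivalent {W : Type*} [AddCommGroup W] [Module K W]
    (P : QuadraticForm K W) (Q : QuadraticForm K V) : ((quadPow P 0).prod Q).Equivalent Q :=
  (equivalent_prod_comm _ _).trans (equivalent_prod_of_subsingleton _ _)

theorem quadPow_succ_prod_equivalent {W : Type*} [AddCommGroup W] [Module K W]
    (P : QuadraticForm K W) (Q : QuadraticForm K V) (m : ℕ) :
    ((quadPow P (m + 1)).prod Q).Equivalent (P.prod ((quadPow P m).prod Q)) :=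
  ((quadPow_succ_equivalent P m).prod (.refl Q)).trans (equivalent_prod_assoc _ _ _)

/-- Every non-degenerate quadratic form is the sum of hyperbolic planes and an anisotropic form. -/
theorem exists_witt_decomposition.{u} {K : Type*} [Field K] (n : ℕ) : ∀ (V : Type u)
    [AddCommGroup V] [Module K V] [FiniteDimensional K V] (Q : QuadraticForm K V),
    QuadNondegenerate Q → Module.finrank K V = n →
    ∃ (m : ℕ) (W : Submodule K V) (Q₀ : QuadraticForm K W), QuadNondegenerate Q₀ ∧
      Q₀.Anisotropic ∧ Q.Equivalent ((quadPow (hypPlane K) m).prod Q₀) := by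
  induction n using Nat.strong_induction_on with
  | _ n ih =>
  intro V _ _ _ Q hQ hn
  by_cases ha : Q.Anisotropic
  · refine ⟨0, ⊤, Q.comp (⊤ : Submodule K V).subtype, ?_, ?_, ?_⟩
    · exact hQ.of_equivalent (QuadraticMap.Equivalent.symm
        ⟨{ Submodule.topEquiv (R := K) (M := V) with map_app' := fun x => rfl }⟩)
    · exact fun x hx => Subtype.ext (ha _ hx)
    · exact QuadraticMap.Equivalent.trans (QuadraticMap.Equivalent.symm
        ⟨{ Submodule.topEquiv (R := K) (M := V) with map_app' := fun x => rfl }⟩)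
        (quadPow_zero_prod_equivalent _ _).symm
  · simp only [QuadraticMap.Anisotropic, not_forall] at ha
    obtain ⟨e, hQe, he⟩ := ha
    obtain ⟨W, Q₁, hQ₁, ⟨f⟩⟩ := exists_hypPlane_splitting hQ he hQe
    have hdim : Module.finrank K V = 2 + Module.finrank K W := by
      rw [f.toLinearEquiv.finrank_eq, Module.finrank_prod, Module.finrank_prod,
        Module.finrank_self]
    obtain ⟨m, W', Q₀, h1, h2, h3⟩ := ih (Module.finrank K W) (by omega) W Q₁ hQ₁ rfl
    -- The induction yields a kernel inside `W`; it is pushed forward to a submodule of `V`.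
    have e' := Submodule.equivSubtypeMap W W'
    refine ⟨m + 1, W'.map W.subtype, Q₀.comp e'.symm.toLinearMap, ?_, ?_, ?_⟩
    · exact h1.of_equivalent ⟨{ e' with map_app' := fun x => by simp }⟩
    · exact fun x hx => by simpa using h2 _ hx
    · refine QuadraticMap.Equivalent.trans ⟨f⟩ (((QuadraticMap.Equivalent.refl _).prod h3).trans
        ((quadPow_succ_prod_equivalent _ _ _).symm.trans ?_))
      exact (QuadraticMap.Equivalent.refl _).prod
        ⟨{ e' with map_app' := fun x => by simp }⟩

end Witt

/-! ### Isotropic vectors and group orders for a given anisotropic kernel -/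

section Counting

variable {K V : Type*} [Field K] [AddCommGroup V] [Module K V]

theorem card_zeros_of_anisotropic {Q : QuadraticForm K V} (hQ : Q.Anisotropic) :
    Nat.card (Q ⁻¹' {0}) = 1 := by
  have : Q ⁻¹' {0} = {0} := by
    ext x
    exact ⟨fun h => hQ x h, fun h => by rw [Set.mem_singleton_iff.1 h]; simp⟩
  rw [this, Nat.card_coe_set_eq, Set.ncard_singleton]

theorem card_quadO_of_subsingleton [Subsingleton V] (Q : QuadraticForm K V) :
    Nat.card (quadO Q) = 1 := by
  have : Subsingleton (quadO Q) := ⟨fun g g' => Subtype.ext (LinearEquiv.ext fun x =>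
    Subsingleton.elim _ _)⟩
  exact Nat.card_of_subsingleton 1

variable [Finite K] [Finite V]

/-- Iterating `card_zeros_hypPlane_prod` from a single zero. The factor `#K` on the left and the
rearranged terms avoid the exponent `d + m - 1` and any subtraction. -/
theorem card_zeros_quadPow_hypPlane_prod (Q : QuadraticForm K V)
    (hZ : Nat.card (Q ⁻¹' {0}) = 1) {d : ℕ} (hd : Nat.card V = Nat.card K ^ d) (m : ℕ) :
    Nat.card K * Nat.card (((quadPow (hypPlane K) m).prod Q) ⁻¹' {0}) + Nat.card K ^ (d + m) =
      Nat.card K ^ (m + 1) + Nat.card K ^ (d + 2 * m) := by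
  induction m with
  | zero => rw [card_preimage_congr (quadPow_zero_prod_equivalent _ Q), hZ]; ring
  | succ m ih =>
    have h := card_zeros_hypPlane_prod ((quadPow (hypPlane K) m).prod Q)
    rw [← card_preimage_congr (quadPow_succ_prod_equivalent (hypPlane K) Q m)] at h
    have hc : Nat.card ((Fin m → K × K) × V) = Nat.card K ^ (d + 2 * m) := by
      rw [Nat.card_prod, Nat.card_fun, Nat.card_prod, hd, Nat.card_fin]
      ring
    rw [hc] at h
    have h2 := congrArg (Nat.card K * ·) h
    have h3 := congrArg (Nat.card K * ·) ih
    have e1 : Nat.card K ^ (d + (m + 1)) = Nat.card K * Nat.card K ^ (d + m) := by ring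
    have e2 : Nat.card K ^ (m + 1 + 1) = Nat.card K * Nat.card K ^ (m + 1) := by ring
    have e3 : Nat.card K ^ (d + 2 * (m + 1)) =
      Nat.card K * (Nat.card K * Nat.card K ^ (d + 2 * m)) := by ring
    rw [e1, e2, e3]
    linarith

theorem card_quadO_quadPow_succ_prod {Q : QuadraticForm K V} (hQ : QuadNondegenerate Q)
    {d : ℕ} (hd : Nat.card V = Nat.card K ^ d) (m : ℕ) :
    Nat.card (quadO ((quadPow (hypPlane K) (m + 1)).prod Q)) =
      (Nat.card (((quadPow (hypPlane K) (m + 1)).prod Q) ⁻¹' {0}) - 1) *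
        Nat.card K ^ (d + 2 * m) * Nat.card (quadO ((quadPow (hypPlane K) m).prod Q)) := by
  have hc : Nat.card ((Fin m → K × K) × V) = Nat.card K ^ (d + 2 * m) := by
    rw [Nat.card_prod, Nat.card_fun, Nat.card_prod, hd, Nat.card_fin]
    ring
  rw [card_quadO_congr (quadPow_succ_prod_equivalent (hypPlane K) Q m),
    card_preimage_congr (quadPow_succ_prod_equivalent (hypPlane K) Q m),
    card_quadO_hypPlane_prod ((quadNondegenerate_quadPow_hypPlane K m).prod hQ), hc]

/-- The factored form lets the products telescope: the kernel enters the group order only through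
`d` and `#O(Q)`. -/
theorem card_zeros_sub_one {Q : QuadraticForm K V} (hZ : Nat.card (Q ⁻¹' {0}) = 1) {d : ℕ}
    (hd : Nat.card V = Nat.card K ^ d) (m : ℕ) :
    Nat.card (((quadPow (hypPlane K) (m + 1)).prod Q) ⁻¹' {0}) - 1 =
      (Nat.card K ^ (m + 1) - 1) * (Nat.card K ^ (d + m) + 1) := by
  have h := card_zeros_quadPow_hypPlane_prod Q hZ hd (m + 1)
  have hpos : 0 < Nat.card K := Nat.card_pos
  obtain ⟨Z, hZdef⟩ :
    ∃ Z, Z = Nat.card (((quadPow (hypPlane K) (m + 1)).prod Q) ⁻¹' {0}) := ⟨_, rfl⟩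
  rw [← hZdef] at h ⊢
  have h2 : Z + Nat.card K ^ (d + m) = Nat.card K ^ (m + 1) +
      Nat.card K ^ (m + 1) * Nat.card K ^ (d + m) := by
    refine Nat.eq_of_mul_eq_mul_left hpos ?_
    ring_nf at h ⊢
    exact h
  obtain ⟨a, ha⟩ : ∃ a, Nat.card K ^ (m + 1) = a + 1 :=
    ⟨Nat.card K ^ (m + 1) - 1, (Nat.succ_pred_eq_of_pos (pow_pos hpos _)).symm⟩
  rw [ha] at h2 ⊢
  have h3 : Z = 1 + a * (Nat.card K ^ (d + m) + 1) := by
    have : Z + Nat.card K ^ (d + m) =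
      1 + a * (Nat.card K ^ (d + m) + 1) + Nat.card K ^ (d + m) := by rw [h2]; ring
    exact Nat.add_right_cancel this
  rw [h3, Nat.add_sub_cancel_left, Nat.add_sub_cancel]

theorem pow_sub_one_mul_pow_add_one (s m : ℕ) : (s ^ m - 1) * (s ^ m + 1) = s ^ (2 * m) - 1 := by
  have := Nat.sq_sub_sq (s ^ m) 1
  rw [mul_comm, ← this, one_pow, ← pow_mul, mul_comm m 2]

/-- For `d = 0`, the new factor `s^(m+1) + 1` combines with the earlier `s^(m+1) - 1` to give
`s^(2(m+1)) - 1`. The leading `2` is `s^0 + 1` from the first plane. -/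
theorem card_quadO_zero_kernel [Subsingleton V] (Q : QuadraticForm K V) (m : ℕ) :
    Nat.card (quadO ((quadPow (hypPlane K) (m + 1)).prod Q)) =
      2 * Nat.card K ^ (m * (m + 1)) * (Nat.card K ^ (m + 1) - 1) *
        ∏ k ∈ Finset.Icc 1 m, (Nat.card K ^ (2 * k) - 1) := by
  have hQ := quadNondegenerate_of_subsingleton Q
  have hd : Nat.card V = Nat.card K ^ 0 := by simp
  have hZ := card_zeros_of_anisotropic (Q := Q) fun x _ => Subsingleton.elim x 0
  induction m with
  | zero =>
    rw [card_quadO_quadPow_succ_prod hQ hd, card_zeros_sub_one hZ hd,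
      card_quadO_congr (quadPow_zero_prod_equivalent _ Q), card_quadO_of_subsingleton]
    simp
    ring
  | succ m ih =>
    rw [card_quadO_quadPow_succ_prod hQ hd, card_zeros_sub_one hZ hd, ih,
      Finset.prod_Icc_succ_top (by omega), ← pow_sub_one_mul_pow_add_one]
    ring

/-- For `d = 1`, the two factors added at each step already have the same exponent, so no unpaired
factor remains. -/
theorem card_quadO_line_kernel {Q : QuadraticForm K V} (hQ : QuadNondegenerate Q)
    (hZ : Nat.card (Q ⁻¹' {0}) = 1) (hd : Nat.card V = Nat.card K ^ 1)
    (hO : Nat.card (quadO Q) = 2) (m : ℕ) :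
    Nat.card (quadO ((quadPow (hypPlane K) m).prod Q)) =
      2 * Nat.card K ^ (m ^ 2) * ∏ k ∈ Finset.Icc 1 m, (Nat.card K ^ (2 * k) - 1) := by
  induction m with
  | zero =>
    rw [card_quadO_congr (quadPow_zero_prod_equivalent _ Q), hO]
    simp
  | succ m ih =>
    rw [card_quadO_quadPow_succ_prod hQ hd, card_zeros_sub_one hZ hd, ih,
      Finset.prod_Icc_succ_top (by omega), ← pow_sub_one_mul_pow_add_one]
    ring

/-- For `d = 2`, the new `s^(m+1) - 1` combines with the earlier `s^(m+1) + 1`, and `s^(m+2) + 1`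
remains. The `s + 1` in `#O(Q)` starts the chain. -/
theorem card_quadO_plane_kernel {Q : QuadraticForm K V} (hQ : QuadNondegenerate Q)
    (hZ : Nat.card (Q ⁻¹' {0}) = 1) (hd : Nat.card V = Nat.card K ^ 2)
    (hO : Nat.card (quadO Q) = 2 * (Nat.card K + 1)) (m : ℕ) :
    Nat.card (quadO ((quadPow (hypPlane K) m).prod Q)) =
      2 * Nat.card K ^ (m * (m + 1)) * (Nat.card K ^ (m + 1) + 1) *
        ∏ k ∈ Finset.Icc 1 m, (Nat.card K ^ (2 * k) - 1) := by
  induction m with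
  | zero =>
    rw [card_quadO_congr (quadPow_zero_prod_equivalent _ Q), hO]
    simp
  | succ m ih =>
    rw [card_quadO_quadPow_succ_prod hQ hd, card_zeros_sub_one hZ hd, ih,
      Finset.prod_Icc_succ_top (by omega), ← pow_sub_one_mul_pow_add_one]
    ring

end Counting

/-! ### Anisotropic kernels in odd characteristic -/

section OddCharacteristic

variable {K V : Type*} [Field K] [AddCommGroup V] [Module K V]

/-- Take three pairwise orthogonal nonzero vectors. If all are anisotropic, `a² Q x + b² Q y + Q z =
0` is solvable over a finite field of odd order. -/
theorem exists_isotropic_of_three_le_finrank [Finite K] [FiniteDimensional K V]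
    (hK : ringChar K ≠ 2) (Q : QuadraticForm K V) (hV : 3 ≤ Module.finrank K V) :
    ¬ Q.Anisotropic := by
  intro hQ
  have h2 : (2 : K) ≠ 0 := Ring.two_ne_zero hK
  have : Nontrivial V := Module.nontrivial_of_finrank_pos (R := K) (by omega)
  obtain ⟨x, hx⟩ := exists_ne (0 : V)
  have hker : ∀ y : V, ∃ z, z ≠ 0 ∧ QuadraticMap.polar Q z x = 0 ∧ QuadraticMap.polar Q z y = 0 := by
    intro y
    have h := LinearMap.ker_ne_bot_of_finrank_lt
      (f := (Q.polarBilin.flip x).prod (Q.polarBilin.flip y)) (by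
        rw [Module.finrank_prod, Module.finrank_self]; omega)
    obtain ⟨z, hz, hz0⟩ := Submodule.exists_mem_ne_zero_of_ne_bot h
    rw [LinearMap.mem_ker] at hz
    exact ⟨z, hz0, congrArg Prod.fst hz, congrArg Prod.snd hz⟩
  obtain ⟨y, hy, hyx, -⟩ := hker x
  obtain ⟨z, hz, hzx, hzy⟩ := hker y
  have hQx : Q x ≠ 0 := fun h => hx (hQ x h)
  have hQy : Q y ≠ 0 := fun h => hy (hQ y h)
  have hQz : Q z ≠ 0 := fun h => hz (hQ z h)
  have := Fintype.ofFinite K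
  obtain ⟨a, b, hab⟩ := FiniteField.exists_root_sum_quadratic
    (f := Polynomial.C (Q x) * Polynomial.X ^ 2)
    (g := Polynomial.C (Q y) * Polynomial.X ^ 2 + Polynomial.C (Q z))
    (Polynomial.degree_C_mul_X_pow 2 hQx)
    (by
      rw [Polynomial.degree_add_eq_left_of_degree_lt, Polynomial.degree_C_mul_X_pow 2 hQy]
      · rfl
      rw [Polynomial.degree_C_mul_X_pow 2 hQy, Polynomial.degree_C hQz]
      decide)
    (FiniteField.odd_card_of_char_ne_two hK)
  simp only [Polynomial.eval_mul, Polynomial.eval_add, Polynomial.eval_C, Polynomial.eval_pow,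
    Polynomial.eval_X] at hab
  have h0 : Q (z + b • y + a • x) = 0 := by
    rw [map_add_smul, map_add_smul, QuadraticMap.polar_add_left, QuadraticMap.polar_smul_left,
      hzx, hzy, hyx]
    simp only [smul_zero, mul_zero, add_zero]
    linear_combination hab
  -- Pairing with `z` shows that the isotropic vector is nonzero, with no appeal to linear
  -- independence.
  have h1 : QuadraticMap.polar Q (z + b • y + a • x) z = 2 * Q z := by
    rw [QuadraticMap.polar_add_left, QuadraticMap.polar_add_left, QuadraticMap.polar_smul_left,
      QuadraticMap.polar_smul_left, QuadraticMap.polar_comm Q y, QuadraticMap.polar_comm Q x,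
      hzx, hzy, QuadraticMap.polar_self]
    simp
  rw [hQ _ h0, QuadraticMap.polar_zero_left] at h1
  exact mul_ne_zero h2 hQz h1.symm

theorem anisotropic_of_finrank_eq_one {Q : QuadraticForm K V} (hQ : QuadNondegenerate Q)
    (hV : Module.finrank K V = 1) : Q.Anisotropic := by
  intro x hx
  by_contra hne
  obtain ⟨y, hy⟩ := hQ x hne
  obtain ⟨c, rfl⟩ := (finrank_eq_one_iff_of_nonzero' x hne).1 hV y
  rw [QuadraticMap.polarBilin_apply_apply, QuadraticMap.polar_smul_right,
    QuadraticMap.polar_self, hx] at hy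
  simp at hy

/-- An isometry of a line is a scalar `c` with `c² = 1`, and `1 ≠ -1` since `2 ≠ 0`. -/
theorem card_quadO_of_finrank_eq_one (hK : ringChar K ≠ 2) {Q : QuadraticForm K V}
    (hQ : QuadNondegenerate Q) (hV : Module.finrank K V = 1) : Nat.card (quadO Q) = 2 := by
  have h2 : (2 : K) ≠ 0 := Ring.two_ne_zero hK
  have : Nontrivial V := Module.nontrivial_of_finrank_pos (R := K) (by omega)
  obtain ⟨v, hv⟩ := exists_ne (0 : V)
  have hspan := (finrank_eq_one_iff_of_nonzero' v hv).1 hV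
  have hQv : Q v ≠ 0 := fun h => hv (anisotropic_of_finrank_eq_one hQ hV v h)
  have hset : (quadO Q : Set (V ≃ₗ[K] V)) = {1, LinearEquiv.neg K} := by
    ext g
    simp only [SetLike.mem_coe, Set.mem_insert_iff, Set.mem_singleton_iff]
    constructor
    · intro hg
      obtain ⟨c, hc⟩ := hspan (g v)
      have h := hg v
      rw [← hc, QuadraticMap.map_smul, smul_eq_mul] at h
      have hc2 : c * c = 1 := mul_right_cancel₀ hQv (h.trans (one_mul _).symm)
      rcases mul_self_eq_one_iff.1 hc2 with rfl | rfl
      · left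
        ext x
        obtain ⟨d, rfl⟩ := hspan x
        rw [map_smul, ← hc]
        simp
      · right
        ext x
        obtain ⟨d, rfl⟩ := hspan x
        rw [map_smul, ← hc]
        simp
    · rintro (rfl | rfl)
      · exact (quadO Q).one_mem
      · intro x
        simp
  change Nat.card ((quadO Q : Set (V ≃ₗ[K] V)) : Type _) = 2
  rw [hset, Nat.card_coe_set_eq, Set.ncard_pair]
  intro h
  have := LinearEquiv.congr_fun h v
  rw [LinearEquiv.neg_apply, LinearEquiv.coe_one, id, eq_neg_iff_add_eq_zero, ← two_smul K] at this
  exact hv ((smul_eq_zero.1 this).resolve_left h2)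

/-- The rank one form `x ↦ a x²`. -/
def lineForm {K : Type*} [Field K] (a : K) : QuadraticForm K K := a • QuadraticMap.sq

theorem lineForm_apply (a x : K) : lineForm a x = a * (x * x) := rfl

theorem polar_lineForm (a x y : K) : QuadraticMap.polar (lineForm a) x y = 2 * a * x * y := by
  simp only [QuadraticMap.polar, lineForm_apply]
  ring

theorem quadNondegenerate_lineForm (hK : ringChar K ≠ 2) {a : K} (ha : a ≠ 0) :
    QuadNondegenerate (lineForm a) := by
  intro x hx
  refine ⟨1, ?_⟩
  rw [QuadraticMap.polarBilin_apply_apply, polar_lineForm]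
  simp [Ring.two_ne_zero hK, ha, hx]

variable [Finite K] [Finite V]

/-- Count the zeros of the ternary form `Q x - a t²` twice. It is isotropic, hence a hyperbolic
plane plus a line, with `s²` zeros. Scaling by `t` gives `1 + (s - 1) · #Q⁻¹(a)`. -/
theorem card_preimage_of_anisotropic_plane (hK : ringChar K ≠ 2) {Q : QuadraticForm K V}
    (hQ : QuadNondegenerate Q) (ha : Q.Anisotropic) (hV : Module.finrank K V = 2) {a : K}
    (ha0 : a ≠ 0) : Nat.card (Q ⁻¹' {a}) = Nat.card K + 1 := by
  have hP : QuadNondegenerate (Q.prod (lineForm (-a))) :=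
    hQ.prod (quadNondegenerate_lineForm hK (neg_ne_zero.2 ha0))
  have hdim : Module.finrank K (V × K) = 3 := by
    rw [Module.finrank_prod, hV, Module.finrank_self]
  have hiso := exists_isotropic_of_three_le_finrank hK (Q.prod (lineForm (-a))) hdim.ge
  simp only [QuadraticMap.Anisotropic, not_forall] at hiso
  obtain ⟨e, hQe, he⟩ := hiso
  obtain ⟨W, Q₀, hQ₀, hf⟩ := exists_hypPlane_splitting hP he hQe
  have hW : Module.finrank K W = 1 := by
    obtain ⟨f⟩ := hf
    have := f.toLinearEquiv.finrank_eq
    rw [hdim, Module.finrank_prod, Module.finrank_prod, Module.finrank_self] at this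
    omega
  have hcard := card_zeros_hypPlane_prod Q₀
  rw [card_zeros_of_anisotropic (anisotropic_of_finrank_eq_one hQ₀ hW), ← card_preimage_congr hf,
    Module.natCard_eq_pow_finrank (K := K) (V := W), hW] at hcard
  have hcount : Nat.card (Unit ⊕ (Kˣ × (Q ⁻¹' {a}))) =
      Nat.card ((Q.prod (lineForm (-a))) ⁻¹' {0}) := by
    refine Nat.card_congr (Equiv.ofBijective (Sum.elim (fun _ => ⟨0, by simp⟩)
      (fun p => ⟨((p.1 : K) • p.2.1, (p.1 : K)), by
        have := p.2.2
        simp only [Set.mem_preimage, Set.mem_singleton_iff] at this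
        simp [QuadraticMap.map_smul, this, lineForm_apply, mul_comm]⟩)) ⟨?_, ?_⟩)
    · rintro (_ | ⟨u, x, hx⟩) (_ | ⟨u', x', hx'⟩) h
      · rfl
      · simp [Prod.ext_iff] at h
        exact absurd h.2.symm u'.ne_zero
      · simp [Prod.ext_iff] at h
      · simp only [Sum.elim_inr, Subtype.mk.injEq, Prod.mk.injEq] at h
        obtain ⟨h1, h2⟩ := h
        obtain rfl := Units.ext h2
        have := smul_right_injective V u.ne_zero h1
        subst this
        rfl
    · rintro ⟨⟨x, t⟩, h⟩
      simp only [Set.mem_preimage, QuadraticMap.prod_apply, lineForm_apply,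
        Set.mem_singleton_iff] at h
      by_cases ht : t = 0
      · subst ht
        have hx : x = 0 := ha x (by simpa using h)
        subst hx
        exact ⟨Sum.inl (), rfl⟩
      · refine ⟨Sum.inr (Units.mk0 t ht, ⟨t⁻¹ • x, ?_⟩), ?_⟩
        · have : Q x = a * (t * t) := by linear_combination h
          simp only [Set.mem_preimage, Set.mem_singleton_iff, QuadraticMap.map_smul, this,
            smul_eq_mul]
          field_simp
        · simp [smul_smul, ht]
  rw [Nat.card_sum, Nat.card_prod, Nat.card_units, Nat.card_unique] at hcount
  rw [← hcount] at hcard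
  obtain ⟨t, ht⟩ : ∃ t, Nat.card K = t + 2 :=
    ⟨Nat.card K - 2, (Nat.sub_add_cancel (Finite.one_lt_card (α := K))).symm⟩
  rw [ht] at hcard ⊢
  refine Nat.eq_of_mul_eq_mul_left (Nat.succ_pos t) ?_
  simp only [Nat.add_succ_sub_one] at hcard
  rw [Nat.succ_eq_add_one]
  linarith

/-- Reflections act transitively on the `s + 1` vectors with the same value as `v`, since
differences of distinct vectors are anisotropic. The stabiliser is the group of the complementary
line, of order two. -/
theorem card_quadO_of_anisotropic_plane (hK : ringChar K ≠ 2) {Q : QuadraticForm K V}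
    (hQ : QuadNondegenerate Q) (ha : Q.Anisotropic) (hV : Module.finrank K V = 2) :
    Nat.card (quadO Q) = 2 * (Nat.card K + 1) := by
  have : Nontrivial V := Module.nontrivial_of_finrank_pos (R := K) (by omega)
  have h2 : (2 : K) ≠ 0 := Ring.two_ne_zero hK
  obtain ⟨v, hv⟩ := exists_ne (0 : V)
  have hQv : Q v ≠ 0 := fun h => hv (ha v h)
  have hL := quadNondegenerate_lineForm hK hQv
  have hsplit := equivalent_of_splitting (q := Q) hL (LinearMap.toSpanSingleton K V v)
    -- The polar form of `t ↦ Q v · t²` is `2 Q v · t t'`, hence the normalising factor.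
    ((2 * Q v)⁻¹ • Q.polarBilin.flip v)
    (fun x y => by
      simp [polar_lineForm]
      field_simp)
    (fun x => by simp [lineForm_apply, QuadraticMap.map_smul, mul_comm])
  generalize LinearMap.ker ((2 * Q v)⁻¹ • Q.polarBilin.flip v) = W at hsplit
  generalize Q.comp W.subtype = Q₀ at hsplit
  have hP := hQ.of_equivalent hsplit
  have hQ₀ := hP.of_prod_right
  have hPa : ((lineForm (Q v)).prod Q₀).Anisotropic := by
    obtain ⟨f⟩ := hsplit
    intro x hx
    have := ha (f.symm x) (by rw [f.symm.map_app, hx])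
    simpa using this
  have hPV : Module.finrank K (K × W) = 2 := by
    obtain ⟨f⟩ := hsplit
    rw [← hV]
    exact f.toLinearEquiv.finrank_eq.symm
  have hW : Module.finrank K W = 1 := by
    rw [Module.finrank_prod, Module.finrank_self] at hPV
    omega
  have hP1 : (lineForm (Q v)).prod Q₀ (1, 0) = Q v := by simp [lineForm_apply]
  rw [card_quadO_congr hsplit, card_quadO_prod hL (fun g => g (1, 0)) ?_ ?_
    (((lineForm (Q v)).prod Q₀) ⁻¹' {Q v}) ?_ ?_,
    card_preimage_of_anisotropic_plane hK hP hPa hPV hQv, card_quadO_of_finrank_eq_one hK hQ₀ hW,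
    mul_comm]
  · intro g g' _ _ h x
    have hx : ((x, 0) : K × W) = x • (1, 0) := by ext <;> simp
    rw [hx, map_smul, map_smul, h]
  · intro g g' h
    exact h 1
  · intro g hg
    exact (hg _).trans hP1
  · intro y hy
    rw [Set.mem_preimage, Set.mem_singleton_iff] at hy
    by_cases hxy : ((1, 0) : K × W) = y
    · exact ⟨1, (quadO _).one_mem, hxy⟩
    · exact exists_isometry_of_sub_anisotropic hP (hP1.trans hy.symm)
        fun h => hxy (sub_eq_zero.1 (hPa _ h))

theorem finrank_quadPow_hypPlane_domain (K : Type*) [Field K] (m : ℕ) :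
    Module.finrank K (Fin m → K × K) = 2 * m := by
  rw [Module.finrank_pi_fintype]
  simp [mul_comm]

theorem card_quadO_of_odd_finrank (hK : ringChar K ≠ 2) {Q : QuadraticForm K V}
    (hQ : QuadNondegenerate Q) {m : ℕ} (hV : Module.finrank K V = 2 * m + 1) :
    Nat.card (quadO Q) =
      2 * Nat.card K ^ (m ^ 2) * ∏ k ∈ Finset.Icc 1 m, (Nat.card K ^ (2 * k) - 1) := by
  obtain ⟨n, W, Q₀, hQ₀, ha, hf⟩ := exists_witt_decomposition _ V Q hQ rfl
  have hdim : Module.finrank K V = 2 * n + Module.finrank K W := by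
    obtain ⟨f⟩ := hf
    rw [f.toLinearEquiv.finrank_eq, Module.finrank_prod, finrank_quadPow_hypPlane_domain K]
  have hW : Module.finrank K W < 3 := by
    by_contra h
    exact exists_isotropic_of_three_le_finrank hK Q₀ (not_lt.1 h) ha
  have hW1 : Module.finrank K W = 1 := by omega
  obtain rfl : n = m := by omega
  rw [card_quadO_congr hf, card_quadO_line_kernel hQ₀ (card_zeros_of_anisotropic ha)
    (by rw [Module.natCard_eq_pow_finrank (K := K) (V := W), hW1])
    (card_quadO_of_finrank_eq_one hK hQ₀ hW1)]

/-- The kernel has even dimension below three and is nonzero, so it is a plane. -/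
theorem card_quadO_of_not_hyperbolic (hK : ringChar K ≠ 2) {Q : QuadraticForm K V}
    (hQ : QuadNondegenerate Q) {m : ℕ} (hV : Module.finrank K V = 2 * (m + 1))
    (hH : ∀ n : ℕ, ¬ Q.Equivalent (quadPow (hypPlane K) n)) :
    Nat.card (quadO Q) =
      2 * Nat.card K ^ (m * (m + 1)) * (Nat.card K ^ (m + 1) + 1) *
        ∏ k ∈ Finset.Icc 1 m, (Nat.card K ^ (2 * k) - 1) := by
  obtain ⟨n, W, Q₀, hQ₀, ha, hf⟩ := exists_witt_decomposition _ V Q hQ rfl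
  have hdim : Module.finrank K V = 2 * n + Module.finrank K W := by
    obtain ⟨f⟩ := hf
    rw [f.toLinearEquiv.finrank_eq, Module.finrank_prod, finrank_quadPow_hypPlane_domain K]
  have hW : Module.finrank K W < 3 := by
    by_contra h
    exact exists_isotropic_of_three_le_finrank hK Q₀ (not_lt.1 h) ha
  have hW0 : Module.finrank K W ≠ 0 := by
    intro h0
    have := Module.finrank_zero_iff.1 h0
    exact hH n (hf.trans (equivalent_prod_of_subsingleton _ _))
  have hW1 : Module.finrank K W = 2 := by omega
  obtain rfl : n = m := by omega
  rw [card_quadO_congr hf, card_quadO_plane_kernel hQ₀ (card_zeros_of_anisotropic ha)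
    (by rw [Module.natCard_eq_pow_finrank (K := K) (V := W), hW1])
    (card_quadO_of_anisotropic_plane hK hQ₀ ha hW1)]

end OddCharacteristic

/-! ### Hyperbolic forms in any characteristic -/

section Hyperbolic

variable {K V : Type*} [Field K] [Finite K] [AddCommGroup V] [Module K V]

theorem card_quadO_of_hyperbolic {Q : QuadraticForm K V} {m : ℕ}
    (h : Q.Equivalent (quadPow (hypPlane K) (m + 1))) :
    Nat.card (quadO Q) =
      2 * Nat.card K ^ (m * (m + 1)) * (Nat.card K ^ (m + 1) - 1) *
        ∏ k ∈ Finset.Icc 1 m, (Nat.card K ^ (2 * k) - 1) := by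
  rw [← card_quadO_zero_kernel (0 : QuadraticForm K PUnit)]
  exact card_quadO_congr (h.trans (equivalent_prod_of_subsingleton _ _).symm)

end Hyperbolic

/-! ### Quadratic forms over `ℤ/2ℤ` and the symplectic group -/

section CharTwo

theorem zmod_two_eq_one_of_ne_zero {a : ZMod 2} (h : a ≠ 0) : a = 1 := by
  revert a; decide

theorem zmod_two_mul_self (a : ZMod 2) : a * a = a := by
  revert a; decide

/-- The anisotropic plane over `ℤ/2ℤ`. -/
def anisotropicPlane : QuadraticForm (ZMod 2) (ZMod 2 × ZMod 2) :=
  QuadraticMap.linMulLin (LinearMap.fst _ _ _) (LinearMap.fst _ _ _) +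
    QuadraticMap.linMulLin (LinearMap.fst _ _ _) (LinearMap.snd _ _ _) +
    QuadraticMap.linMulLin (LinearMap.snd _ _ _) (LinearMap.snd _ _ _)

theorem anisotropicPlane_apply (x : ZMod 2 × ZMod 2) :
    anisotropicPlane x = x.1 * x.1 + x.1 * x.2 + x.2 * x.2 := rfl

theorem polar_anisotropicPlane (x y : ZMod 2 × ZMod 2) :
    QuadraticMap.polar anisotropicPlane x y = x.1 * y.2 + x.2 * y.1 := by
  simp only [QuadraticMap.polar, anisotropicPlane_apply, Prod.fst_add, Prod.snd_add]
  ring_nf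
  simp [CharTwo.two_eq_zero]

theorem assocBilin_anisotropicPlane :
    assocBilin anisotropicPlane = assocBilin (hypPlane (ZMod 2)) := by
  refine LinearMap.ext₂ fun x y => ?_
  rw [QuadraticMap.polarBilin_apply_apply, QuadraticMap.polarBilin_apply_apply,
    polar_anisotropicPlane, polar_hypPlane]

theorem quadNondegenerate_anisotropicPlane : QuadNondegenerate anisotropicPlane := by
  rw [QuadNondegenerate, assocBilin_anisotropicPlane]
  exact quadNondegenerate_hypPlane

theorem anisotropic_anisotropicPlane : anisotropicPlane.Anisotropic := by
  rintro ⟨a, b⟩ h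
  rw [anisotropicPlane_apply] at h
  revert a b
  decide

/-- The form is `1` on every nonzero vector, so every linear automorphism is an isometry and the
group is `GL₂(𝔽₂)`. -/
theorem card_quadO_anisotropicPlane : Nat.card (quadO anisotropicPlane) = 6 := by
  have h : ∀ g, g ∈ quadO anisotropicPlane := by
    intro g x
    by_cases hx : x = 0
    · rw [hx, map_zero]
    · rw [zmod_two_eq_one_of_ne_zero fun h => hx (anisotropic_anisotropicPlane _ h),
        zmod_two_eq_one_of_ne_zero fun h => hx
          ((LinearEquiv.map_eq_zero_iff g).1 (anisotropic_anisotropicPlane _ h))]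
  rw [Nat.card_congr (Equiv.subtypeUnivEquiv h),
    ← Nat.card_congr (autEquivOfLinearEquiv (LinearEquiv.finTwoArrow (ZMod 2) (ZMod 2))),
    ← Nat.card_congr (LinearMap.GeneralLinearGroup.generalLinearEquiv (ZMod 2)
      (Fin 2 → ZMod 2)).toEquiv,
    ← Nat.card_congr (Matrix.GeneralLinearGroup.toLin (n := Fin 2) (R := ZMod 2)).toEquiv,
    Matrix.card_GL_field]
  simp [Fin.prod_univ_two]

variable {V : Type*} [AddCommGroup V] [Module (ZMod 2) V]

theorem polar_self_eq_zero (Q : QuadraticForm (ZMod 2) V) (x : V) :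
    QuadraticMap.polar Q x x = 0 := by
  rw [QuadraticMap.polar_self, two_nsmul, CharTwo.add_self_eq_zero]

/-- All nonzero values are `1`, so any two distinct nonzero vectors pair to `1`. Nothing nonzero is
orthogonal to two such vectors, so the plane they span is the whole space. -/
theorem equivalent_anisotropicPlane {Q : QuadraticForm (ZMod 2) V} (hQ : QuadNondegenerate Q)
    (ha : Q.Anisotropic) [Nontrivial V] : Q.Equivalent anisotropicPlane := by
  have hval : ∀ x, x ≠ 0 → Q x = 1 := fun x hx =>
    zmod_two_eq_one_of_ne_zero fun h => hx (ha x h)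
  have hadd : ∀ x y : V, x ≠ y → x + y ≠ 0 := by
    intro x y hxy h
    exact hxy (add_right_cancel (h.trans (ZModModule.add_self y).symm))
  have hpol : ∀ x y, x ≠ 0 → y ≠ 0 → x ≠ y → QuadraticMap.polar Q x y = 1 := by
    intro x y hx hy hxy
    rw [QuadraticMap.polar, hval x hx, hval y hy, hval _ (hadd x y hxy)]
    decide
  obtain ⟨x, hx⟩ := exists_ne (0 : V)
  obtain ⟨y, hxy⟩ := hQ x hx
  rw [QuadraticMap.polarBilin_apply_apply] at hxy
  have hne : x ≠ y := by
    rintro rfl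
    exact hxy (polar_self_eq_zero Q x)
  have hy : y ≠ 0 := by
    rintro rfl
    exact hxy (QuadraticMap.polar_zero_right Q x)
  have hxy1 := hpol x y hx hy hne
  have h := equivalent_of_splitting (q := Q) quadNondegenerate_anisotropicPlane
    ((LinearMap.toSpanSingleton (ZMod 2) V x).coprod (LinearMap.toSpanSingleton (ZMod 2) V y))
    ((Q.polarBilin.flip y).prod (Q.polarBilin.flip x))
    (fun z c => by
      simp [polar_anisotropicPlane, QuadraticMap.polar_add_right, QuadraticMap.polar_smul_right]
      ring)
    (fun c => by
      simp [map_add_smul, anisotropicPlane_apply, QuadraticMap.map_smul, hval x hx, hval y hy,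
        QuadraticMap.polar_smul_left, hxy1]
      linear_combination -zmod_two_mul_self c.2)
  refine h.trans ?_
  have hsub : Subsingleton (LinearMap.ker ((Q.polarBilin.flip y).prod (Q.polarBilin.flip x))) := by
    refine subsingleton_of_forall_eq 0 ?_
    rintro ⟨z, hz⟩
    rw [LinearMap.mem_ker] at hz
    have h1 : QuadraticMap.polar Q z y = 0 := congrArg Prod.fst hz
    have h2 : QuadraticMap.polar Q z x = 0 := congrArg Prod.snd hz
    refine Subtype.ext ?_
    by_contra hz0
    change z ≠ 0 at hz0
    by_cases hzx : z = x
    · rw [hzx, hxy1] at h1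
      exact one_ne_zero h1
    · rw [hpol z x hz0 hx hzx] at h2
      exact one_ne_zero h2
  exact equivalent_prod_of_subsingleton _ _

theorem equivalent_quadPow_or_of_nondegenerate [Finite V] {Q : QuadraticForm (ZMod 2) V}
    (hQ : QuadNondegenerate Q) :
    (∃ m, Q.Equivalent (quadPow (hypPlane (ZMod 2)) m)) ∨
      ∃ m, Q.Equivalent ((quadPow (hypPlane (ZMod 2)) m).prod anisotropicPlane) := by
  obtain ⟨m, W, Q₀, hQ₀, ha, hf⟩ := exists_witt_decomposition _ V Q hQ rfl
  rcases subsingleton_or_nontrivial W with h | h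
  · exact Or.inl ⟨m, hf.trans (equivalent_prod_of_subsingleton _ _)⟩
  · exact Or.inr ⟨m, hf.trans ((QuadraticMap.Equivalent.refl _).prod
      (equivalent_anisotropicPlane hQ₀ ha))⟩

theorem card_zeros_quadPow_hypPlane (m : ℕ) :
    Nat.card ((quadPow (hypPlane (ZMod 2)) (m + 1)) ⁻¹' {0}) = 2 ^ m * (2 ^ (m + 1) + 1) := by
  have h := card_zeros_quadPow_hypPlane_prod (0 : QuadraticForm (ZMod 2) PUnit)
    (card_zeros_of_anisotropic fun x _ => rfl) (d := 0) (by simp) (m + 1)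
  rw [card_preimage_congr (equivalent_prod_of_subsingleton _ _), Nat.card_zmod] at h
  ring_nf at h ⊢
  omega

theorem card_zeros_quadPow_hypPlane_prod_anisotropicPlane (m : ℕ) :
    Nat.card (((quadPow (hypPlane (ZMod 2)) m).prod anisotropicPlane) ⁻¹' {0}) =
      2 ^ m * (2 ^ (m + 1) - 1) := by
  have h := card_zeros_quadPow_hypPlane_prod anisotropicPlane
    (card_zeros_of_anisotropic anisotropic_anisotropicPlane) (d := 2) (by simp) m
  rw [Nat.card_zmod] at h
  rw [Nat.mul_sub]
  ring_nf at h ⊢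
  omega

theorem card_quadO_quadPow_hypPlane (m : ℕ) :
    Nat.card (quadO (quadPow (hypPlane (ZMod 2)) (m + 1))) =
      2 ^ (m * (m + 1) + 1) * (2 ^ (m + 1) - 1) * ∏ k ∈ Finset.Icc 1 m, (2 ^ (2 * k) - 1) := by
  rw [card_quadO_of_hyperbolic (.refl _), Nat.card_zmod]
  ring

theorem card_quadO_quadPow_hypPlane_prod_anisotropicPlane (m : ℕ) :
    Nat.card (quadO ((quadPow (hypPlane (ZMod 2)) m).prod anisotropicPlane)) =
      2 ^ (m * (m + 1) + 1) * (2 ^ (m + 1) + 1) * ∏ k ∈ Finset.Icc 1 m, (2 ^ (2 * k) - 1) := by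
  rw [card_quadO_plane_kernel quadNondegenerate_anisotropicPlane
    (card_zeros_of_anisotropic anisotropic_anisotropicPlane) (by simp)
    (by rw [card_quadO_anisotropicPlane, Nat.card_zmod]), Nat.card_zmod]
  ring

/-- Zeros and non-zeros are never equally many: by the classification, twice the number of zeros is
`2^(2m) ± 2^m` when `#V = 2^(2m)`. This gives `Q w = 0` in `card_bilinO_eq`. -/
theorem two_mul_card_zeros_ne [Finite V] {Q : QuadraticForm (ZMod 2) V}
    (hQ : QuadNondegenerate Q) : 2 * Nat.card (Q ⁻¹' {0}) ≠ Nat.card V := by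
  intro h
  rcases equivalent_quadPow_or_of_nondegenerate hQ with ⟨m, hm⟩ | ⟨m, hm⟩
  · have hc : Nat.card V = 2 ^ (2 * m) := by
      obtain ⟨f⟩ := hm
      rw [Nat.card_congr f.toLinearEquiv.toEquiv]
      simp [pow_mul]
    rw [card_preimage_congr hm, hc] at h
    rcases m with _ | m
    · simp at h
    · rw [card_zeros_quadPow_hypPlane] at h
      have : 0 < 2 ^ m := by positivity
      ring_nf at h
      omega
  · have hc : Nat.card V = 2 ^ (2 * m + 2) := by
      obtain ⟨f⟩ := hm
      rw [Nat.card_congr f.toLinearEquiv.toEquiv]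
      simp [pow_mul, pow_add]
    rw [card_preimage_congr hm, hc, card_zeros_quadPow_hypPlane_prod_anisotropicPlane,
      Nat.mul_sub] at h
    have h1 : 0 < 2 ^ m := by positivity
    have h2 : 2 ^ m * 2 ^ (m + 1) = 2 * (2 ^ m * 2 ^ m) := by ring
    have h3 : 2 ^ (2 * m + 2) = 4 * (2 ^ m * 2 ^ m) := by ring
    have h4 : 2 ^ m ≤ 2 ^ m * 2 ^ m := Nat.le_mul_of_pos_left _ h1
    rw [h2, h3] at h
    generalize 2 ^ m * 2 ^ m = b at *
    omega

/-- The two cross terms coincide and cancel modulo two, and `B(w, w) = 2 Q w` vanishes. -/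
theorem exists_transvection [Finite V] {Q : QuadraticForm (ZMod 2) V} (hQ : QuadNondegenerate Q)
    (w : V) : ∃ g ∈ bilinO (assocBilin Q), ∀ x, g x = x + QuadraticMap.polar Q x w • w := by
  refine exists_mem_bilinO_of_preserves hQ (LinearMap.id + (Q.polarBilin.flip w).smulRight w) ?_
  intro x y
  simp [QuadraticMap.polar_add_right, QuadraticMap.polar_smul_right]
  rw [QuadraticMap.polar_comm Q w y]
  linear_combination (QuadraticMap.polar Q x w * QuadraticMap.polar Q y w * (1 + Q w)) *
    CharTwo.two_eq_zero (R := ZMod 2)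

theorem exists_polar_eq [Finite V] {Q : QuadraticForm (ZMod 2) V} (hQ : QuadNondegenerate Q)
    (f : V →ₗ[ZMod 2] ZMod 2) : ∃ w, ∀ x, f x = QuadraticMap.polar Q x w := by
  have hinj : Function.Injective Q.polarBilin := by
    rw [injective_iff_map_eq_zero]
    intro x hx
    by_contra hne
    obtain ⟨y, hy⟩ := hQ x hne
    exact hy (by rw [hx]; rfl)
  obtain ⟨w, hw⟩ := (LinearMap.injective_iff_surjective_of_finrank_eq_finrank
    (Subspace.dual_finrank_eq (K := ZMod 2) (V := V)).symm).1 hinj f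
  exact ⟨w, fun x => by rw [← hw, QuadraticMap.polarBilin_apply_apply, QuadraticMap.polar_comm]⟩

/-- The symplectic group acts simply transitively modulo `O(Q)` on the zeros of `Q`. -/
theorem card_bilinO_eq [Finite V] {Q : QuadraticForm (ZMod 2) V} (hQ : QuadNondegenerate Q) :
    Nat.card (bilinO (assocBilin Q)) = Nat.card (Q ⁻¹' {0}) * Nat.card (quadO Q) := by
  choose T hT hTx using exists_transvection hQ
  have hQT : ∀ w, Q w = 0 → ∀ x, Q (T w x) = Q x + QuadraticMap.polar Q x w := by
    intro w hw x
    rw [hTx, map_add_smul, hw, mul_zero, add_zero, zmod_two_mul_self]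
  rw [← Nat.card_prod]
  symm
  -- The bijection is `(w, h) ↦ h ∘ T_w`; `w` is recovered from `Q ∘ T_w - Q = B(·, w)`.
  refine Nat.card_congr (Equiv.ofBijective (fun p : (Q ⁻¹' {0}) × quadO Q =>
    (⟨p.2 * T p.1, (bilinO _).mul_mem (quadO_le_bilinO Q p.2.2) (hT _)⟩ :
      bilinO (assocBilin Q))) ⟨?_, ?_⟩)
  · rintro ⟨⟨w, hw⟩, ⟨h, hh⟩⟩ ⟨⟨w', hw'⟩, ⟨h', hh'⟩⟩ heq
    have heq' : h * T w = h' * T w' := congrArg Subtype.val heq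
    have hww : w = w' := by
      by_contra hne
      obtain ⟨x, hx⟩ := hQ _ (sub_ne_zero.2 hne)
      apply hx
      have h1 := congrArg Q (LinearEquiv.congr_fun heq' x)
      rw [LinearEquiv.mul_apply, LinearEquiv.mul_apply, hh, hh', hQT w hw, hQT w' hw'] at h1
      rw [QuadraticMap.polarBilin_apply_apply, QuadraticMap.polar_comm,
        QuadraticMap.polar_sub_right, add_left_cancel h1, sub_self]
    subst hww
    obtain rfl := mul_right_cancel heq'
    rfl
  · rintro ⟨g, hg⟩
    have hg' : ∀ x y, QuadraticMap.polar Q (g x) (g y) = QuadraticMap.polar Q x y := hg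
    -- `Q ∘ g - Q` is additive because `g` preserves the polar form, and homogeneous because `a² =
    -- a` in `ℤ/2ℤ`.
    obtain ⟨w, hw⟩ := exists_polar_eq hQ
      { toFun := fun x => Q (g x) - Q x
        map_add' := fun x y => by
          rw [map_add, QuadraticMap.map_add (⇑Q), QuadraticMap.map_add (⇑Q), hg']
          ring
        map_smul' := fun a x => by
          rw [map_smul, QuadraticMap.map_smul, QuadraticMap.map_smul, zmod_two_mul_self,
            RingHom.id_apply, smul_sub] }
    change ∀ x, Q (g x) - Q x = QuadraticMap.polar Q x w at hw
    have hw0 : Q w = 0 := by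
      by_contra hne
      have hw1 := zmod_two_eq_one_of_ne_zero hne
      -- If `Q w = 1`, a permutation of `V` would exchange zeros and non-zeros, making them equally
      -- many.
      have h1 : ∀ x, Q (g x) = Q (x + w) + 1 := by
        intro x
        rw [QuadraticMap.map_add (⇑Q), hw1, ← hw]
        linear_combination -(CharTwo.two_eq_zero (R := ZMod 2))
      have h2 : Nat.card (Q ⁻¹' {0}) = Nat.card ((Q ⁻¹' {0})ᶜ : Set V) := by
        refine Nat.card_congr (Equiv.subtypeEquiv
          (g.symm.toEquiv.trans (Equiv.addRight w)) fun x => ?_)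
        change Q x = 0 ↔ ¬ Q (g.symm x + w) = 0
        have h3 := h1 (g.symm x)
        rw [g.apply_symm_apply] at h3
        rw [h3]
        generalize Q (g.symm x + w) = a
        revert a
        decide
      have h4 := Set.ncard_add_ncard_compl (Q ⁻¹' {0})
      rw [← Nat.card_coe_set_eq, ← Nat.card_coe_set_eq, ← h2] at h4
      exact two_mul_card_zeros_ne hQ (by rw [two_mul, h4])
    have hmem : g * (T w)⁻¹ ∈ quadO Q := by
      intro x
      obtain ⟨y, rfl⟩ := (T w).surjective x
      have : (g * (T w)⁻¹) (T w y) = g y := by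
        rw [← LinearEquiv.mul_apply, inv_mul_cancel_right]
      rw [this, hQT w hw0, ← hw]
      ring
    exact ⟨(⟨w, hw0⟩, ⟨_, hmem⟩), Subtype.ext (by simp)⟩

theorem card_bilinO_quadPow_hypPlane (m : ℕ) :
    Nat.card (bilinO (assocBilin (quadPow (hypPlane (ZMod 2)) m))) =
      2 ^ (m ^ 2) * ∏ k ∈ Finset.Icc 1 m, (2 ^ (2 * k) - 1) := by
  rw [card_bilinO_eq (quadNondegenerate_quadPow_hypPlane _ m)]
  rcases m with _ | m
  · rw [card_quadO_of_subsingleton, card_zeros_of_anisotropic fun x _ => Subsingleton.elim x 0]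
    simp
  · rw [card_zeros_quadPow_hypPlane, card_quadO_quadPow_hypPlane,
      Finset.prod_Icc_succ_top (by omega), ← pow_sub_one_mul_pow_add_one]
    ring

end CharTwo

/-! ### Passing from values in `ℚ/pℤ` to values in `ℤ/pℤ` -/

section Lift

variable {p : ℕ} [Fact p.Prime] {V W : Type*} [AddCommGroup V] [Module (ZMod p) V]
  [AddCommGroup W] [Module (ZMod p) W]

theorem zmodToQMod_injective (p : ℕ) [Fact p.Prime] : Function.Injective (zmodToQMod p) := by
  rw [injective_iff_map_eq_zero]
  intro a ha
  obtain ⟨k, rfl⟩ := ZMod.intCast_surjective a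
  rw [zmodToQMod_intCast, QuotientAddGroup.eq_zero_iff, AddSubgroup.mem_zmultiples_iff] at ha
  obtain ⟨j, hj⟩ := ha
  rw [ZMod.intCast_zmod_eq_zero_iff_dvd]
  refine ⟨j, ?_⟩
  have : ((j * p : ℤ) : ℚ) = k := by
    rw [← hj]
    simp
  rw [mul_comm]
  exact_mod_cast this.symm

/-- If `p r ∈ pℤ`, then `r` is an integer: the embedded `ℤ/pℤ` is the whole `p`-torsion. -/
theorem exists_zmodToQMod_eq {x : QMod p} (hx : p • x = 0) : ∃ a, zmodToQMod p a = x := by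
  obtain ⟨r, rfl⟩ := QuotientAddGroup.mk_surjective x
  rw [← QuotientAddGroup.mk_nsmul, QuotientAddGroup.eq_zero_iff,
    AddSubgroup.mem_zmultiples_iff] at hx
  obtain ⟨j, hj⟩ := hx
  refine ⟨(j : ZMod p), ?_⟩
  rw [zmodToQMod_intCast]
  have hp : (p : ℚ) ≠ 0 := by exact_mod_cast (Fact.out : p.Prime).ne_zero
  congr 1
  simp only [zsmul_eq_mul, nsmul_eq_mul] at hj
  rw [mul_comm] at hj
  exact mul_left_cancel₀ hp hj

/-- `Q` is the `ℤ/pℤ`-valued version of the `ℚ/pℤ`-valued form `q`. -/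
def QuadLift (q : QuadraticMap ℤ V (QMod p)) (Q : QuadraticForm (ZMod p) V) : Prop :=
  ∀ x, q x = zmodToQMod p (Q x)

/-- `B` is the `ℤ/pℤ`-valued version of the `ℚ/pℤ`-valued bilinear form `b`. -/
def BilinLift (b : LinearMap.BilinMap ℤ V (QMod p)) (B : LinearMap.BilinMap (ZMod p) V (ZMod p)) :
    Prop :=
  ∀ x y, b x y = zmodToQMod p (B x y)

/-- Additive equivalences of `ℤ/pℤ`-modules are linear. -/
def zmodLinearEquiv (f : V ≃ₗ[ℤ] W) : V ≃ₗ[ZMod p] W where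
  __ := f.toAddEquiv
  map_smul' c x := ZMod.map_smul f.toAddEquiv c x

/-- Linear equivalences of `ℤ/pℤ`-modules are the same as `ℤ`-linear ones. -/
def zmodLinearEquivEquiv (p : ℕ) [Fact p.Prime] (V W : Type*) [AddCommGroup V] [Module (ZMod p) V]
    [AddCommGroup W] [Module (ZMod p) W] : (V ≃ₗ[ℤ] W) ≃ (V ≃ₗ[ZMod p] W) where
  toFun f := zmodLinearEquiv f
  invFun f := f.toAddEquiv.toIntLinearEquiv
  left_inv _ := rfl
  right_inv _ := rfl

theorem exists_bilinLift (b : LinearMap.BilinMap ℤ V (QMod p)) :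
    ∃ B : LinearMap.BilinMap (ZMod p) V (ZMod p), BilinLift b B := by
  have h : ∀ x y, ∃ a, zmodToQMod p a = b x y := by
    intro x y
    apply exists_zmodToQMod_eq
    rw [← LinearMap.map_smul_of_tower, ZModModule.char_nsmul_eq_zero, map_zero]
  choose B hB using h
  have hadd : ∀ x x' y, B (x + x') y = B x y + B x' y := by
    intro x x' y
    apply zmodToQMod_injective p
    rw [map_add, hB, hB, hB, map_add, LinearMap.add_apply]
  have hadd' : ∀ x y y', B x (y + y') = B x y + B x y' := by
    intro x y y'
    apply zmodToQMod_injective p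
    rw [map_add, hB, hB, hB, map_add]
  refine ⟨LinearMap.mk₂ (ZMod p) B hadd ?_ hadd' ?_, fun x y => (hB x y).symm⟩
  · intro c x y
    exact ZMod.map_smul (AddMonoidHom.mk' (fun x => B x y) fun x x' => hadd x x' y) c x
  · intro c x y
    exact ZMod.map_smul (AddMonoidHom.mk' (fun y => B x y) fun y y' => hadd' x y y') c y

theorem exists_quadLift {q : QuadraticMap ℤ V (QMod p)} (hq : ∀ x, p • q x = 0) :
    ∃ Q : QuadraticForm (ZMod p) V, QuadLift q Q := by
  choose Q hQ using fun x => exists_zmodToQMod_eq (hq x)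
  obtain ⟨B, hB⟩ := exists_bilinLift q.polarBilin
  refine ⟨⟨Q, ?_, B, ?_⟩, fun x => (hQ x).symm⟩
  · intro a x
    obtain ⟨k, rfl⟩ := ZMod.intCast_surjective a
    apply zmodToQMod_injective p
    rw [hQ, Int.cast_smul_eq_zsmul, QuadraticMap.map_smul, ← hQ, ← Int.cast_mul,
      Int.cast_smul_eq_zsmul, map_smul]
  · intro x y
    apply zmodToQMod_injective p
    rw [hQ, map_add (zmodToQMod p), map_add (zmodToQMod p), hQ, hQ, ← hB, QuadraticMap.polarBilin_apply_apply,
      ← QuadraticMap.map_add (⇑q)]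

/-- `p²` kills `q x` by homogeneity and `2p` kills it through `b(x, x) = 2 q x`; for odd `p` their
greatest common divisor is `p`. -/
theorem smul_eq_zero_of_odd (hp : p ≠ 2) (q : QuadraticMap ℤ V (QMod p)) (x : V) :
    p • q x = 0 := by
  obtain ⟨k, hk⟩ := (Fact.out : p.Prime).odd_of_ne_two hp
  have h1 : (p * p : ℤ) • q x = 0 := by
    rw [← QuadraticMap.map_smul, natCast_zsmul, ZModModule.char_nsmul_eq_zero,
      QuadraticMap.map_zero]
  have h2 : (2 * p : ℤ) • q x = 0 := by
    rw [mul_comm, mul_smul, ofNat_zsmul, ← QuadraticMap.polar_self, ← QuadraticMap.polar_smul_left,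
      natCast_zsmul, ZModModule.char_nsmul_eq_zero, QuadraticMap.polar_zero_left]
  have h3 : (p : ℤ) = p * p - k * (2 * p) := by
    have : (p : ℤ) = 2 * k + 1 := by exact_mod_cast hk
    linear_combination (p : ℤ) * (-1) * this
  rw [← natCast_zsmul, h3, sub_smul, mul_smul (k : ℤ), h1, h2, smul_zero, sub_zero]

theorem smul_eq_zero_of_isEven {V : Type*} [AddCommGroup V] {q : QuadraticMap ℤ V (QMod 2)}
    (hq : IsEven q) (x : V) : 2 • q x = 0 :=
  (QuadraticMap.polar_self q x).symm.trans (hq x)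

variable {q : QuadraticMap ℤ V (QMod p)} {Q : QuadraticForm (ZMod p) V}
  {q' : QuadraticMap ℤ W (QMod p)} {Q' : QuadraticForm (ZMod p) W}

theorem QuadLift.polar (h : QuadLift q Q) : BilinLift (assocBilin q) (assocBilin Q) := by
  intro x y
  simp [QuadraticMap.polar, h x, h y, h (x + y)]

theorem QuadLift.prod (h : QuadLift q Q) (h' : QuadLift q' Q') :
    QuadLift (q.prod q') (Q.prod Q') := by
  intro x
  simp [h x.1, h' x.2]

theorem QuadLift.quadPow (h : QuadLift q Q) (m : ℕ) : QuadLift (quadPow q m) (quadPow Q m) := by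
  intro x
  simp [h _]

theorem QuadLift.card_quadO (h : QuadLift q Q) : Nat.card (quadO q) = Nat.card (quadO Q) := by
  refine Nat.card_congr (Equiv.subtypeEquiv (zmodLinearEquivEquiv p V V) fun g => ?_)
  refine forall_congr' fun x => ?_
  rw [h, h, (zmodToQMod_injective p).eq_iff]
  rfl

theorem BilinLift.card_bilinO {b : LinearMap.BilinMap ℤ V (QMod p)}
    {B : LinearMap.BilinMap (ZMod p) V (ZMod p)} (h : BilinLift b B) :
    Nat.card (bilinO b) = Nat.card (bilinO B) := by
  refine Nat.card_congr (Equiv.subtypeEquiv (zmodLinearEquivEquiv p V V) fun g => ?_)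
  refine forall_congr' fun x => forall_congr' fun y => ?_
  rw [h, h, (zmodToQMod_injective p).eq_iff]
  rfl

theorem QuadLift.preimage_zero (h : QuadLift q Q) : q ⁻¹' {0} = Q ⁻¹' {0} := by
  ext x
  rw [Set.mem_preimage, Set.mem_preimage, Set.mem_singleton_iff, Set.mem_singleton_iff, h,
    (injective_iff_map_eq_zero' _).1 (zmodToQMod_injective p)]

theorem BilinLift.nondegenerate_iff {b : LinearMap.BilinMap ℤ V (QMod p)}
    {B : LinearMap.BilinMap (ZMod p) V (ZMod p)} (h : BilinLift b B) :
    BilinNondegenerate b ↔ BilinNondegenerate B := by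
  refine forall_congr' fun x => imp_congr_right fun _ => exists_congr fun y => ?_
  rw [h, Ne, (injective_iff_map_eq_zero' _).1 (zmodToQMod_injective p)]

theorem QuadLift.nondegenerate_iff (h : QuadLift q Q) :
    QuadNondegenerate q ↔ QuadNondegenerate Q :=
  h.polar.nondegenerate_iff

theorem QuadLift.equivalent_iff (h : QuadLift q Q) (h' : QuadLift q' Q') :
    q.Equivalent q' ↔ Q.Equivalent Q' := by
  constructor
  · rintro ⟨f⟩
    refine ⟨{ zmodLinearEquiv f.toLinearEquiv with map_app' := fun x => ?_ }⟩
    apply zmodToQMod_injective p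
    rw [← h, ← h']
    exact f.map_app x
  · rintro ⟨f⟩
    refine ⟨{ f.toLinearEquiv.toAddEquiv.toIntLinearEquiv with map_app' := fun x => ?_ }⟩
    rw [h, h']
    exact congrArg _ (f.map_app x)

theorem quadLift_formH (p : ℕ) [Fact p.Prime] : QuadLift (formH p) (hypPlane (ZMod p)) :=
  fun _ => rfl

theorem quadLift_formV : QuadLift formV anisotropicPlane := fun _ => rfl

end Lift

/-! ### The rank one forms `w^ε` -/

section OddLines

/-- The forms `w^ε`, characterised by their polar form. -/
def IsOddLine (w : QuadraticMap ℤ (ZMod 2) (QMod 2)) : Prop :=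
  ∀ a b, QuadraticMap.polar w a b = zmodToQMod 2 (a * b)

theorem zmodToQMod_add_self (a : ZMod 2) : zmodToQMod 2 a + zmodToQMod 2 a = 0 := by
  rw [← map_add, CharTwo.add_self_eq_zero, map_zero]

theorem isOddLine_formW {ε : ℤ} (hε : ε = 1 ∨ ε = 3) : IsOddLine (formW ε) := by
  have h1 : formW ε 1 + formW ε 1 = zmodToQMod 2 1 := by
    have h : zmodToQMod 2 1 = ((ε : ℚ) : QMod 2) := by
      rw [← zmodToQMod_intCast]
      rcases hε with rfl | rfl <;> rfl
    rw [formW_one, h, ← QuotientAddGroup.mk_add, add_halves]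
  intro a b
  have hab : ∀ a : ZMod 2, a = 0 ∨ a = 1 := by decide
  rcases hab a with rfl | rfl
  · simp
  rcases hab b with rfl | rfl
  · simp
  rw [QuadraticMap.polar, CharTwo.add_self_eq_zero, map_zero, sub_sub, h1, zero_sub, mul_one,
    neg_eq_iff_add_eq_zero, zmodToQMod_add_self]

theorem formW_one_add_formW_three : formW 1 1 + formW 3 1 = 0 := by
  rw [formW_one, formW_one, ← QuotientAddGroup.mk_add, QuotientAddGroup.eq_zero_iff,
    AddSubgroup.mem_zmultiples_iff]
  exact ⟨1, by norm_num⟩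

variable {w w' : QuadraticMap ℤ (ZMod 2) (QMod 2)}

theorem IsOddLine.map_add (hw : IsOddLine w) (a b : ZMod 2) :
    w (a + b) = w a + w b + zmodToQMod 2 (a * b) := by
  rw [QuadraticMap.map_add (⇑w), hw]

theorem IsOddLine.add_self (hw : IsOddLine w) (a : ZMod 2) : w a + w a = zmodToQMod 2 a := by
  have h := hw.map_add a a
  rw [CharTwo.add_self_eq_zero, QuadraticMap.map_zero, zmod_two_mul_self] at h
  rw [eq_neg_of_add_eq_zero_left h.symm, neg_eq_iff_add_eq_zero, zmodToQMod_add_self]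

theorem IsOddLine.bilinLift (hw : IsOddLine w) :
    BilinLift (assocBilin w) (LinearMap.mul (ZMod 2) (ZMod 2)) := hw

theorem IsOddLine.nondegenerate (hw : IsOddLine w) : QuadNondegenerate w := by
  refine hw.bilinLift.nondegenerate_iff.2 fun x hx => ⟨1, by simpa using hx⟩

/-- Doubling kills integral values but sends `w 1` to `1 ≠ 0`. This excludes the mixed cases in the
counts of vectors with a given value. -/
theorem IsOddLine.ne (hw : IsOddLine w) (a : ZMod 2) : zmodToQMod 2 a ≠ w 1 := by
  intro h
  have h1 := hw.add_self 1
  rw [← h, zmodToQMod_add_self] at h1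
  have := zmodToQMod_injective 2 ((map_zero _).trans h1)
  exact zero_ne_one this

theorem formW_three_one : formW 3 1 = formW 1 1 + zmodToQMod 2 1 := by
  rw [← (isOddLine_formW (Or.inl rfl)).add_self 1, eq_neg_of_add_eq_zero_right
    formW_one_add_formW_three, neg_eq_iff_add_eq_zero]
  have h : zmodToQMod 2 1 + zmodToQMod 2 1 = 0 := zmodToQMod_add_self 1
  rw [← (isOddLine_formW (Or.inl rfl)).add_self 1] at h
  rw [← h]
  abel

/-- Elements `x` of `ℚ/2ℤ` with `2x = 1` are values of `w¹` or `w³`. -/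
theorem exists_formW_one_eq {x : QMod 2} (hx : 2 • x = zmodToQMod 2 1) :
    ∃ ε : ℤ, (ε = 1 ∨ ε = 3) ∧ formW ε 1 = x := by
  obtain ⟨a, ha⟩ := exists_zmodToQMod_eq (p := 2) (x := x - formW 1 1) (by
    rw [smul_sub, hx, two_nsmul, (isOddLine_formW (Or.inl rfl)).add_self, sub_self])
  have hab : ∀ a : ZMod 2, a = 0 ∨ a = 1 := by decide
  rcases hab a with rfl | rfl
  · exact ⟨1, Or.inl rfl, (sub_eq_zero.1 (ha.symm.trans (map_zero _))).symm⟩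
  · refine ⟨3, Or.inr rfl, ?_⟩
    rw [formW_three_one, ha]
    abel

end OddLines

/-! ### Characteristic vectors and orbit-stabiliser for bilinear forms -/

section OddOrders

variable {R M M₁ M₂ N : Type*} [CommRing R] [AddCommGroup M] [Module R M]
  [AddCommGroup M₁] [Module R M₁] [AddCommGroup M₂] [Module R M₂]
  [AddCommGroup N] [Module R N]

/-- A characteristic vector is fixed by all isometries. -/
theorem isometry_fixes_characteristic {b : LinearMap.BilinMap R M N} (hb : BilinNondegenerate b)
    {c : M} (hc : ∀ z, b z z = b c z) {g : M ≃ₗ[R] M} (hg : g ∈ bilinO b) : g c = c := by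
  by_contra hne
  obtain ⟨y, hy⟩ := hb _ (sub_ne_zero.2 hne)
  obtain ⟨z, rfl⟩ := g.surjective y
  rw [map_sub, LinearMap.sub_apply, hg, ← hc, ← hc, hg, sub_self] at hy
  exact hy rfl

/-- The version of `card_eq_card_orbit_mul` for bilinear forms. -/
theorem card_bilinO_sum {b₁ : LinearMap.BilinMap R M₁ N} {b₂ : LinearMap.BilinMap R M₂ N}
    (h₁ : BilinNondegenerate b₁) {T : Type*} (F : ((M₁ × M₂) ≃ₗ[R] (M₁ × M₂)) → T)
    (hF : ∀ g g' : (M₁ × M₂) ≃ₗ[R] (M₁ × M₂), g ∈ bilinO (bilinSum b₁ b₂) →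
      g' ∈ bilinO (bilinSum b₁ b₂) → F g = F g' → ∀ x, g (x, 0) = g' (x, 0))
    (hF' : ∀ g g' : (M₁ × M₂) ≃ₗ[R] (M₁ × M₂), (∀ x, g (x, 0) = g' (x, 0)) → F g = F g')
    (S : Set T) (hS₁ : ∀ g ∈ bilinO (bilinSum b₁ b₂), F g ∈ S)
    (hS₂ : ∀ s ∈ S, ∃ g ∈ bilinO (bilinSum b₁ b₂), F g = s) :
    Nat.card (bilinO (bilinSum b₁ b₂)) = Nat.card S * Nat.card (bilinO b₂) := by
  refine card_eq_card_orbit_mul h₁ le_rfl (fun h => ?_) F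
    (fun g hg g' hg' => ⟨hF g g' hg hg', hF' g g'⟩) S ?_
  · rw [mem_bilinO, mem_bilinO]
    constructor
    · intro hh x y
      simp [bilinSum_apply, hh]
    · intro hh x y
      simpa [bilinSum_apply] using hh (0, x) (0, y)
  · ext s
    exact ⟨fun ⟨g, hg, hs⟩ => hs ▸ hS₁ g hg, fun hs => hS₂ s hs⟩

end OddOrders

/-! ### An even form plus one odd line -/

section OneLine

variable {V : Type*} [AddCommGroup V]
  {w : QuadraticMap ℤ (ZMod 2) (QMod 2)} {q : QuadraticMap ℤ V (QMod 2)}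

theorem int_smul_line (x : ZMod 2) : ∃ k : ℤ, x = k • (1 : ZMod 2) := by
  obtain ⟨k, rfl⟩ := ZMod.intCast_surjective x
  exact ⟨k, by simp⟩

theorem line_ext {f g : (ZMod 2 × V) ≃ₗ[ℤ] (ZMod 2 × V)} (h : f (1, 0) = g (1, 0)) (x : ZMod 2) :
    f (x, 0) = g (x, 0) := by
  obtain ⟨k, rfl⟩ := int_smul_line x
  have hx : ((k • (1 : ZMod 2), 0) : ZMod 2 × V) = k • (1, 0) := by simp
  rw [hx, map_smul, map_smul, h]

theorem characteristic_line_prod (hw : IsOddLine w) {b : LinearMap.BilinMap ℤ V (QMod 2)}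
    (he : ∀ x, b x x = 0) (z : ZMod 2 × V) :
    bilinSum (assocBilin w) b z z = bilinSum (assocBilin w) b (1, 0) z := by
  simp [bilinSum_apply, hw _ _, he, zmod_two_mul_self]

theorem card_bilinO_line_prod (hw : IsOddLine w) {b : LinearMap.BilinMap ℤ V (QMod 2)}
    (hb : BilinNondegenerate b) (he : ∀ x, b x x = 0) :
    Nat.card (bilinO (bilinSum (assocBilin w) b)) = Nat.card (bilinO b) := by
  have hP : BilinNondegenerate (bilinSum (assocBilin w) b) := hw.nondegenerate.sum hb
  rw [card_bilinO_sum hw.nondegenerate (fun g => g (1, 0))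
    (fun g g' _ _ h x => line_ext h x)
    (fun g g' h => h 1) {(1, 0)}
    (fun g hg => isometry_fixes_characteristic hP (characteristic_line_prod hw he) hg)
    (fun s hs => ⟨1, (bilinO _).one_mem, (Set.mem_singleton_iff.1 hs).symm⟩)]
  simp

/-- The generator of the line is the characteristic vector, so its orbit is a single point. -/
theorem card_quadO_line_prod (hw : IsOddLine w) (hq : QuadNondegenerate q) (he : IsEven q) :
    Nat.card (quadO (w.prod q)) = Nat.card (quadO q) := by
  have hP : BilinNondegenerate (bilinSum (assocBilin w) (assocBilin q)) :=
    hw.nondegenerate.sum hq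
  rw [card_quadO_prod hw.nondegenerate (fun g => g (1, 0))
    (fun g g' _ _ h x => line_ext h x)
    (fun g g' h => h 1) {(1, 0)}
    (fun g hg => isometry_fixes_characteristic hP (characteristic_line_prod hw he)
      (assocBilin_prod w q ▸ quadO_le_bilinO _ hg))
    (fun s hs => ⟨1, (quadO _).one_mem, (Set.mem_singleton_iff.1 hs).symm⟩)]
  simp

theorem card_zeros_line_prod [Module (ZMod 2) V] (hw : IsOddLine w) {Q : QuadraticForm (ZMod 2) V}
    (hQ : QuadLift q Q) : Nat.card ((w.prod q) ⁻¹' {0}) = Nat.card (q ⁻¹' {0}) := by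
  symm
  refine Nat.card_congr (Equiv.ofBijective
    (fun y => ⟨(0, y.1), (by have h : q y.1 = 0 := y.2; simp [h])⟩) ⟨?_, ?_⟩)
  · intro y y' h
    simpa [Subtype.ext_iff] using h
  · rintro ⟨⟨a, y⟩, h⟩
    have hab : ∀ a : ZMod 2, a = 0 ∨ a = 1 := by decide
    simp only [Set.mem_preimage, QuadraticMap.prod_apply, Set.mem_singleton_iff] at h
    rcases hab a with rfl | rfl
    · exact ⟨⟨y, by simpa using h⟩, rfl⟩
    · exfalso
      rw [hQ] at h
      apply hw.ne (Q y)
      rw [eq_neg_of_add_eq_zero_left h, eq_neg_iff_add_eq_zero, zmodToQMod_add_self]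

end OneLine

/-! ### An even form plus two odd lines -/

section TwoLines

variable {V : Type*} [AddCommGroup V]

theorem zmod_two_eq_zero_or_one (a : ZMod 2) : a = 0 ∨ a = 1 := by
  revert a; decide

theorem exists_intLinearMap {X Y : Type*} [AddCommGroup X] [AddCommGroup Y] (f : X → Y)
    (h : ∀ x y, f (x + y) = f x + f y) : ∃ g : X →ₗ[ℤ] Y, ∀ x, g x = f x :=
  ⟨(AddMonoidHom.mk' f h).toIntLinearMap, fun _ => rfl⟩

/-- This basis contains the characteristic vector `(1, 1)`, which isometries fix when `V` carries an
even form. Only the image of `(1, 0)` then has to be tracked. -/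
theorem pair_ext {f g : ((ZMod 2 × ZMod 2) × V) ≃ₗ[ℤ] ((ZMod 2 × ZMod 2) × V)}
    (h : f ((1, 0), 0) = g ((1, 0), 0)) (hc :
      f ((1, 1), 0) = g ((1, 1), 0)) (x : ZMod 2 × ZMod 2) :
    f (x, 0) = g (x, 0) := by
  obtain ⟨a, b⟩ := x
  obtain ⟨k, rfl⟩ := int_smul_line a
  obtain ⟨l, rfl⟩ := int_smul_line b
  have hx : (((k • (1 : ZMod 2), l • (1 : ZMod 2)), 0) : (ZMod 2 × ZMod 2) × V) =
      (k - l) • ((1, 0), 0) + l • ((1, 1), 0) := by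
    simp [sub_smul]
  rw [hx, map_add, map_add, map_smul, map_smul, map_smul, map_smul, h, hc]

variable {w₁ w₂ : QuadraticMap ℤ (ZMod 2) (QMod 2)}

theorem characteristic_pair_prod (hw₁ : IsOddLine w₁) (hw₂ : IsOddLine w₂)
    {b : LinearMap.BilinMap ℤ V (QMod 2)} (he : ∀ x, b x x = 0)
    (z : (ZMod 2 × ZMod 2) × V) :
    bilinSum (assocBilin (w₁.prod w₂)) b z z =
      bilinSum (assocBilin (w₁.prod w₂)) b ((1, 1), 0) z := by
  simp [bilinSum_apply, hw₁ _ _, hw₂ _ _, he, zmod_two_mul_self]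

variable {q : QuadraticMap ℤ V (QMod 2)}

theorem quadO_pair_fixes (hw₁ : IsOddLine w₁) (hw₂ : IsOddLine w₂) (hq : QuadNondegenerate q)
    (he : IsEven q) {g : ((ZMod 2 × ZMod 2) × V) ≃ₗ[ℤ] ((ZMod 2 × ZMod 2) × V)}
    (hg : g ∈ quadO ((w₁.prod w₂).prod q)) : g ((1, 1), 0) = ((1, 1), 0) :=
  isometry_fixes_characteristic ((hw₁.nondegenerate.prod hw₂.nondegenerate).sum hq)
    (characteristic_pair_prod hw₁ hw₂ he) (assocBilin_prod (w₁.prod w₂) q ▸ quadO_le_bilinO _ hg)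

theorem card_quadO_pair_prod (hw₁ : IsOddLine w₁) (hw₂ : IsOddLine w₂) (hq : QuadNondegenerate q)
    (he : IsEven q) (S : Set ((ZMod 2 × ZMod 2) × V))
    (hS₁ : ∀ x, (w₁.prod w₂).prod q x = w₁ 1 → x ∈ S)
    (hS₂ : ∀ s ∈ S, ∃ f : ((ZMod 2 × ZMod 2) × V) →ₗ[ℤ] ((ZMod 2 × ZMod 2) × V),
      (∀ x, (w₁.prod w₂).prod q (f x) = (w₁.prod w₂).prod q x) ∧ f ((1, 0), 0) = s) [Finite V] :
    Nat.card (quadO ((w₁.prod w₂).prod q)) = Nat.card S * Nat.card (quadO q) := by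
  have hN := hw₁.nondegenerate.prod hw₂.nondegenerate
  refine card_quadO_prod hN (fun g => g ((1, 0), 0)) ?_ (fun g g' h => h (1, 0)) S ?_ ?_
  · intro g g' hg hg' h
    refine pair_ext h ?_
    rw [quadO_pair_fixes hw₁ hw₂ hq he hg, quadO_pair_fixes hw₁ hw₂ hq he hg']
  · intro g hg
    apply hS₁
    rw [hg]
    simp
  · intro s hs
    obtain ⟨f, hf, hfs⟩ := hS₂ s hs
    obtain ⟨g, hg, hgf⟩ := exists_mem_quadO_of_preserves (hN.prod hq) f hf
    exact ⟨g, hg, (hgf _).trans hfs⟩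

variable [Module (ZMod 2) V] {Q : QuadraticForm (ZMod 2) V}

theorem pair_prod_apply (hQ : QuadLift q Q) (a b : ZMod 2) (y : V) :
    (w₁.prod w₂).prod q ((a, b), y) = w₁ a + w₂ b + zmodToQMod 2 (Q y) := by
  simp [hQ y]

/-- Eichler-type transformation attached to the characteristic vector of a sum of two odd lines. -/
theorem exists_pairShift (Q : QuadraticForm (ZMod 2) V) (y₀ : V) (s : ZMod 2) :
    ∃ f : ((ZMod 2 × ZMod 2) × V) →ₗ[ℤ] ((ZMod 2 × ZMod 2) × V), ∀ a b y, f ((a, b), y) =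
      ((a + (QuadraticMap.polar Q y y₀ + s * (a + b)),
        b + (QuadraticMap.polar Q y y₀ + s * (a + b))), y + (a + b) • y₀) := by
  obtain ⟨f, hf⟩ := exists_intLinearMap (fun z : (ZMod 2 × ZMod 2) × V =>
      (((z.1.1 + (QuadraticMap.polar Q z.2 y₀ + s * (z.1.1 + z.1.2)),
        z.1.2 + (QuadraticMap.polar Q z.2 y₀ + s * (z.1.1 + z.1.2))),
        z.2 + (z.1.1 + z.1.2) • y₀) : (ZMod 2 × ZMod 2) × V)) (fun x y => by
      refine Prod.ext (Prod.ext ?_ ?_) ?_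
      · simp only [Prod.fst_add, Prod.snd_add, QuadraticMap.polar_add_left]
        ring
      · simp only [Prod.fst_add, Prod.snd_add, QuadraticMap.polar_add_left]
        ring
      · simp only [Prod.fst_add, Prod.snd_add]
        module)
  exact ⟨f, fun a b y => hf _⟩

/-- Transvection in the direction `y₀ + c` with `c` the characteristic vector of a sum of two odd
lines. -/
theorem exists_pairTransvection (Q : QuadraticForm (ZMod 2) V) (y₀ : V) :
    ∃ f : ((ZMod 2 × ZMod 2) × V) →ₗ[ℤ] ((ZMod 2 × ZMod 2) × V), ∀ a b y, f ((a, b), y) =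
      ((a + (QuadraticMap.polar Q y y₀ + (a + b)), b + (QuadraticMap.polar Q y y₀ + (a + b))),
        y + (QuadraticMap.polar Q y y₀ + (a + b)) • y₀) := by
  obtain ⟨f, hf⟩ := exists_intLinearMap (fun z : (ZMod 2 × ZMod 2) × V =>
      (((z.1.1 + (QuadraticMap.polar Q z.2 y₀ + (z.1.1 + z.1.2)),
        z.1.2 + (QuadraticMap.polar Q z.2 y₀ + (z.1.1 + z.1.2))),
        z.2 + (QuadraticMap.polar Q z.2 y₀ + (z.1.1 + z.1.2)) • y₀) :
          (ZMod 2 × ZMod 2) × V)) (fun x y => by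
      refine Prod.ext (Prod.ext ?_ ?_) ?_
      · simp only [Prod.fst_add, Prod.snd_add, QuadraticMap.polar_add_left]
        ring
      · simp only [Prod.fst_add, Prod.snd_add, QuadraticMap.polar_add_left]
        ring
      · simp only [Prod.fst_add, Prod.snd_add, QuadraticMap.polar_add_left]
        module)
  exact ⟨f, fun a b y => hf _⟩

/-- The vectors of value `w₁ 1` are `((a, a + 1), y)` with `Q y = 0`, and all lie in one orbit.
Hence the order is `2 · #Q⁻¹(0) · #O(q)`, which `card_bilinO_eq` identifies with `2 · #O(b_q)`. -/
theorem card_quadO_equal_pair_prod [Finite V] (hw : IsOddLine w₁) (hq : QuadNondegenerate q)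
    (he : IsEven q) (hQ : QuadLift q Q) :
    Nat.card (quadO ((w₁.prod w₁).prod q)) = 2 * Nat.card (bilinO (assocBilin q)) := by
  obtain ⟨S, hS⟩ : ∃ S : Set ((ZMod 2 × ZMod 2) × V), S = {x | x.1.2 = x.1.1 + 1 ∧ Q x.2 = 0} :=
    ⟨_, rfl⟩
  have hcard : Nat.card S = 2 * Nat.card (Q ⁻¹' {0}) := by
    have : Nat.card (ZMod 2 × (Q ⁻¹' {0})) = Nat.card S := by
      refine Nat.card_congr (Equiv.ofBijective
        (fun p => ⟨((p.1, p.1 + 1), p.2.1), by rw [hS]; exact ⟨rfl, p.2.2⟩⟩) ⟨?_, ?_⟩)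
      · rintro ⟨a, y, hy⟩ ⟨a', y', hy'⟩ h
        simp only [Subtype.mk.injEq, Prod.mk.injEq] at h
        obtain ⟨⟨rfl, -⟩, rfl⟩ := h
        rfl
      · rintro ⟨⟨⟨a, b⟩, y⟩, h⟩
        rw [hS] at h
        obtain ⟨h1, h2⟩ := h
        simp only at h1 h2
        subst h1
        exact ⟨(a, ⟨y, h2⟩), rfl⟩
    rw [← this, Nat.card_prod, Nat.card_zmod]
  -- The vector `c + y₀` has value `1`, so the transvection along it is a reflection and preserves
  -- the quadratic form.
  have hT : ∀ y₀, Q y₀ = 0 → ∃ f : ((ZMod 2 × ZMod 2) × V) →ₗ[ℤ] ((ZMod 2 × ZMod 2) × V),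
      (∀ x, (w₁.prod w₁).prod q (f x) = (w₁.prod w₁).prod q x) ∧
      (∀ a y, QuadraticMap.polar Q y y₀ = 0 → f ((a, a + 1), y) = ((a + 1, a), y + y₀)) := by
    intro y₀ hy₀
    obtain ⟨f, hf⟩ := exists_pairTransvection Q y₀
    refine ⟨f, ?_, ?_⟩
    · rintro ⟨⟨a, b⟩, y⟩
      rw [hf, pair_prod_apply hQ, pair_prod_apply hQ]
      obtain ⟨t, ht⟩ : ∃ t, t = QuadraticMap.polar Q y y₀ + (a + b) := ⟨_, rfl⟩
      rw [← ht, map_add_smul, hy₀, hw.map_add, hw.map_add]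
      have h1 : w₁ a + w₁ t + zmodToQMod 2 (a * t) + (w₁ b + w₁ t + zmodToQMod 2 (b * t)) +
          zmodToQMod 2 (Q y + t ^ 2 * 0 + t * QuadraticMap.polar Q y y₀) =
          w₁ a + w₁ b + zmodToQMod 2 (Q y) +
          zmodToQMod 2 (t + a * t + b * t + t * QuadraticMap.polar Q y y₀) := by
        have h2 : w₁ a + w₁ t + zmodToQMod 2 (a * t) + (w₁ b + w₁ t + zmodToQMod 2 (b * t)) =
          w₁ a + w₁ b + ((w₁ t + w₁ t) + zmodToQMod 2 (a * t) + zmodToQMod 2 (b * t)) := by abel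
        rw [h2, hw.add_self]
        simp only [map_add, mul_zero, add_zero]
        abel
      have h3 : t + a * t + b * t + t * QuadraticMap.polar Q y y₀ = 0 := by
        have : t + a * t + b * t + t * QuadraticMap.polar Q y y₀ = t + t * t := by
          nth_rw 6 [ht]
          ring
        rw [this, zmod_two_mul_self, CharTwo.add_self_eq_zero]
      rw [h1, h3, map_zero, add_zero]
    · intro a y hy
      rw [hf, hy]
      have h1 : (1 : ZMod 2) + 1 = 0 := by decide
      rcases zmod_two_eq_zero_or_one a with rfl | rfl <;> simp [h1]
  rw [card_quadO_pair_prod hw hw hq he S ?_ ?_, hQ.polar.card_bilinO,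
    card_bilinO_eq (hQ.nondegenerate_iff.1 hq), hQ.card_quadO, hcard, mul_assoc]
  · rintro ⟨⟨a, b⟩, y⟩ h
    rw [pair_prod_apply hQ] at h
    rw [hS]
    rcases zmod_two_eq_zero_or_one a with rfl | rfl <;>
    rcases zmod_two_eq_zero_or_one b with rfl | rfl
    · simp only [map_zero, zero_add] at h
      exact absurd h (hw.ne _)
    · simp only [map_zero, zero_add, add_eq_left] at h
      exact ⟨by simp, zmodToQMod_injective 2 (h.trans (map_zero _).symm)⟩
    · simp only [map_zero, add_zero, add_eq_left] at h
      exact ⟨(by decide : (0 : ZMod 2) = 1 + 1), zmodToQMod_injective 2 (h.trans (map_zero _).symm)⟩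
    · rw [hw.add_self, ← map_add] at h
      exact absurd h (hw.ne _)
  · rintro ⟨⟨a, b⟩, y⟩ h
    rw [hS] at h
    obtain ⟨hb, hy⟩ := h
    simp only at hb hy
    subst hb
    obtain ⟨f, hf, hfe⟩ := hT y hy
    -- With `y₀ = 0` the reflection exchanges the two lines, which reaches the targets with `a = 1`.
    obtain ⟨f', hf', hfe'⟩ := hT 0 (map_zero Q)
    have h1 : (1 : ZMod 2) + 1 = 0 := by decide
    have e1 : f ((1, 0), 0) = ((0, 1), y) := by
      have := hfe 1 0 (QuadraticMap.polar_zero_left Q y)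
      rw [h1, zero_add] at this
      exact this
    rcases zmod_two_eq_zero_or_one a with rfl | rfl
    · exact ⟨f, hf, by rw [e1]; simp⟩
    · refine ⟨f' ∘ₗ f, fun x => by rw [LinearMap.comp_apply, hf', hf], ?_⟩
      have := hfe' 0 y (QuadraticMap.polar_zero_right Q y)
      rw [zero_add, add_zero] at this
      rw [LinearMap.comp_apply, e1, this, h1]

/-- Integrality forces `a = b`, and then `w₁ a + w₁ a = a` must cancel `Q y`: exactly one zero lies
over each `y`. -/
theorem card_zeros_equal_pair_prod (hw : IsOddLine w₁) (hQ : QuadLift q Q) :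
    Nat.card (((w₁.prod w₁).prod q) ⁻¹' {0}) = Nat.card V := by
  symm
  refine Nat.card_congr (Equiv.ofBijective (fun y => ⟨((Q y, Q y), y), ?_⟩) ⟨?_, ?_⟩)
  · rw [Set.mem_preimage, pair_prod_apply hQ, hw.add_self, zmodToQMod_add_self]
    rfl
  · intro y y' h
    simp only [Subtype.mk.injEq, Prod.mk.injEq] at h
    exact h.2
  · rintro ⟨⟨⟨a, b⟩, y⟩, h⟩
    rw [Set.mem_preimage, pair_prod_apply hQ, Set.mem_singleton_iff] at h
    have h' := eq_neg_of_add_eq_zero_left h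
    rw [neg_eq_of_add_eq_zero_left (zmodToQMod_add_self (Q y))] at h'
    rcases zmod_two_eq_zero_or_one a with rfl | rfl <;>
    rcases zmod_two_eq_zero_or_one b with rfl | rfl
    · rw [map_zero, add_zero] at h'
      have h0 : Q y = 0 := zmodToQMod_injective 2 (h'.symm.trans (map_zero _).symm)
      exact ⟨y, Subtype.ext (by change ((Q y, Q y), y) = _; rw [h0])⟩
    · rw [map_zero, zero_add] at h'
      exact absurd h'.symm (hw.ne _)
    · rw [map_zero, add_zero] at h'
      exact absurd h'.symm (hw.ne _)
    · rw [hw.add_self] at h'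
      have h0 : 1 = Q y := zmodToQMod_injective 2 h'
      exact ⟨y, Subtype.ext (by change ((Q y, Q y), y) = _; rw [← h0])⟩

theorem neg_pair_apply (h : w₁ 1 + w₂ 1 = 0) (t : ZMod 2) : w₁ t + w₂ t = 0 := by
  rcases zmod_two_eq_zero_or_one t with rfl | rfl
  · simp
  · exact h

/-- Since `w₂ 1 = w₁ 1 + 1`, each `y` extends to exactly one vector of value `w₁ 1`. The
characteristic vector is now isotropic, and its Eichler transformations act transitively on these
vectors. -/
theorem card_quadO_neg_pair_prod [Finite V] (hw₁ : IsOddLine w₁) (hw₂ : IsOddLine w₂)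
    (hw : w₁ 1 + w₂ 1 = 0) (hq : QuadNondegenerate q) (he : IsEven q) (hQ : QuadLift q Q) :
    Nat.card (quadO ((w₁.prod w₂).prod q)) = Nat.card V * Nat.card (quadO q) := by
  have h2 : w₂ 1 = w₁ 1 + zmodToQMod 2 1 := by
    rw [← hw₁.add_self, eq_neg_of_add_eq_zero_right hw, neg_eq_iff_add_eq_zero]
    have h3 := zmodToQMod_add_self 1
    rw [← hw₁.add_self] at h3
    rw [← h3]
    abel
  obtain ⟨S, hS⟩ : ∃ S : Set ((ZMod 2 × ZMod 2) × V),
    S = Set.range fun y => ((1 + Q y, Q y), y) := ⟨_, rfl⟩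
  have hcard : Nat.card S = Nat.card V := by
    rw [hS]
    refine (Nat.card_congr (Equiv.ofInjective _ ?_)).symm
    intro y y' h
    exact congrArg Prod.snd h
  rw [card_quadO_pair_prod hw₁ hw₂ hq he S ?_ ?_, hcard]
  · rintro ⟨⟨a, b⟩, y⟩ h
    rw [pair_prod_apply hQ] at h
    rw [hS]
    rcases zmod_two_eq_zero_or_one a with rfl | rfl <;>
    rcases zmod_two_eq_zero_or_one b with rfl | rfl
    · simp only [map_zero, zero_add] at h
      exact absurd h (hw₁.ne _)
    · rw [map_zero, zero_add, h2, add_assoc, add_eq_left, ← map_add] at h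
      have h0 : 1 + Q y = 0 := zmodToQMod_injective 2 (h.trans (map_zero _).symm)
      have h1 : Q y = 1 := by
        generalize Q y = t at h0
        revert t
        decide
      exact ⟨y, by change ((1 + Q y, Q y), y) = _; rw [h1]; rfl⟩
    · simp only [map_zero, add_zero, add_eq_left] at h
      have h0 : Q y = 0 := zmodToQMod_injective 2 (h.trans (map_zero _).symm)
      exact ⟨y, by change ((1 + Q y, Q y), y) = _; rw [h0]; rfl⟩
    · rw [hw, zero_add] at h
      exact absurd h (hw₁.ne _)
  · rintro s hs
    rw [hS] at hs
    obtain ⟨y₀, rfl⟩ := hs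
    -- The parameter `s = Q y₀` compensates the value of the added multiple of `y₀`.
    obtain ⟨f, hf⟩ := exists_pairShift Q y₀ (Q y₀)
    refine ⟨f, ?_, ?_⟩
    · rintro ⟨⟨a, b⟩, y⟩
      rw [hf, pair_prod_apply hQ, pair_prod_apply hQ]
      obtain ⟨t, ht⟩ : ∃ t, t = QuadraticMap.polar Q y y₀ + Q y₀ * (a + b) := ⟨_, rfl⟩
      rw [← ht, map_add_smul, hw₁.map_add, hw₂.map_add]
      have h1 : w₁ a + w₁ t + zmodToQMod 2 (a * t) + (w₂ b + w₂ t + zmodToQMod 2 (b * t)) +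
          zmodToQMod 2 (Q y + (a + b) ^ 2 * Q y₀ + (a + b) * QuadraticMap.polar Q y y₀) =
          w₁ a + w₂ b + zmodToQMod 2 (Q y) + zmodToQMod 2 (a * t + b * t +
            (a + b) ^ 2 * Q y₀ + (a + b) * QuadraticMap.polar Q y y₀) := by
        have h3 : w₁ a + w₁ t + zmodToQMod 2 (a * t) + (w₂ b + w₂ t + zmodToQMod 2 (b * t)) =
          w₁ a + w₂ b + ((w₁ t + w₂ t) + zmodToQMod 2 (a * t) + zmodToQMod 2 (b * t)) := by abel
        rw [h3, neg_pair_apply hw]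
        simp only [map_add]
        abel
      have h4 : a * t + b * t + (a + b) ^ 2 * Q y₀ + (a + b) * QuadraticMap.polar Q y y₀ = 0 := by
        rw [ht]
        linear_combination ((a + b) ^ 2 * Q y₀ + (a + b) * QuadraticMap.polar Q y y₀) *
          CharTwo.two_eq_zero (R := ZMod 2)
      rw [h1, h4, map_zero, add_zero]
    · rw [hf, QuadraticMap.polar_zero_left]
      simp

/-- Integrality forces `a = b`, and the two lines then cancel, leaving `a` free. -/
theorem card_zeros_neg_pair_prod (hw₁ : IsOddLine w₁) (hw₂ : IsOddLine w₂)
    (hw : w₁ 1 + w₂ 1 = 0) (hQ : QuadLift q Q) :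
    Nat.card (((w₁.prod w₂).prod q) ⁻¹' {0}) = 2 * Nat.card (q ⁻¹' {0}) := by
  have h : Nat.card (ZMod 2 × (q ⁻¹' {0})) = Nat.card (((w₁.prod w₂).prod q) ⁻¹' {0}) := by
    refine Nat.card_congr (Equiv.ofBijective (fun p => ⟨((p.1, p.1), p.2.1), ?_⟩) ⟨?_, ?_⟩)
    · have h : q p.2.1 = 0 := p.2.2
      change w₁ p.1 + w₂ p.1 + q p.2.1 = 0
      rw [h, neg_pair_apply hw, add_zero]
    · rintro ⟨a, y, hy⟩ ⟨a', y', hy'⟩ h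
      simp only [Subtype.mk.injEq, Prod.mk.injEq] at h
      obtain ⟨⟨rfl, -⟩, rfl⟩ := h
      rfl
    · rintro ⟨⟨⟨a, b⟩, y⟩, h⟩
      change w₁ a + w₂ b + q y = 0 at h
      have h' := eq_neg_of_add_eq_zero_left h
      rw [hQ, neg_eq_of_add_eq_zero_left (zmodToQMod_add_self (Q y)), ← hQ] at h'
      rcases zmod_two_eq_zero_or_one a with rfl | rfl <;>
      rcases zmod_two_eq_zero_or_one b with rfl | rfl
      · exact ⟨(0, ⟨y, by rw [map_zero, map_zero, add_zero, zero_add] at h; exact h⟩), rfl⟩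
      · rw [map_zero, zero_add, hQ] at h'
        exact absurd h'.symm (hw₂.ne _)
      · rw [map_zero, add_zero, hQ] at h'
        exact absurd h'.symm (hw₁.ne _)
      · exact ⟨(1, ⟨y, by rw [hw, zero_add] at h; exact h⟩), rfl⟩
  rw [← h, Nat.card_prod, Nat.card_zmod]

/-- The orbit of `(1, 0)` is the set of all vectors with `b(x, x) = 1`, that is, those whose line
coordinates differ. -/
theorem card_bilinO_pair_prod [Finite V] (hw₁ : IsOddLine w₁) (hw₂ : IsOddLine w₂)
    (hq : QuadNondegenerate q) (he : IsEven q) (hQ : QuadLift q Q) :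
    Nat.card (bilinO (bilinSum (assocBilin (w₁.prod w₂)) (assocBilin q))) =
      2 * Nat.card V * Nat.card (bilinO (assocBilin q)) := by
  have hN := hw₁.nondegenerate.prod hw₂.nondegenerate
  have hP : BilinNondegenerate (bilinSum (assocBilin (w₁.prod w₂)) (assocBilin q)) := hN.sum hq
  have hval : ∀ a b y a' b' y', bilinSum (assocBilin (w₁.prod w₂)) (assocBilin q) ((a, b), y)
      ((a', b'), y') = zmodToQMod 2 (a * a' + b * b' + QuadraticMap.polar Q y y') := by
    intro a b y a' b' y'
    have h := hQ.polar y y'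
    rw [QuadraticMap.polarBilin_apply_apply, QuadraticMap.polarBilin_apply_apply] at h
    simp [bilinSum_apply, hw₁ _ _, hw₂ _ _, h]
  obtain ⟨S, hS⟩ : ∃ S : Set ((ZMod 2 × ZMod 2) × V), S = {x | x.1.2 = x.1.1 + 1} := ⟨_, rfl⟩
  have hcard : Nat.card S = 2 * Nat.card V := by
    have : Nat.card (ZMod 2 × V) = Nat.card S := by
      refine Nat.card_congr (Equiv.ofBijective
        (fun p => ⟨((p.1, p.1 + 1), p.2), by rw [hS]; rfl⟩) ⟨?_, ?_⟩)
      · rintro ⟨a, y⟩ ⟨a', y'⟩ h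
        simp only [Subtype.mk.injEq, Prod.mk.injEq] at h
        obtain ⟨⟨rfl, -⟩, rfl⟩ := h
        rfl
      · rintro ⟨⟨⟨a, b⟩, y⟩, h⟩
        rw [hS] at h
        obtain rfl : b = a + 1 := h
        exact ⟨(a, y), rfl⟩
    rw [← this, Nat.card_prod, Nat.card_zmod]
  rw [card_bilinO_sum hN (fun g => g ((1, 0), 0)) ?_ (fun g g' h => h (1, 0)) S ?_ ?_, hcard]
  · intro g g' hg hg' h
    refine pair_ext h ?_
    rw [isometry_fixes_characteristic hP (characteristic_pair_prod hw₁ hw₂ he) hg,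
      isometry_fixes_characteristic hP (characteristic_pair_prod hw₁ hw₂ he) hg']
  · intro g hg
    have h := hg ((1, 0), 0) ((1, 0), 0)
    rw [hS]
    change (g ((1, 0), 0)).1.2 = (g ((1, 0), 0)).1.1 + 1
    generalize g ((1, 0), 0) = x at h
    obtain ⟨⟨a, b⟩, y⟩ := x
    rw [hval, hval, polar_self_eq_zero, polar_self_eq_zero] at h
    have h' := zmodToQMod_injective 2 h
    simp only
    clear h
    revert a b
    decide
  · rintro ⟨⟨a, b⟩, y₀⟩ hs
    rw [hS] at hs
    obtain rfl : b = a + 1 := hs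
    -- The bilinear form is preserved for every parameter; this one sends `(1, 0)` to `(1 + s, s) =
    -- (a, a + 1)`.
    obtain ⟨f, hf⟩ := exists_pairShift Q y₀ (a + 1)
    obtain ⟨g, hg, hgf⟩ := exists_mem_bilinO_of_preserves hP f (by
      rintro ⟨⟨a', b'⟩, y⟩ ⟨⟨a'', b''⟩, y'⟩
      rw [hf, hf, hval, hval]
      congr 1
      rw [QuadraticMap.polar_add_left, QuadraticMap.polar_add_right, QuadraticMap.polar_add_right,
        QuadraticMap.polar_smul_left, QuadraticMap.polar_smul_left,
        QuadraticMap.polar_smul_right, QuadraticMap.polar_smul_right, polar_self_eq_zero,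
        QuadraticMap.polar_comm Q y₀ y']
      generalize QuadraticMap.polar Q y y₀ = u
      generalize QuadraticMap.polar Q y' y₀ = v
      simp only [smul_eq_mul]
      linear_combination ((u + (a + 1) * (a' + b')) * (v + (a + 1) * (a'' + b'')) +
        (a' + b') * v + (a'' + b'') * u + (a + 1) * (a' + b') * (a'' + b'')) *
        CharTwo.two_eq_zero (R := ZMod 2))
    refine ⟨g, hg, ?_⟩
    rw [hgf, hf, QuadraticMap.polar_zero_left]
    have h1 : (1 : ZMod 2) + 1 = 0 := by decide
    rcases zmod_two_eq_zero_or_one a with rfl | rfl <;> simp [h1]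

end TwoLines

/-! ### Normal forms for the prime two -/

section Decomposition

variable {V : Type*} [AddCommGroup V]

theorem exists_diagonal_vectors [Module (ZMod 2) V] [Finite V]
    {B : LinearMap.BilinMap (ZMod 2) V (ZMod 2)} (hs : IsSymmetric B) (hB : BilinNondegenerate B) :
    (∀ x, B x x = 0) ∨ (∃ c, B c c = 1 ∧ ∀ x, B x c = 0 → B x x = 0) ∨
      ∃ e f, B e e = 1 ∧ B f f = 1 ∧ B e f = 0 ∧
        ∀ x, B x e = 0 → B x f = 0 → B x x = 0 := by
  -- The characteristic vector exists because `x ↦ B(x, x)` is linear over `ℤ/2ℤ`: cross terms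
  -- double and `a² = a`.
  obtain ⟨c, hc⟩ : ∃ c, ∀ x, B x x = B x c := by
    have hinj : Function.Injective B := by
      rw [injective_iff_map_eq_zero]
      intro x hx
      by_contra hne
      obtain ⟨y, hy⟩ := hB x hne
      exact hy (by rw [hx]; rfl)
    obtain ⟨w, hw⟩ := (LinearMap.injective_iff_surjective_of_finrank_eq_finrank
      (Subspace.dual_finrank_eq (K := ZMod 2) (V := V)).symm).1 hinj
      { toFun := fun x => B x x
        map_add' := fun x y => by
          rw [map_add, map_add, LinearMap.add_apply, LinearMap.add_apply, hs y x]
          linear_combination B x y * CharTwo.two_eq_zero (R := ZMod 2)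
        map_smul' := fun a x => by
          rw [map_smul, map_smul, LinearMap.smul_apply, smul_smul, zmod_two_mul_self,
            RingHom.id_apply] }
    exact ⟨w, fun x => by rw [hs x w, hw]; rfl⟩
  by_cases hc0 : c = 0
  · exact Or.inl fun x => by rw [hc, hc0, map_zero]
  rcases zmod_two_eq_zero_or_one (B c c) with hcc | hcc
  · obtain ⟨e, he⟩ := hB c hc0
    have hec : B e c = 1 := by rw [hs]; exact zmod_two_eq_one_of_ne_zero he
    -- If `B(c, c) = 0`, then `e` and `e + c` form an orthonormal pair whose span contains `c`, so
    -- its complement is alternating.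
    refine Or.inr (Or.inr ⟨e, e + c, ?_, ?_, ?_, ?_⟩)
    · rw [hc, hec]
    · rw [hc, map_add, LinearMap.add_apply, hec, hcc, add_zero]
    · rw [map_add, hc, hec, CharTwo.add_self_eq_zero]
    · intro x hxe hxf
      rw [map_add, hxe, zero_add] at hxf
      rw [hc, hxf]
  · exact Or.inr (Or.inl ⟨c, hcc, fun x hx => by rw [hc, hx]⟩)

theorem BilinLift.isSymmetric [Module (ZMod 2) V] {b : LinearMap.BilinMap ℤ V (QMod 2)}
    {B : LinearMap.BilinMap (ZMod 2) V (ZMod 2)} (h : BilinLift b B) (hb : IsSymmetric b) :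
    IsSymmetric B := by
  intro x y
  apply zmodToQMod_injective 2
  rw [← h, ← h, hb]

theorem isSymmetric_assocBilin (q : QuadraticMap ℤ V (QMod 2)) : IsSymmetric (assocBilin q) :=
  fun x y => QuadraticMap.polar_comm q x y

/-- The linear map `a ↦ a e`. -/
def lineMap [Module (ZMod 2) V] (e : V) : ZMod 2 →ₗ[ℤ] V :=
  (LinearMap.toSpanSingleton (ZMod 2) V e).toAddMonoidHom.toIntLinearMap

theorem lineMap_apply [Module (ZMod 2) V] (e : V) (a : ZMod 2) : lineMap e a = a • e := rfl

/-- The linear map `x ↦ B(x, e)`. -/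
def lineProj [Module (ZMod 2) V] (B : LinearMap.BilinMap (ZMod 2) V (ZMod 2)) (e : V) :
    V →ₗ[ℤ] ZMod 2 :=
  (B.flip e).toAddMonoidHom.toIntLinearMap

theorem lineProj_apply [Module (ZMod 2) V] (B : LinearMap.BilinMap (ZMod 2) V (ZMod 2)) (e x : V) :
    lineProj B e x = B x e := rfl

theorem map_line [Module (ZMod 2) V] {q : QuadraticMap ℤ V (QMod 2)} {e : V}
    {w : QuadraticMap ℤ (ZMod 2) (QMod 2)} (h : w 1 = q e) (a : ZMod 2) : q (a • e) = w a := by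
  rcases zmod_two_eq_zero_or_one a with rfl | rfl
  · simp
  · rw [one_smul, h]

theorem bilin_splitting_line [Module (ZMod 2) V] {b : LinearMap.BilinMap ℤ V (QMod 2)}
    {B : LinearMap.BilinMap (ZMod 2) V (ZMod 2)} (hB : BilinLift b B)
    {w : QuadraticMap ℤ (ZMod 2) (QMod 2)} (hw : IsOddLine w) (e : V) (x : V) (y : ZMod 2) :
    assocBilin w (lineProj B e x) y = b x (lineMap e y) := by
  rw [hB, lineMap_apply, map_smul, QuadraticMap.polarBilin_apply_apply, hw, lineProj_apply,
    smul_eq_mul, mul_comm]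

theorem bilin_splitting_pair [Module (ZMod 2) V] {b : LinearMap.BilinMap ℤ V (QMod 2)}
    {B : LinearMap.BilinMap (ZMod 2) V (ZMod 2)} (hB : BilinLift b B)
    {w w' : QuadraticMap ℤ (ZMod 2) (QMod 2)} (hw : IsOddLine w) (hw' : IsOddLine w') (e f : V)
    (x : V) (y : ZMod 2 × ZMod 2) :
    assocBilin (w.prod w') ((lineProj B e).prod (lineProj B f) x) y =
      b x ((lineMap e).coprod (lineMap f) y) := by
  rw [LinearMap.coprod_apply, map_add, ← bilin_splitting_line hB hw,
    ← bilin_splitting_line hB hw', assocBilin_prod]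
  rfl

/-- A vector with `b(e, e) = 1` satisfies `2 q(e) = 1`, so it spans a copy of `w¹` or `w³`. The
vectors of `exists_diagonal_vectors` therefore split off such lines. -/
theorem exists_odd_decomposition [Module (ZMod 2) V] [Finite V] {q : QuadraticMap ℤ V (QMod 2)}
    (hq : QuadNondegenerate q) (he : ¬ IsEven q) :
    ∃ (W : Submodule ℤ V) (q₀ : QuadraticMap ℤ W (QMod 2)), QuadNondegenerate q₀ ∧ IsEven q₀ ∧
      ((∃ ε : ℤ, (ε = 1 ∨ ε = 3) ∧ q.Equivalent (q₀.prod (formW ε))) ∨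
       ∃ ε ε' : ℤ, (ε = 1 ∨ ε = 3) ∧ (ε' = 1 ∨ ε' = 3) ∧
        q.Equivalent (q₀.prod ((formW ε).prod (formW ε')))) := by
  obtain ⟨B, hB⟩ := exists_bilinLift (assocBilin q)
  have hs : IsSymmetric B := hB.isSymmetric (isSymmetric_assocBilin q)
  have h2 : ∀ x, B x x = 1 → 2 • q x = zmodToQMod 2 1 := by
    intro x hx
    rw [← hx, ← hB, QuadraticMap.polarBilin_apply_apply, QuadraticMap.polar_self]
  have heven : ∀ (W : Submodule ℤ V), (∀ x ∈ W, B x x = 0) → IsEven (q.comp W.subtype) := by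
    rintro W hW ⟨x, hx⟩
    have h := hB x x
    rw [hW x hx, map_zero] at h
    rw [← h]
    simp [QuadraticMap.polar]
  rcases exists_diagonal_vectors hs (hB.nondegenerate_iff.1 hq) with h | ⟨c, hc, hcx⟩ |
    ⟨e, f, hee, hff, hef, hx⟩
  · exact absurd (fun x => by rw [hB, h, map_zero]) he
  · obtain ⟨ε, hε, hεc⟩ := exists_formW_one_eq (h2 c hc)
    have hw := isOddLine_formW hε
    have h := equivalent_of_splitting (q := q) hw.nondegenerate (lineMap c) (lineProj B c)
      (bilin_splitting_line hB hw c) (map_line hεc)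
    exact ⟨_, _, (hq.of_equivalent h).of_prod_right, heven _ fun x hx => hcx x hx,
      Or.inl ⟨ε, hε, h.trans (equivalent_prod_comm _ _)⟩⟩
  · obtain ⟨ε, hε, hεe⟩ := exists_formW_one_eq (h2 e hee)
    obtain ⟨ε', hε', hεf⟩ := exists_formW_one_eq (h2 f hff)
    have hw := isOddLine_formW hε
    have hw' := isOddLine_formW hε'
    have h := equivalent_of_splitting (q := q) (hw.nondegenerate.prod hw'.nondegenerate)
      ((lineMap e).coprod (lineMap f)) ((lineProj B e).prod (lineProj B f))
      (bilin_splitting_pair hB hw hw' e f) (fun x => by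
        rw [LinearMap.coprod_apply, lineMap_apply, lineMap_apply, QuadraticMap.map_add (⇑q),
          map_line hεe, map_line hεf]
        have hp : QuadraticMap.polar q (x.1 • e) (x.2 • f) = 0 := by
          have := hB (x.1 • e) (x.2 • f)
          rw [QuadraticMap.polarBilin_apply_apply] at this
          rw [this, show B (x.1 • e) (x.2 • f) = 0 by simp [hef], map_zero]
        rw [hp, add_zero]
        rfl)
    exact ⟨_, _, (hq.of_equivalent h).of_prod_right,
      heven _ fun x hx' => hx x (congrArg Prod.fst hx') (congrArg Prod.snd hx'),
      Or.inr ⟨ε, ε', hε, hε', h.trans (equivalent_prod_comm _ _)⟩⟩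

theorem exists_equivalent_on_coordinates [Finite V] (h2 : ∀ x : V, 2 • x = 0)
    (q : QuadraticMap ℤ V (QMod 2)) :
    ∃ (n : ℕ) (q' : QuadraticMap ℤ (Fin n → ZMod 2) (QMod 2)), q.Equivalent q' := by
  let _ : Module (ZMod 2) V := AddCommGroup.zmodModule h2
  let e : V ≃ₗ[ℤ] (Fin (Module.finrank (ZMod 2) V) → ZMod 2) :=
    (zmodLinearEquivEquiv 2 V _).symm (Module.finBasis (ZMod 2) V).equivFun
  exact ⟨_, q.comp e.symm.toLinearMap, ⟨{ e with map_app' := fun x => by simp }⟩⟩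

theorem IsEven.of_equivalent {W : Type*} [AddCommGroup W] {q : QuadraticMap ℤ V (QMod 2)}
    {q' : QuadraticMap ℤ W (QMod 2)} (h : q.Equivalent q') (hq : IsEven q) : IsEven q' := by
  obtain ⟨f, hf⟩ := bilinIso_of_equivalent h
  intro x
  obtain ⟨y, rfl⟩ := f.surjective x
  rw [hf, hq]

theorem bilinIso_quadPow_formU_succ {W : Type*} [AddCommGroup W]
    {b : LinearMap.BilinMap ℤ V (QMod 2)} {b₀ : LinearMap.BilinMap ℤ W (QMod 2)}
    (h : BilinIso b (bilinSum formUbar b₀)) {m : ℕ} (h₀ : BilinIso b₀ (bilinPow formUbar m)) :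
    BilinIso b (bilinPow formUbar (m + 1)) := by
  have h1 := bilinIso_of_equivalent (quadPow_succ_equivalent formU m).symm
  rw [assocBilin_prod, assocBilin_quadPow, assocBilin_quadPow] at h1
  exact (h.trans (BilinIso.sum_congr ⟨.refl _ _, fun _ _ => rfl⟩ h₀)).trans h1

/-- The symplectic basis argument: any `e ≠ 0` has a partner `f` with `b(e, f) = 1`; the plane they
span splits off and divides the cardinality by four. -/
theorem exists_alternating_decomposition.{u} (n : ℕ) : ∀ (V : Type u) [AddCommGroup V]
    [Module (ZMod 2) V] [Finite V] (b : LinearMap.BilinMap ℤ V (QMod 2)), IsSymmetric b →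
    BilinNondegenerate b → (∀ x, b x x = 0) → Nat.card V = n →
    ∃ m : ℕ, BilinIso b (bilinPow formUbar m) := by
  induction n using Nat.strong_induction_on with
  | _ n ih =>
  intro V _ _ _ b hs hb ha hn
  obtain ⟨B, hB⟩ := exists_bilinLift b
  have hsB := hB.isSymmetric hs
  have haB : ∀ x, B x x = 0 := fun x =>
    zmodToQMod_injective 2 (by rw [← hB, ha, map_zero])
  rcases subsingleton_or_nontrivial V with hV | hV
  · refine ⟨0, LinearEquiv.ofBijective (0 : V →ₗ[ℤ] (Fin 0 → ZMod 2 × ZMod 2))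
      ⟨fun x y _ => Subsingleton.elim x y, fun y => ⟨0, Subsingleton.elim _ _⟩⟩, fun x y => ?_⟩
    rw [Subsingleton.elim x 0]
    simp [bilinPow]
  · obtain ⟨e, he⟩ := exists_ne (0 : V)
    obtain ⟨f, hf⟩ := hB.nondegenerate_iff.1 hb e he
    replace hf := zmod_two_eq_one_of_ne_zero hf
    have hU : BilinNondegenerate formUbar :=
      (quadLift_formH 2).nondegenerate_iff.2 quadNondegenerate_hypPlane
    have hval : ∀ x y : ZMod 2 × ZMod 2, formUbar x y = zmodToQMod 2 (x.1 * y.2 + x.2 * y.1) := by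
      intro x y
      rw [(quadLift_formH 2).polar x y, QuadraticMap.polarBilin_apply_apply, polar_hypPlane]
    have hπ : ∀ x y, formUbar ((lineProj B f).prod (lineProj B e) x) y =
        b x ((lineMap e).coprod (lineMap f) y) := by
      intro x y
      rw [hval, hB, LinearMap.coprod_apply, lineMap_apply, lineMap_apply, map_add (B x),
        map_smul (B x), map_smul (B x), smul_eq_mul, smul_eq_mul]
      congr 1
      change B x f * y.2 + B x e * y.1 = _
      ring
    have hφ : ∀ x y, b ((lineMap e).coprod (lineMap f) x) ((lineMap e).coprod (lineMap f) y) =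
        formUbar x y := by
      intro x y
      rw [← hπ, hval, hval]
      congr 1
      simp only [LinearMap.prod_apply, Function.prod, LinearMap.coprod_apply, lineMap_apply,
        lineProj_apply, map_add, map_smul, LinearMap.smul_apply, haB, hf, hsB f e,
        smul_eq_mul]
      simp
    have h := bilinIso_of_splitting hs hU _ _ hπ hφ
    have hW2 : ∀ x : LinearMap.ker ((lineProj B f).prod (lineProj B e)), 2 • x = 0 :=
      fun x => Subtype.ext (ZModModule.char_nsmul_eq_zero 2 x.1)
    let _ : Module (ZMod 2) (LinearMap.ker ((lineProj B f).prod (lineProj B e))) :=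
      AddCommGroup.zmodModule hW2
    have hb₀ := (hb.of_iso h).of_sum_right
    have hcard : Nat.card V =
        4 * Nat.card (LinearMap.ker ((lineProj B f).prod (lineProj B e))) := by
      obtain ⟨g, -⟩ := h
      rw [Nat.card_congr g.toEquiv, Nat.card_prod, Nat.card_prod, Nat.card_zmod]
    have hpos : 0 < Nat.card (LinearMap.ker ((lineProj B f).prod (lineProj B e))) := Nat.card_pos
    obtain ⟨m, hm⟩ := ih _ (by omega) (LinearMap.ker ((lineProj B f).prod (lineProj B e))) _
      (fun x y => hs x y) hb₀ (fun x => ha x) rfl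
    exact ⟨m + 1, bilinIso_quadPow_formU_succ h hm⟩

theorem exists_bilin_decomposition [Module (ZMod 2) V] [Finite V]
    {b : LinearMap.BilinMap ℤ V (QMod 2)} (hs : IsSymmetric b) (hb : BilinNondegenerate b) :
    ∃ m : ℕ, BilinIso b (bilinPow formUbar m) ∨
      BilinIso b (bilinSum (bilinPow formUbar m) formWbar) ∨
      BilinIso b (bilinSum (bilinPow formUbar m) (bilinSum formWbar formWbar)) := by
  obtain ⟨B, hB⟩ := exists_bilinLift b
  have hsB := hB.isSymmetric hs
  have hw := isOddLine_formW (Or.inl rfl : (1 : ℤ) = 1 ∨ (1 : ℤ) = 3)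
  have hker : ∀ W : Submodule ℤ V, (∀ x ∈ W, B x x = 0) →
      BilinNondegenerate (b.compl₁₂ W.subtype W.subtype) →
      ∃ m, BilinIso (b.compl₁₂ W.subtype W.subtype) (bilinPow formUbar m) := by
    intro W hW hbW
    let _ : Module (ZMod 2) W := AddCommGroup.zmodModule (n := 2)
      fun x => Subtype.ext (ZModModule.char_nsmul_eq_zero 2 x.1)
    refine exists_alternating_decomposition _ W _ (fun x y => hs x y) hbW (fun x => ?_) rfl
    change b x x = 0
    rw [hB, hW x x.2, map_zero]
  rcases exists_diagonal_vectors hsB (hB.nondegenerate_iff.1 hb) with h | ⟨c, hc, hcx⟩ |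
    ⟨e, f, hee, hff, hef, hx⟩
  · obtain ⟨m, hm⟩ := exists_alternating_decomposition _ V b hs hb
      (fun x => by rw [hB, h, map_zero]) rfl
    exact ⟨m, Or.inl hm⟩
  · have h := bilinIso_of_splitting hs hw.nondegenerate (lineMap c) (lineProj B c)
      (bilin_splitting_line hB hw c) (fun x y => by
        rw [← bilin_splitting_line hB hw, lineProj_apply, lineMap_apply, map_smul,
          LinearMap.smul_apply, hc, smul_eq_mul, mul_one])
    obtain ⟨m, hm⟩ := hker _ (fun x hx => hcx x hx) (hb.of_iso h).of_sum_right
    exact ⟨m, Or.inr (Or.inl ((h.trans (bilinIso_sum_comm _ _)).trans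
      (hm.sum_congr ⟨.refl _ _, fun _ _ => rfl⟩)))⟩
  · have h := bilinIso_of_splitting hs (hw.nondegenerate.prod hw.nondegenerate)
      ((lineMap e).coprod (lineMap f)) ((lineProj B e).prod (lineProj B f))
      (bilin_splitting_pair hB hw hw e f) (fun x y => by
        rw [← bilin_splitting_pair hB hw hw]
        have hπ : (lineProj B e).prod (lineProj B f) ((lineMap e).coprod (lineMap f) x) = x := by
          refine Prod.ext ?_ ?_
          · change B ((lineMap e).coprod (lineMap f) x) e = x.1
            simp [lineMap_apply, hee, hsB f e, hef]
          · change B ((lineMap e).coprod (lineMap f) x) f = x.2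
            simp [lineMap_apply, hff, hef]
        rw [hπ])
    obtain ⟨m, hm⟩ := hker _ (fun x hx' => hx x (congrArg Prod.fst hx') (congrArg Prod.snd hx'))
      (hb.of_iso h).of_sum_right
    rw [assocBilin_prod] at h
    exact ⟨m, Or.inr (Or.inr ((h.trans (bilinIso_sum_comm _ _)).trans
      (hm.sum_congr ⟨.refl _ _, fun _ _ => rfl⟩)))⟩

end Decomposition

end ElementaryForms

/-! ### Assembly of the classification and the orders -/

open ElementaryForms in
theorem mainTheorem3 :
    -- Quadratic forms for the prime 2: every form is of one of the types in the table.
    (∀ (V : Type*) [AddCommGroup V] [Module (ZMod 2) V] [Finite V]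
      (q : QuadraticMap ℤ V (QMod 2)), QuadNondegenerate q →
      (IsEven q →
        (∃ m : ℕ, q.Equivalent (quadPow formU m)) ∨
        (∃ m : ℕ, 1 ≤ m ∧ q.Equivalent ((quadPow formU (m - 1)).prod formV))) ∧
      (¬ IsEven q →
        ∃ (n : ℕ) (q' : QuadraticMap ℤ (Fin n → ZMod 2) (QMod 2)),
          QuadNondegenerate q' ∧ IsEven q' ∧
          ((∃ ε : ℤ, (ε = 1 ∨ ε = 3) ∧ q.Equivalent (q'.prod (formW ε))) ∨
           (∃ ε : ℤ, (ε = 1 ∨ ε = 3) ∧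
              q.Equivalent (q'.prod ((formW ε).prod (formW ε)))) ∨
           q.Equivalent (q'.prod ((formW 1).prod (formW 3)))))) ∧
    -- The orders in the even case.
    (∀ (V : Type*) [AddCommGroup V] [Module (ZMod 2) V] [Finite V]
      (q : QuadraticMap ℤ V (QMod 2)), QuadNondegenerate q → ∀ m : ℕ,
      (m = 0 → q.Equivalent (quadPow formU m) →
        Nat.card (quadO q) = 1 ∧ Nat.card (q ⁻¹' {0}) = 1) ∧
      (1 ≤ m → q.Equivalent (quadPow formU m) →
        Nat.card (quadO q) =
          2 ^ (m * (m - 1) + 1) * (2 ^ m - 1) * ∏ k ∈ Finset.Icc 1 (m - 1), (2 ^ (2 * k) - 1) ∧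
        Nat.card (q ⁻¹' {0}) = 2 ^ (m - 1) * (2 ^ m + 1)) ∧
      (1 ≤ m → q.Equivalent ((quadPow formU (m - 1)).prod formV) →
        Nat.card (quadO q) =
          2 ^ (m * (m - 1) + 1) * (2 ^ m + 1) * ∏ k ∈ Finset.Icc 1 (m - 1), (2 ^ (2 * k) - 1) ∧
        Nat.card (q ⁻¹' {0}) = 2 ^ (m - 1) * (2 ^ m - 1))) ∧
    -- The orders in the remaining cases.
    (∀ (V V' : Type*) [AddCommGroup V] [Module (ZMod 2) V] [Finite V]
      [AddCommGroup V'] [Module (ZMod 2) V'] [Finite V']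
      (q : QuadraticMap ℤ V (QMod 2)) (q' : QuadraticMap ℤ V' (QMod 2)),
      QuadNondegenerate q → QuadNondegenerate q' → IsEven q' →
      (∀ ε : ℤ, (ε = 1 ∨ ε = 3) → q.Equivalent (q'.prod (formW ε)) →
        Nat.card (quadO q) = Nat.card (quadO q') ∧
        Nat.card (q ⁻¹' {0}) = Nat.card (q' ⁻¹' {0})) ∧
      (∀ ε : ℤ, (ε = 1 ∨ ε = 3) → q.Equivalent (q'.prod ((formW ε).prod (formW ε))) →
        Nat.card (quadO q) = 2 * Nat.card (bilinO (assocBilin q')) ∧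
        Nat.card (q ⁻¹' {0}) = 2 ^ Module.finrank (ZMod 2) V') ∧
      (q.Equivalent (q'.prod ((formW 1).prod (formW 3))) →
        Nat.card (quadO q) = 2 ^ Module.finrank (ZMod 2) V' * Nat.card (quadO q') ∧
        Nat.card (q ⁻¹' {0}) = 2 * Nat.card (q' ⁻¹' {0}))) ∧
    -- Symmetric bilinear forms for the prime 2: normal forms and orders.
    (∀ (V : Type*) [AddCommGroup V] [Module (ZMod 2) V] [Finite V]
      (b : LinearMap.BilinMap ℤ V (QMod 2)), IsSymmetric b → BilinNondegenerate b →
      (∃ m : ℕ,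
        BilinIso b (bilinPow formUbar m) ∨
        BilinIso b (bilinSum (bilinPow formUbar m) formWbar) ∨
        BilinIso b (bilinSum (bilinPow formUbar m) (bilinSum formWbar formWbar))) ∧
      (∀ m : ℕ,
        (BilinIso b (bilinPow formUbar m) →
          Nat.card (bilinO b) = 2 ^ (m ^ 2) * ∏ k ∈ Finset.Icc 1 m, (2 ^ (2 * k) - 1)) ∧
        (BilinIso b (bilinSum (bilinPow formUbar m) formWbar) →
          Nat.card (bilinO b) = Nat.card (bilinO (bilinPow formUbar m))) ∧
        (BilinIso b (bilinSum (bilinPow formUbar m) (bilinSum formWbar formWbar)) →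
          Nat.card (bilinO b) = 2 ^ (2 * m + 1) * Nat.card (bilinO (bilinPow formUbar m))))) ∧
    -- Quadratic forms for odd primes.
    (∀ (p : ℕ), p.Prime → p ≠ 2 →
      ∀ (V : Type*) [AddCommGroup V] [Module (ZMod p) V] [Finite V]
        (q : QuadraticMap ℤ V (QMod p)), QuadNondegenerate q → ∀ m : ℕ,
      (m = 0 → Module.finrank (ZMod p) V = 2 * m → Nat.card (quadO q) = 1) ∧
      (1 ≤ m → Module.finrank (ZMod p) V = 2 * m → IsHyperbolic p q →
        Nat.card (quadO q) =
          2 * p ^ (m * (m - 1)) * (p ^ m - 1) * ∏ k ∈ Finset.Icc 1 (m - 1), (p ^ (2 * k) - 1)) ∧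
      (1 ≤ m → Module.finrank (ZMod p) V = 2 * m → ¬ IsHyperbolic p q →
        Nat.card (quadO q) =
          2 * p ^ (m * (m - 1)) * (p ^ m + 1) * ∏ k ∈ Finset.Icc 1 (m - 1), (p ^ (2 * k) - 1)) ∧
      (Module.finrank (ZMod p) V = 2 * m + 1 →
        Nat.card (quadO q) = 2 * p ^ (m ^ 2) * ∏ k ∈ Finset.Icc 1 m, (p ^ (2 * k) - 1))) := by
  refine ⟨?_, ?_, ?_, ?_, ?_⟩
  · intro V _ _ _ q hq
    refine ⟨fun he => ?_, fun he => ?_⟩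
    · obtain ⟨Q, hQ⟩ := exists_quadLift (smul_eq_zero_of_isEven he)
      rcases equivalent_quadPow_or_of_nondegenerate (hQ.nondegenerate_iff.1 hq) with
        ⟨m, hm⟩ | ⟨m, hm⟩
      · exact Or.inl ⟨m, (hQ.equivalent_iff ((quadLift_formH 2).quadPow m)).2 hm⟩
      -- The index `m` of the table counts the anisotropic plane as well.
      · exact Or.inr ⟨m + 1, by omega,
          (hQ.equivalent_iff (((quadLift_formH 2).quadPow m).prod quadLift_formV)).2 hm⟩
    · obtain ⟨W, q₀, hq₀, he₀, h⟩ := exists_odd_decomposition hq he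
      obtain ⟨n, q', hf⟩ := exists_equivalent_on_coordinates
        (fun x : W => Subtype.ext (ZModModule.char_nsmul_eq_zero 2 x.1)) q₀
      refine ⟨n, q', hq₀.of_equivalent hf, he₀.of_equivalent hf, ?_⟩
      rcases h with ⟨ε, hε, h⟩ | ⟨ε, ε', hε, hε', h⟩
      · exact Or.inl ⟨ε, hε, h.trans (hf.prod (.refl _))⟩
      · replace h := h.trans (hf.prod (.refl _))
        rcases hε with rfl | rfl <;> rcases hε' with rfl | rfl
        · exact Or.inr (Or.inl ⟨1, Or.inl rfl, h⟩)
        · exact Or.inr (Or.inr h)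
        · exact Or.inr (Or.inr (h.trans
            ((QuadraticMap.Equivalent.refl _).prod (equivalent_prod_comm _ _))))
        · exact Or.inr (Or.inl ⟨3, Or.inr rfl, h⟩)
  · intro V _ _ _ q hq m
    refine ⟨fun hm h => ?_, fun hm h => ?_, fun hm h => ?_⟩
    · subst hm
      have hl := (quadLift_formH 2).quadPow 0
      rw [card_quadO_congr h, card_preimage_congr h, hl.card_quadO, hl.preimage_zero,
        card_quadO_of_subsingleton,
        card_zeros_of_anisotropic fun x _ => Subsingleton.elim x 0]
      exact ⟨rfl, rfl⟩
    · obtain ⟨m, rfl⟩ := Nat.exists_eq_add_of_le' hm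
      have hl := (quadLift_formH 2).quadPow (m + 1)
      rw [card_quadO_congr h, card_preimage_congr h, hl.card_quadO, hl.preimage_zero,
        card_quadO_quadPow_hypPlane, card_zeros_quadPow_hypPlane, Nat.add_sub_cancel,
        mul_comm (m + 1) m]
      exact ⟨rfl, rfl⟩
    · obtain ⟨m, rfl⟩ := Nat.exists_eq_add_of_le' hm
      rw [Nat.add_sub_cancel] at h
      have hl := ((quadLift_formH 2).quadPow m).prod quadLift_formV
      rw [card_quadO_congr h, card_preimage_congr h, hl.card_quadO, hl.preimage_zero,
        card_quadO_quadPow_hypPlane_prod_anisotropicPlane,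
        card_zeros_quadPow_hypPlane_prod_anisotropicPlane, Nat.add_sub_cancel,
        mul_comm (m + 1) m]
      exact ⟨rfl, rfl⟩
  · intro V V' _ _ _ _ _ _ q q' hq hq' he
    -- Only the even part `q'` lifts to `ℤ/2ℤ`; the odd lines keep their values in `ℚ/2ℤ`.
    obtain ⟨Q, hQ⟩ := exists_quadLift (smul_eq_zero_of_isEven he)
    have hV' : Nat.card V' = 2 ^ Module.finrank (ZMod 2) V' := by
      rw [Module.natCard_eq_pow_finrank (K := ZMod 2), Nat.card_zmod]
    refine ⟨fun ε hε h => ?_, fun ε hε h => ?_, fun h => ?_⟩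
    · have hw := isOddLine_formW hε
      replace h := h.trans (equivalent_prod_comm _ _)
      rw [card_quadO_congr h, card_preimage_congr h]
      exact ⟨card_quadO_line_prod hw hq' he, card_zeros_line_prod hw hQ⟩
    · have hw := isOddLine_formW hε
      replace h := h.trans (equivalent_prod_comm _ _)
      rw [card_quadO_congr h, card_preimage_congr h, ← hV']
      exact ⟨card_quadO_equal_pair_prod hw hq' he hQ, card_zeros_equal_pair_prod hw hQ⟩
    · have hw₁ := isOddLine_formW (Or.inl rfl : (1 : ℤ) = 1 ∨ (1 : ℤ) = 3)
      have hw₃ := isOddLine_formW (Or.inr rfl : (3 : ℤ) = 1 ∨ (3 : ℤ) = 3)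
      replace h := h.trans (equivalent_prod_comm _ _)
      rw [card_quadO_congr h, card_preimage_congr h, ← hV']
      exact ⟨card_quadO_neg_pair_prod hw₁ hw₃ formW_one_add_formW_three hq' he hQ,
        card_zeros_neg_pair_prod hw₁ hw₃ formW_one_add_formW_three hQ⟩
  · intro V _ _ _ b hs hb
    refine ⟨exists_bilin_decomposition hs hb, fun m => ?_⟩
    have hw := isOddLine_formW (Or.inl rfl : (1 : ℤ) = 1 ∨ (1 : ℤ) = 3)
    have hl := (quadLift_formH 2).quadPow m
    have hn : QuadNondegenerate (quadPow formU m) :=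
      hl.nondegenerate_iff.2 (quadNondegenerate_quadPow_hypPlane _ m)
    have he : IsEven (quadPow formU m) := fun x => by
      rw [hl.polar, QuadraticMap.polarBilin_apply_apply, polar_self_eq_zero, map_zero]
    refine ⟨fun h => ?_, fun h => ?_, fun h => ?_⟩
    · rw [card_bilinO_congr h, ← assocBilin_quadPow, hl.polar.card_bilinO,
        card_bilinO_quadPow_hypPlane]
    · rw [card_bilinO_congr (h.trans (bilinIso_sum_comm _ _)), ← assocBilin_quadPow]
      exact card_bilinO_line_prod hw hn he
    · rw [card_bilinO_congr (h.trans (bilinIso_sum_comm _ _)), ← assocBilin_quadPow,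
        ← assocBilin_prod, card_bilinO_pair_prod hw hw hn he hl]
      congr 1
      simp only [Nat.card_fun, Nat.card_prod, Nat.card_zmod, Nat.card_fin]
      rw [pow_succ, pow_mul]
      ring
  · intro p hp hp2 V _ _ _ q hq m
    have : Fact p.Prime := ⟨hp⟩
    obtain ⟨Q, hQ⟩ := exists_quadLift (smul_eq_zero_of_odd hp2 q)
    have hQn := hQ.nondegenerate_iff.1 hq
    have hK : ringChar (ZMod p) ≠ 2 := by rwa [ZMod.ringChar_zmod_n]
    have hH : ∀ n, q.Equivalent (quadPow (formH p) n) ↔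
        Q.Equivalent (quadPow (hypPlane (ZMod p)) n) :=
      fun n => hQ.equivalent_iff ((quadLift_formH p).quadPow n)
    refine ⟨fun hm hV => ?_, fun hm hV h => ?_, fun hm hV h => ?_, fun hV => ?_⟩
    · rw [hm, mul_zero] at hV
      have := Module.finrank_zero_iff.1 hV
      rw [hQ.card_quadO, card_quadO_of_subsingleton]
    · obtain ⟨m, rfl⟩ := Nat.exists_eq_add_of_le' hm
      obtain ⟨n, hn⟩ := h
      rw [hH] at hn
      -- Hyperbolicity gives some number of planes; the dimension determines it.
      have hnm : n = m + 1 := by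
        obtain ⟨f⟩ := hn
        have := f.toLinearEquiv.finrank_eq
        rw [hV, finrank_quadPow_hypPlane_domain] at this
        omega
      rw [hnm] at hn
      rw [hQ.card_quadO, card_quadO_of_hyperbolic hn, Nat.card_zmod, Nat.add_sub_cancel,
        mul_comm (m + 1) m]
    · obtain ⟨m, rfl⟩ := Nat.exists_eq_add_of_le' hm
      rw [hQ.card_quadO, card_quadO_of_not_hyperbolic hK hQn hV
        fun n hn => h ⟨n, (hH n).2 hn⟩, Nat.card_zmod, Nat.add_sub_cancel, mul_comm (m + 1) m]
    · rw [hQ.card_quadO, card_quadO_of_odd_finrank hK hQn hV, Nat.card_zmod]
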